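/- **Setting.** Let $M$ be a flip manifold: take finitely many products $M_i=F_i\times S^1$, where each $F_i$ is a compact connected oriented hyperbolic surface whose boundary is a (possibly empty) finite union of totally geodesic circles of length $1$ and $S^1=\mathbb R/\mathbb Z$, and glue some pairs of distinct boundary tori by orientation-reversing isometries which interchange the base and the fibre directions (each boundary torus is glued at most once; some may stay unglued), so that $M$ is connected. Each piece carries the product metric. Let $p\colon\tilde M\to M$ be the universal cover and let $d$ be the induced path metric on $\tilde M$ (the lift of the Kapovich--Leeb metric). A *piece* of $\tilde M$ is the image of a lift to $\tilde M$ of the map $\tilde F_i\times\mathbb R\to F_i\times S^1\to M$, where $\tilde F_i$ is the universal cover of $F_i$, a convex domain in the hyperbolic plane; it has product coordinates $\tilde F_i\times\mathbb R$, and $\tilde F_i$ is identified with $\tilde F_i\times\{0\}$. **Special paths.** Let $x,y\in\tilde M$. If $x$ and $y$ lie in a common piece, a special path from $x$ to $y$ is a geodesic from $x$ to $y$. Otherwise, let a geodesic from $x$ to $y$ pass successively through pairwise distinct pieces $\tilde M_0,\dots,\tilde M_n$, with $\tilde M_k=\tilde F_k\times\mathbb R$, $n\ge 1$, $x\in\tilde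 M_0$, $y\in\tilde M_n$, and put $\tilde T_k=\tilde M_k\cap\tilde M_{k+1}$ for $0\le k<n$. For $0<k<n$ let $p_k\in\tilde T_{k-1}\cap\tilde F_k$ and $q_k\in\tilde T_k\cap\tilde F_k$ be the endpoints of the shortest path in $\tilde F_k$ between these two boundary lines. Let $p_0$ be the projection of $x$ to $\tilde F_0$ and $q_0$ the point of $\tilde T_0\cap\tilde F_0$ closest to $p_0$; let $q_n$ be the projection of $y$ to $\tilde F_n$ and $p_n$ the point of $\tilde T_{n-1}\cap\tilde F_n$ closest to $q_n$. Put $x_0=x$, $x_{n+1}=y$, and for $0\le k<n$ let $x_{k+1}\in\tilde T_k$ be the intersection point of the fibre $\{q_k\}\times\mathbb R$ of $\tilde M_k$ with the fibre $\{p_{k+1}\}\times\mathbb R$ of $\tilde M_{k+1}$. A special path from $x$ to $y$ is then the concatenation of geodesics from $x_k$ to $x_{k+1}$, $k=0,\dots,n$. Special paths are parametrised by arc length. **Proposition.** For every flip manifold $M$ there is a constant $c\ge 1$, depending only on $M$, such that every special path $\gamma\colon[0,L]\to\tilde M$ is a $(c,c)$-quasi-geodesic, that is, for all $s,t\in[0,L]$,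 $$\frac1c\,|s-t|-c\;\le\; d(\gamma(s),\gamma(t))\;\le\; c\,|s-t|+c .$$ -/

import Mathlib

open scoped MatrixGroups

/-! ### Compact hyperbolic surfaces with geodesic boundary -/

/-- The point `exp t * i` of the hyperbolic plane: `t ↦ axisPoint t` parametrises the imaginary
half-axis as a unit speed geodesic. -/
noncomputable def axisPoint (t : ℝ) : UpperHalfPlane :=
  ⟨⟨0, Real.exp t⟩, Real.exp_pos t⟩

/-- A compact connected oriented hyperbolic surface whose boundary is a (possibly empty) finite
union of totally geodesic circles of length one. It is presented as the quotient of its universal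
cover, a closed convex domain of the hyperbolic plane bounded by disjoint complete geodesics, by a
Fuchsian group acting freely and cocompactly on this domain. (The group is taken in `SL(2, ℝ)`,
whose action on the plane factors through `PSL(2, ℝ)`.) -/
structure HyperbolicSurface where
  /-- the universal cover, as a domain in the hyperbolic plane -/
  cover : Set UpperHalfPlane
  /-- the group of covering transformations -/
  group : Subgroup SL(2, ℝ)
  isClosed_cover : IsClosed cover
  interior_nonempty : (interior cover).Nonempty
  /-- the domain contains the geodesic segment between any two of its points -/
  convex : ∀ x ∈ cover, ∀ y ∈ cover, ∀ z : UpperHalfPlane,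
    dist x z + dist z y = dist x y → z ∈ cover
  smul_mem : ∀ g ∈ group, ∀ z ∈ cover, g • z ∈ cover
  /-- an element with a fixed point in the domain acts trivially -/
  free : ∀ g ∈ group, ∀ z ∈ cover, g • z = z → ∀ w : UpperHalfPlane, g • w = w
  properlyDiscontinuous : ∀ K : Set UpperHalfPlane, IsCompact K →
    {g : SL(2, ℝ) | g ∈ group ∧ ∃ z ∈ K, g • z ∈ K}.Finite
  /-- the quotient surface is compact -/
  cocompact : ∃ K ⊆ cover, IsCompact K ∧ ∀ z ∈ cover, ∃ g ∈ group, g • z ∈ K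
  /-- the set of boundary circles of the surface -/
  Bdry : Type
  finite_bdry : Finite Bdry
  /-- the geodesic line `t ↦ frame b • axisPoint t` is a chosen lift of the boundary circle `b` -/
  frame : Bdry → SL(2, ℝ)
  /-- the lifts of the boundary circles form the boundary of the domain -/
  frontier_eq : frontier cover =
    {z | ∃ g ∈ group, ∃ b : Bdry, ∃ t : ℝ, z = g • frame b • axisPoint t}
  /-- the domain lies on the right hand side of each of the chosen lines -/
  cover_side : ∀ b : Bdry, ∀ z ∈ cover, 0 ≤ ((frame b)⁻¹ • z).re
  /-- each boundary circle closes up after length one -/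
  exists_translation : ∀ b : Bdry, ∃ g ∈ group, ∀ t : ℝ,
    g • frame b • axisPoint t = frame b • axisPoint (t + 1)
  /-- there are no other identifications between points of the chosen lines: the boundary circles
  are simple, of length exactly one, and pairwise disjoint -/
  line_inj : ∀ g ∈ group, ∀ (b b' : Bdry) (s t : ℝ),
    g • frame b • axisPoint s = frame b' • axisPoint t → b = b' ∧ ∃ n : ℤ, t = s + n

namespace HyperbolicSurface

variable (F : HyperbolicSurface)

theorem line_mem_cover (b : F.Bdry) (t : ℝ) : F.frame b • axisPoint t ∈ F.cover := by
  apply F.isClosed_cover.frontier_subset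
  rw [F.frontier_eq]
  exact ⟨1, F.group.one_mem, b, t, by rw [one_smul]⟩

/-- The chosen lift of the boundary circle `b`, parametrised by arc length. -/
noncomputable def line (b : F.Bdry) (t : ℝ) : F.cover :=
  ⟨F.frame b • axisPoint t, F.line_mem_cover b t⟩

/-- Two points of the universal cover are equivalent if a covering transformation maps one to the
other. -/
def deckSetoid : Setoid F.cover where
  r z w := ∃ g ∈ F.group, g • (z : UpperHalfPlane) = w
  iseqv :=
    { refl := fun z => ⟨1, F.group.one_mem, one_smul _ _⟩
      symm := by
        rintro z w ⟨g, hg, h⟩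
        exact ⟨g⁻¹, F.group.inv_mem hg, by rw [← h, inv_smul_smul]⟩
      trans := by
        rintro z w v ⟨g, hg, h⟩ ⟨k, hk, h'⟩
        exact ⟨k * g, F.group.mul_mem hk hg, by rw [mul_smul, h, h']⟩ }

/-- The surface itself. -/
abbrev Surface : Type := Quotient F.deckSetoid

/-- The universal covering map of the surface. -/
def proj (z : F.cover) : F.Surface := Quotient.mk F.deckSetoid z

end HyperbolicSurface

/-! ### Flip manifolds -/

/-- The gluing data of a flip manifold: finitely many products `F × S¹` of compact oriented
hyperbolic surfaces (with geodesic boundary circles of length one) with a circle of length one, and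
finitely many tori, each of which identifies a boundary torus with another boundary torus by an
isometry interchanging the base and the fibre directions. Boundary tori may stay unglued. -/
structure FlipManifold where
  Piece : Type
  finite_piece : Finite Piece
  surface : Piece → HyperbolicSurface
  /-- the gluing tori -/
  Torus : Type
  finite_torus : Finite Torus
  /-- the first of the two boundary tori that are identified -/
  left : Torus → Σ i, (surface i).Bdry
  /-- the second of the two boundary tori that are identified -/
  right : Torus → Σ i, (surface i).Bdry
  /-- a boundary torus is glued at most once, and never to itself -/
  injective_sides : Function.Injective (Sum.elim left right)
  /-- The flip along a torus is `(s, t) ↦ (± t + a, ± s + a')`, where `s` is the arc length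
  parameter of the boundary circle and `t` the one of the fibre. As all boundary circles are
  parametrised with the surface on their right hand side, the two signs have to be equal in order
  that the orientations of the pieces match. -/
  sign : Torus → ℤˣ
  baseShift : Torus → ℝ
  fibreShift : Torus → ℝ

namespace FlipManifold

variable (M : FlipManifold)

/-- The disjoint union of the pieces `F × S¹`. -/
abbrev PreTotal : Type := Σ i : M.Piece, (M.surface i).Surface × AddCircle (1 : ℝ)

/-- The identifications of points on the boundary tori. -/
inductive Glue : M.PreTotal → M.PreTotal → Prop
  | flip (τ : M.Torus) (s t : ℝ) :
      Glue
        ⟨(M.left τ).1,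
          ((M.surface (M.left τ).1).proj ((M.surface (M.left τ).1).line (M.left τ).2 s),
            (t : AddCircle (1 : ℝ)))⟩
        ⟨(M.right τ).1,
          ((M.surface (M.right τ).1).proj ((M.surface (M.right τ).1).line (M.right τ).2
              (((M.sign τ : ℤ) : ℝ) * t + M.baseShift τ)),
            ((((M.sign τ : ℤ) : ℝ) * s + M.fibreShift τ : ℝ) : AddCircle (1 : ℝ)))⟩

/-- The flip manifold as a topological space, with the quotient topology. -/
abbrev Total : Type := Quot M.Glue

/-- The composition of the universal covering `F̃ × ℝ → F × S¹` of a piece with the map from the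
piece to the flip manifold. -/
def pieceMap (i : M.Piece) (u : (M.surface i).cover × ℝ) : M.Total :=
  Quot.mk M.Glue ⟨i, ((M.surface i).proj u.1, (u.2 : AddCircle (1 : ℝ)))⟩

/-! ### Pieces and metric of the universal cover

From here on `p : X → M.Total` is the universal covering. -/

/-- A piece `F̃ × ℝ` of the universal cover, together with its product coordinates: a lift of the
universal covering of a piece of the manifold. -/
structure CoverPiece {X : Type*} [TopologicalSpace X] (p : X → M.Total) where
  idx : M.Piece
  toFun : (M.surface idx).cover × ℝ → X
  continuous_toFun : Continuous toFun
  lift : ∀ u, p (toFun u) = M.pieceMap idx u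

variable {M} {X : Type*} [TopologicalSpace X] {p : X → M.Total}

namespace CoverPiece

/-- The universal cover `F̃` of the base surface of a piece. -/
abbrev Base (P : M.CoverPiece p) : Type := (M.surface P.idx).cover

/-- The set of points of a piece. -/
def carrier (P : M.CoverPiece p) : Set X := Set.range P.toFun

/-- The product metric of the hyperbolic metric on `F̃` and the Euclidean metric on `ℝ`. -/
noncomputable def prodDist (P : M.CoverPiece p) (u v : P.Base × ℝ) : ℝ :=
  Real.sqrt (dist u.1 v.1 ^ 2 + dist u.2 v.2 ^ 2)

/-- The intersection of `F̃ = F̃ × {0}` with the common boundary plane of `P` and an adjacent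
piece `Q`. -/
def boundaryLine (P Q : M.CoverPiece p) : Set P.Base :=
  {z | P.toFun (z, 0) ∈ Q.carrier}

end CoverPiece

/-- `BrokenGeodesic p x y L`: there is a path of length `L` from `x` to `y` which is a concatenation
of finitely many segments, each of them a geodesic of the product metric of some piece. -/
inductive BrokenGeodesic (p : X → M.Total) : X → X → ℝ → Prop
  | refl (x : X) : BrokenGeodesic p x x 0
  | step {x : X} {L : ℝ} (P : M.CoverPiece p) (u v : P.Base × ℝ) :
      BrokenGeodesic p x (P.toFun u) L →
        BrokenGeodesic p x (P.toFun v) (L + P.prodDist u v)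

/-- The path metric on the universal cover which is induced by the product metrics of the pieces:
the infimum of the lengths of the broken geodesics between two points. -/
noncomputable def coverDist (p : X → M.Total) (x y : X) : ENNReal :=
  ⨅ (L : ℝ) (_ : BrokenGeodesic p x y L), ENNReal.ofReal L

/-- The restriction of `γ` to `[a, b]` is a unit speed geodesic from `x` to `y`. -/
def IsGeodesic (p : X → M.Total) (γ : ℝ → X) (a b : ℝ) (x y : X) : Prop :=
  a ≤ b ∧ γ a = x ∧ γ b = y ∧
    ∀ s ∈ Set.Icc a b, ∀ t ∈ Set.Icc a b, coverDist p (γ s) (γ t) = ENNReal.ofReal |s - t|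

/-- The restriction of `γ` to `[a, b]` is a `(K, C)`-quasi-geodesic. -/
def IsQuasiGeodesic (p : X → M.Total) (K C : ℝ) (γ : ℝ → X) (a b : ℝ) : Prop :=
  ∀ s ∈ Set.Icc a b, ∀ t ∈ Set.Icc a b,
    ENNReal.ofReal (K⁻¹ * |s - t| - C) ≤ coverDist p (γ s) (γ t) ∧
      coverDist p (γ s) (γ t) ≤ ENNReal.ofReal (K * |s - t| + C)

/-! ### Special paths -/

/-- A geodesic from `x` to `y` passes successively through the pieces `P 0, …, P n`, which are
pairwise distinct. -/
def PassesThrough (p : X → M.Total) (x y : X) (n : ℕ) (P : ℕ → M.CoverPiece p) : Prop :=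
  Set.InjOn (fun k => (P k).carrier) (Set.Iic n) ∧
    ∃ (D : ℝ) (δ : ℝ → X) (r : ℕ → ℝ),
      IsGeodesic p δ 0 D x y ∧ r 0 = 0 ∧ r (n + 1) = D ∧
        ∀ k ≤ n, r k ≤ r (k + 1) ∧ ∀ t ∈ Set.Icc (r k) (r (k + 1)), δ t ∈ (P k).carrier

/-- The points `a k`, `b k` of the base `F̃ k` of the piece `P k`, for `0 ≤ k ≤ n`, where `1 ≤ n`:
for `0 < k < n` they are the endpoints of the shortest path in `F̃ k` between its boundary lines on
the sides of `P (k - 1)` and `P (k + 1)`; `a 0` is the projection of `x`, and `b 0` the point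
closest to it on the boundary line on the side of `P 1`; `b n` is the projection of `y`, and
`a n` the point closest to it on the boundary line on the side of `P (n - 1)`. -/
structure IsTurningData (x y : X) (n : ℕ) (P : ℕ → M.CoverPiece p)
    (a b : ∀ k, (P k).Base) : Prop where
  left_mem : ∀ k < n, a (k + 1) ∈ (P (k + 1)).boundaryLine (P k)
  right_mem : ∀ k < n, b k ∈ (P k).boundaryLine (P (k + 1))
  shortest : ∀ k, k + 1 < n → ∀ u ∈ (P (k + 1)).boundaryLine (P k),
    ∀ v ∈ (P (k + 1)).boundaryLine (P (k + 2)), dist (a (k + 1)) (b (k + 1)) ≤ dist u v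
  start : ∃ t : ℝ, (P 0).toFun (a 0, t) = x
  start_closest : ∀ u ∈ (P 0).boundaryLine (P 1), dist (a 0) (b 0) ≤ dist (a 0) u
  finish : ∃ t : ℝ, (P n).toFun (b n, t) = y
  finish_closest : ∀ k, k + 1 = n → ∀ u ∈ (P (k + 1)).boundaryLine (P k),
    dist (a (k + 1)) (b (k + 1)) ≤ dist u (b (k + 1))

/-- `γ : [0, L] → X`, parametrised by arc length, is a special path from `x` to `y`.

If `x` and `y` lie in a common piece, it is a geodesic. Otherwise it is the concatenation of
geodesics from `ξ k` to `ξ (k + 1)`, `0 ≤ k ≤ n`, where `ξ 0 = x`, `ξ (n + 1) = y`, and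
`ξ (k + 1)` is the intersection point of the fibre of `P k` through `b k` with the fibre of
`P (k + 1)` through `a (k + 1)`, in the common boundary plane of these pieces. -/
def IsSpecialPath (p : X → M.Total) (x y : X) (L : ℝ) (γ : ℝ → X) : Prop :=
  ((∃ P : M.CoverPiece p, x ∈ P.carrier ∧ y ∈ P.carrier) ∧ IsGeodesic p γ 0 L x y) ∨
  ((¬ ∃ P : M.CoverPiece p, x ∈ P.carrier ∧ y ∈ P.carrier) ∧
    ∃ (n : ℕ) (P : ℕ → M.CoverPiece p) (a b : ∀ k, (P k).Base) (ξ : ℕ → X) (r : ℕ → ℝ),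
      1 ≤ n ∧ PassesThrough p x y n P ∧ IsTurningData x y n P a b ∧
      ξ 0 = x ∧ ξ (n + 1) = y ∧
      (∀ k < n, (∃ t : ℝ, (P k).toFun (b k, t) = ξ (k + 1)) ∧
        ∃ t : ℝ, (P (k + 1)).toFun (a (k + 1), t) = ξ (k + 1)) ∧
      r 0 = 0 ∧ r (n + 1) = L ∧
      ∀ k ≤ n, IsGeodesic p γ (r k) (r (k + 1)) (ξ k) (ξ (k + 1)))

end FlipManifold

/-!
# Special paths are quasi-geodesics

The upper bound is clear, since a special path is parametrised by arc length. For the lower bound,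
the length of a special path has to be compared with the lengths of all broken geodesics between two
of its points.

*The metric argument.* Call the directions of the base and of the fibre of a piece horizontal and
vertical. In a piece with two walls over the boundary lines `ℓ` and `ℓ'`, whose distance is realised
by `p ∈ ℓ` and `q ∈ ℓ'`, points `u ∈ ℓ` and `u' ∈ ℓ'` satisfy
`dist p q + dist u p + dist u' q ≤ C * dist u u'`, with a constant which depends only on the surface
(`HyperbolicSurface.exists_edge_divergence`). So a path which crosses the piece far from the special
path loses a horizontal amount which is proportional to the horizontal deviations where it enters
and leaves. As the gluings interchange the two directions, the horizontal deviation when leaving a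
piece is a vertical deviation in the next one, where it bounds the difference of the vertical
lengths. Summing over the pieces, these terms telescope:
`TreeOfProducts.Turning.sum_add_dist_sub_le` and `TreeOfProducts.Turning.length_le`. This uses
that each wall separates, so that a path has to cross all walls between its endpoints
(`TreeOfProducts.Path.exists_cross`). Separation also shows that pieces are isometrically embedded
(`TreeOfProducts.Path.pdist_le`) and, with a compactness argument, that they are convex
(`TreeOfProducts.mem_range_of_geodesic`), so that the geodesics of which a special path is composed
are geodesics of the pieces.

*The tree of pieces.* Separation is not proved in the universal cover `X` directly. Instead, copies
of the universal covers of the pieces are glued in the pattern of a forest whose vertices are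
labelled by elements of a free group, so that crossing a wall is the same as multiplying by a
generator (`FlipManifold.Tree`). The walls of this space separate because the edges of the Cayley
tree do (`FlipManifold.Wall.sideOf_eq_iff`). The space is a covering of the flip manifold
(`FlipManifold.isCoveringMap_treeProj`), and it need neither be connected nor simply connected a
priori: it suffices that `X`, being simply connected and locally path connected, maps to it over the
manifold (`FlipManifold.exists_lift_to_tree`). By uniqueness of lifts, the pieces of `X` are mapped
isometrically onto pieces of the tree, and intersecting pieces of `X` intersect exactly where their
images do (`FlipManifold.TreeLabel.mem_carrier`). Hence special paths of `X` are mapped to the paths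
considered above, and broken geodesics to broken geodesics of the same length.
-/

/-! ### Lines in the hyperbolic plane -/

@[simp]
theorem axisPoint_re (t : ℝ) : (axisPoint t).re = 0 := rfl

@[simp]
theorem axisPoint_im (t : ℝ) : (axisPoint t).im = Real.exp t := rfl

theorem dist_axisPoint (s t : ℝ) : dist (axisPoint s) (axisPoint t) = |s - t| := by
  rw [UpperHalfPlane.dist_of_re_eq (by simp)]
  simp [Real.dist_eq]

theorem continuous_axisPoint : Continuous axisPoint :=
  (UpperHalfPlane.isometry_vertical_line 0).continuous

theorem axisPoint_log_im {z : UpperHalfPlane} (hz : z.re = 0) : axisPoint (Real.log z.im) = z := by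
  apply UpperHalfPlane.ext
  apply Complex.ext
  · simpa using hz.symm
  · simpa using Real.exp_log z.im_pos

theorem dist_sq_coe (z w : UpperHalfPlane) :
    dist (z : ℂ) w ^ 2 = (z.re - w.re) ^ 2 + (z.im - w.im) ^ 2 := by
  rw [Complex.dist_eq_re_im, Real.sq_sqrt (by positivity)]
  rfl

/-- A point where equality holds in the triangle inequality for two points of the imaginary
half-axis lies on this axis. -/
theorem re_eq_zero_of_dist_add_dist_eq {s t : ℝ} {z : UpperHalfPlane}
    (h : dist (axisPoint s) z + dist z (axisPoint t) = dist (axisPoint s) (axisPoint t)) :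
    z.re = 0 := by
  have h1 := UpperHalfPlane.dist_log_im_le (axisPoint s) z
  have h2 := UpperHalfPlane.dist_log_im_le z (axisPoint t)
  rw [dist_axisPoint] at h
  simp only [axisPoint_im, Real.log_exp] at h1 h2
  have h3 := dist_triangle s (Real.log z.im) t
  rw [Real.dist_eq s t] at h3
  have h4 : dist (axisPoint s) z = dist (axisPoint s) (axisPoint (Real.log z.im)) := by
    rw [dist_axisPoint, ← Real.dist_eq]; linarith
  have h5 := congrArg Real.cosh h4
  rw [UpperHalfPlane.cosh_dist, UpperHalfPlane.cosh_dist, dist_sq_coe, dist_sq_coe] at h5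
  simp only [axisPoint_re, axisPoint_im, Real.exp_log z.im_pos] at h5
  have h6 : (0:ℝ) < 2 * Real.exp s * z.im := by have := z.im_pos; positivity
  rw [add_right_inj, div_left_inj' h6.ne'] at h5
  nlinarith

section Moebius

variable (g : SL(2, ℝ)) (z : UpperHalfPlane)

theorem smul_re : (g • z).re =
    (g 0 0 * g 1 0 * (z.re ^ 2 + z.im ^ 2) + (g 0 0 * g 1 1 + g 0 1 * g 1 0) * z.re
      + g 0 1 * g 1 1) / ((g 1 0 * z.re + g 1 1) ^ 2 + (g 1 0 * z.im) ^ 2) := by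
  rw [← UpperHalfPlane.coe_re, UpperHalfPlane.coe_specialLinearGroup_apply, Complex.div_re,
    ← add_div]
  congr 1
  · simp; ring
  · simp [Complex.normSq_apply]; ring

theorem smul_im : (g • z).im =
    z.im / ((g 1 0 * z.re + g 1 1) ^ 2 + (g 1 0 * z.im) ^ 2) := by
  have hd := g.det_coe
  rw [Matrix.det_fin_two] at hd
  rw [← UpperHalfPlane.coe_im, UpperHalfPlane.coe_specialLinearGroup_apply, Complex.div_im,
    ← sub_div]
  congr 1
  · simp; linear_combination (z.im) * hd
  · simp [Complex.normSq_apply]; ring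

end Moebius

/-- Along a line, parametrised by arc length, the quotient of the two coordinates, which is up to
sign the hyperbolic sine of the distance from the imaginary half-axis, is a combination of two
exponentials. -/
theorem re_div_im_smul_axisPoint (g : SL(2, ℝ)) (t : ℝ) :
    (g • axisPoint t).re / (g • axisPoint t).im =
      g 0 0 * g 1 0 * Real.exp t + g 0 1 * g 1 1 * Real.exp (-t) := by
  have hd := g.det_coe
  rw [Matrix.det_fin_two] at hd
  have hN : (g 1 0 * 0 + g 1 1) ^ 2 + (g 1 0 * Real.exp t) ^ 2 ≠ 0 := by
    intro h
    have h1 : g 1 1 = 0 := by nlinarith [sq_nonneg (g 1 1), sq_nonneg (g 1 0 * Real.exp t)]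
    have h2 : g 1 0 * Real.exp t = 0 := by
      nlinarith [sq_nonneg (g 1 1), sq_nonneg (g 1 0 * Real.exp t)]
    have h3 : g 1 0 = 0 := by simpa using h2
    rw [h1, h3] at hd
    simp at hd
  rw [smul_re, smul_im, axisPoint_re, axisPoint_im, div_div_div_cancel_right₀ hN, Real.exp_neg]
  field_simp
  ring

theorem exists_smul_axisPoint (z w : UpperHalfPlane) :
    ∃ (g : SL(2, ℝ)) (s t : ℝ), g • axisPoint s = z ∧ g • axisPoint t = w := by
  -- it suffices to map both points to the imaginary half-axis
  suffices H : ∃ h : SL(2, ℝ), (h • z).re = 0 ∧ (h • w).re = 0 by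
    obtain ⟨h, h1, h2⟩ := H
    refine ⟨h⁻¹, Real.log (h • z).im, Real.log (h • w).im, ?_, ?_⟩
    · rw [axisPoint_log_im h1, inv_smul_smul]
    · rw [axisPoint_log_im h2, inv_smul_smul]
  by_cases hre : z.re = w.re
  · let h : SL(2, ℝ) := ⟨!![1, -z.re; 0, 1], by simp [Matrix.det_fin_two]⟩
    refine ⟨h, ?_, ?_⟩
    · rw [smul_re]; simp [h]
    · rw [smul_re]; simp [h, hre]
  · -- the points lie on the half-circle with centre `c` and radius `R`
    obtain ⟨c, hc⟩ : ∃ c, c * (2 * (z.re - w.re)) =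
        z.re ^ 2 + z.im ^ 2 - (w.re ^ 2 + w.im ^ 2) :=
      ⟨_, div_mul_cancel₀ _ (mul_ne_zero two_ne_zero (sub_ne_zero.2 hre))⟩
    set R : ℝ := √((z.re - c) ^ 2 + z.im ^ 2) with hR
    have hzpos := z.im_pos
    have hRsq : R ^ 2 = (z.re - c) ^ 2 + z.im ^ 2 := by rw [hR, Real.sq_sqrt (by positivity)]
    have hRpos : 0 < R := by rw [hR]; positivity
    set r : ℝ := (√(2 * R))⁻¹ with hr
    have hrsq : r ^ 2 * (2 * R) = 1 := by
      rw [hr, inv_pow, Real.sq_sqrt (by positivity)]; field_simp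
    let h : SL(2, ℝ) := ⟨!![r, -(r * (c - R)); -r, r * (c + R)], by
      rw [Matrix.det_fin_two]
      simp only [Matrix.of_apply, Matrix.cons_val', Matrix.cons_val_zero, Matrix.cons_val_one,
        Matrix.cons_val_fin_one]
      linear_combination hrsq⟩
    have key : ∀ v : UpperHalfPlane, R ^ 2 = (v.re - c) ^ 2 + v.im ^ 2 → (h • v).re = 0 := by
      intro v hv
      rw [smul_re]
      simp only [h, Matrix.of_apply, Matrix.cons_val', Matrix.cons_val_zero,
        Matrix.cons_val_one, Matrix.cons_val_fin_one]
      rw [div_eq_zero_iff]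
      left
      linear_combination r ^ 2 * hv
    exact ⟨h, key z hRsq, key w (by rw [hRsq]; linear_combination -hc)⟩

theorem cosh_dist_axisPoint (z : UpperHalfPlane) (τ : ℝ) :
    Real.cosh (dist z (axisPoint τ)) =
      (z.re ^ 2 + z.im ^ 2 + Real.exp τ ^ 2) / (2 * z.im * Real.exp τ) := by
  have := z.im_pos
  rw [UpperHalfPlane.cosh_dist, dist_sq_coe]
  simp only [axisPoint_re, axisPoint_im]
  field_simp
  ring

/-- The hyperbolic sine of the distance of a point from the imaginary half-axis is at least
`|re / im|`. -/
theorem abs_re_div_im_le_sinh_dist (z : UpperHalfPlane) (τ : ℝ) :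
    |z.re / z.im| ≤ Real.sinh (dist z (axisPoint τ)) := by
  have hz := z.im_pos
  have hsinh : 0 ≤ Real.sinh (dist z (axisPoint τ)) := Real.sinh_nonneg_iff.2 dist_nonneg
  apply abs_le_of_sq_le_sq _ hsinh
  rw [Real.sinh_sq, cosh_dist_axisPoint, div_pow, div_pow, le_sub_iff_add_le,
    div_add_one (by positivity), div_le_div_iff₀ (by positivity) (by positivity)]
  have hE := Real.exp_pos τ
  set E := Real.exp τ
  have : 0 ≤ (z.re ^ 2 + z.im ^ 2 - E ^ 2) ^ 2 * z.im ^ 2 := by positivity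
  nlinarith

/-- The distance from the imaginary half-axis is attained at the point with the same modulus. -/
theorem exists_sinh_dist_axisPoint_eq (z : UpperHalfPlane) :
    ∃ τ : ℝ, Real.sinh (dist z (axisPoint τ)) = |z.re / z.im| := by
  have hz := z.im_pos
  set N := √(z.re ^ 2 + z.im ^ 2) with hN
  have hNpos : 0 < N := by rw [hN]; positivity
  have hNsq : N ^ 2 = z.re ^ 2 + z.im ^ 2 := by rw [hN, Real.sq_sqrt (by positivity)]
  refine ⟨Real.log N, ?_⟩
  have hsinh : 0 ≤ Real.sinh (dist z (axisPoint (Real.log N))) :=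
    Real.sinh_nonneg_iff.2 dist_nonneg
  rw [← abs_of_nonneg hsinh, ← sq_eq_sq_iff_abs_eq_abs, Real.sinh_sq, cosh_dist_axisPoint,
    Real.exp_log hNpos, ← hNsq]
  have : z.re ^ 2 = N ^ 2 - z.im ^ 2 := by rw [hNsq]; ring
  rw [div_pow z.re, this]
  field_simp
  ring

/-- Two lines diverge linearly from the points where their distance is attained: along the second
line, the hyperbolic sine of the distance from the first one is a multiple of the hyperbolic cosine
of the arc length parameter. -/
theorem abs_sub_le_dist_of_forall_dist_le {g : SL(2, ℝ)} {s₀ t₀ ε : ℝ} (hε : 0 < ε)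
    (hside : ∀ t, 0 ≤ (g • axisPoint t).re)
    (hmin : ∀ s t, dist (axisPoint s₀) (g • axisPoint t₀) ≤ dist (axisPoint s) (g • axisPoint t))
    (hdist : ε ≤ dist (axisPoint s₀) (g • axisPoint t₀)) (s t : ℝ) :
    |t - t₀| ≤ dist (axisPoint s) (g • axisPoint t) + |Real.log (Real.sinh ε)| := by
  set φ : ℝ → ℝ := fun t => (g • axisPoint t).re / (g • axisPoint t).im with hφ
  have hφ0 : ∀ t, 0 ≤ φ t := fun t => div_nonneg (hside t) (g • axisPoint t).im_pos.le
  have hφle : ∀ s t, φ t ≤ Real.sinh (dist (axisPoint s) (g • axisPoint t)) := fun s t => by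
    rw [dist_comm]
    exact (le_abs_self _).trans (abs_re_div_im_le_sinh_dist _ _)
  have hφeq : ∀ t, ∃ s, Real.sinh (dist (axisPoint s) (g • axisPoint t)) = φ t := fun t => by
    obtain ⟨s, hs⟩ := exists_sinh_dist_axisPoint_eq (g • axisPoint t)
    exact ⟨s, by rw [dist_comm, hs, abs_of_nonneg (hφ0 t)]⟩
  have hφmin : ∀ t, φ t₀ ≤ φ t := fun t => by
    obtain ⟨s, hs⟩ := hφeq t
    rw [← hs]
    exact (hφle s₀ t₀).trans (Real.sinh_le_sinh.2 (hmin s t))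
  have hφε : Real.sinh ε ≤ φ t₀ := by
    obtain ⟨s, hs⟩ := hφeq t₀
    rw [← hs]
    exact Real.sinh_le_sinh.2 (hdist.trans (hmin s t₀))
  have hS : 0 < Real.sinh ε := Real.sinh_pos_iff.2 hε
  set A := g 0 0 * g 1 0 * Real.exp t₀ with hA
  set B := g 0 1 * g 1 1 * Real.exp (-t₀) with hB
  have hφform : ∀ r, φ (t₀ + r) = A * Real.exp r + B * Real.exp (-r) := fun r => by
    rw [hφ]
    simp only
    rw [re_div_im_smul_axisPoint, Real.exp_add, neg_add, Real.exp_add]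
    ring
  -- the derivative vanishes at the minimum
  have hAB : A = B := by
    have hder : HasDerivAt (fun r => A * Real.exp r + B * Real.exp (-r))
        (A * Real.exp 0 + B * (Real.exp (-0) * -1)) 0 :=
      ((Real.hasDerivAt_exp 0).const_mul A).add
        (((hasDerivAt_neg (0 : ℝ)).exp).const_mul B)
    have hloc : IsLocalMin (fun r => A * Real.exp r + B * Real.exp (-r)) 0 := by
      refine Filter.Eventually.of_forall fun r => ?_
      have := hφmin (t₀ + r)
      have h0 := hφform 0
      rw [add_zero] at h0
      rwa [hφform, h0] at this
    have := hloc.hasDerivAt_eq_zero hder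
    simp at this
    linarith
  have hA2 : Real.sinh ε ≤ 2 * A := by
    have := hφform 0
    simp [← hAB] at this
    linarith
  set r := t - t₀ with hr
  have h1 : Real.sinh ε / 2 * Real.exp |r| ≤ φ t := by
    have h2 := hφform r
    rw [show t₀ + r = t by rw [hr]; ring, ← hAB] at h2
    rw [h2]
    have h3 : Real.exp |r| ≤ Real.exp r + Real.exp (-r) := by
      rcases abs_cases r with ⟨h, _⟩ | ⟨h, _⟩ <;> rw [h] <;>
        linarith [Real.exp_pos r, Real.exp_pos (-r)]
    nlinarith [Real.exp_pos |r|]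
  set D := dist (axisPoint s) (g • axisPoint t) with hD
  have h4 : Real.sinh D ≤ Real.exp D / 2 := by
    rw [Real.sinh_eq]; linarith [Real.exp_pos (-D)]
  have h5 : Real.sinh ε * Real.exp |r| ≤ Real.exp D := by linarith [hφle s t]
  have h6 := Real.log_le_log (by positivity) h5
  rw [Real.log_mul hS.ne' (Real.exp_pos _).ne', Real.log_exp, Real.log_exp] at h6
  linarith [neg_abs_le (Real.log (Real.sinh ε))]

/-! ### Boundary lines of the universal cover of a surface -/

theorem exists_pos_forall_le_of_finite {ι : Type*} [Finite ι] (f : ι → ℝ) (hf : ∀ i, 0 < f i) :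
    ∃ ε > 0, ∀ i, ε ≤ f i := by
  cases isEmpty_or_nonempty ι
  · exact ⟨1, one_pos, fun i => isEmptyElim i⟩
  · obtain ⟨i, hi⟩ := Finite.exists_min f
    exact ⟨f i, hf i, hi⟩

namespace HyperbolicSurface

variable (F : HyperbolicSurface)

/-- The image under `g` of the chosen lift of the boundary circle `b`, parametrised by arc
length. -/
noncomputable def edge (g : SL(2, ℝ)) (b : F.Bdry) (s : ℝ) : UpperHalfPlane :=
  g • F.frame b • axisPoint s

variable {F}

theorem smul_edge (h g : SL(2, ℝ)) (b : F.Bdry) (s : ℝ) :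
    h • F.edge g b s = F.edge (h * g) b s := by
  rw [edge, edge, mul_smul]

theorem edge_mem {g : SL(2, ℝ)} (hg : g ∈ F.group) (b : F.Bdry) (s : ℝ) :
    F.edge g b s ∈ F.cover :=
  F.smul_mem g hg _ (F.line_mem_cover b s)

theorem dist_edge (g : SL(2, ℝ)) (b : F.Bdry) (s t : ℝ) :
    dist (F.edge g b s) (F.edge g b t) = |s - t| := by
  rw [edge, edge, dist_smul, dist_smul, dist_axisPoint]

theorem continuous_edge (g : SL(2, ℝ)) (b : F.Bdry) : Continuous (F.edge g b) :=
  (isometry_smul UpperHalfPlane g).continuous.comp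
    ((isometry_smul UpperHalfPlane (F.frame b)).continuous.comp continuous_axisPoint)

theorem isometry_edge (g : SL(2, ℝ)) (b : F.Bdry) : Isometry (F.edge g b) :=
  Isometry.of_dist_eq fun s t => by rw [dist_edge, Real.dist_eq]

theorem isClosed_range_edge (g : SL(2, ℝ)) (b : F.Bdry) : IsClosed (Set.range (F.edge g b)) :=
  (isometry_edge g b).isClosedEmbedding.isClosed_range

theorem exists_edge_eq_of_dist_add_dist_eq {g : SL(2, ℝ)} {b : F.Bdry} {s t : ℝ}
    {z : UpperHalfPlane}
    (h : dist (F.edge g b s) z + dist z (F.edge g b t) = dist (F.edge g b s) (F.edge g b t)) :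
    ∃ r, F.edge g b r = z := by
  set f := g * F.frame b with hf
  have he : ∀ r, F.edge g b r = f • axisPoint r := fun r => by rw [edge, hf, mul_smul]
  rw [he, he] at h
  have h' : dist (axisPoint s) (f⁻¹ • z) + dist (f⁻¹ • z) (axisPoint t) =
      dist (axisPoint s) (axisPoint t) := by
    rw [← dist_smul f, ← dist_smul f (f⁻¹ • z), ← dist_smul f (axisPoint s) (axisPoint t),
      smul_inv_smul, h]
  refine ⟨Real.log (f⁻¹ • z).im, ?_⟩
  rw [he, axisPoint_log_im (re_eq_zero_of_dist_add_dist_eq h'), smul_inv_smul]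

theorem exists_shift (b : F.Bdry) (n : ℤ) :
    ∃ h ∈ F.group, ∀ t, h • F.frame b • axisPoint t = F.frame b • axisPoint (t + n) := by
  obtain ⟨g, hg, h⟩ := F.exists_translation b
  refine ⟨g ^ n, F.group.zpow_mem hg n, ?_⟩
  induction n with
  | zero => simp
  | succ n ih =>
    intro t
    rw [zpow_add_one, mul_smul, h, ih]
    congr 2
    push_cast; ring
  | pred n ih =>
    intro t
    have h' : g⁻¹ • F.frame b • axisPoint t = F.frame b • axisPoint (t - 1) := by
      rw [inv_smul_eq_iff, h]; congr 2; ring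
    rw [zpow_sub_one, mul_smul, h', ih]
    congr 2
    push_cast; ring

/-- Two boundary lines which meet coincide, and lie over the same boundary circle. -/
theorem edge_eq_edge {g g' : SL(2, ℝ)} (hg : g ∈ F.group) (hg' : g' ∈ F.group) {b b' : F.Bdry}
    {s t : ℝ} (h : F.edge g b s = F.edge g' b' t) :
    b = b' ∧ ∃ n : ℤ, t = s + n ∧ ∀ r, F.edge g b r = F.edge g' b' (r + n) := by
  have h1 : (g'⁻¹ * g) • F.frame b • axisPoint s = F.frame b' • axisPoint t := by
    rw [mul_smul, inv_smul_eq_iff]; exact h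
  have hmem := F.group.mul_mem (F.group.inv_mem hg') hg
  obtain ⟨rfl, n, rfl⟩ := F.line_inj _ hmem _ _ _ _ h1
  obtain ⟨k, hk, hk'⟩ := exists_shift b n
  have h2 : (k⁻¹ * (g'⁻¹ * g)) • F.frame b • axisPoint s = F.frame b • axisPoint s := by
    rw [mul_smul, h1, inv_smul_eq_iff, hk']
  have h3 := F.free _ (F.group.mul_mem (F.group.inv_mem hk) hmem) _ (F.line_mem_cover b s) h2
  refine ⟨rfl, n, rfl, fun r => ?_⟩
  have h4 := h3 (F.frame b • axisPoint r)
  rw [mul_smul, inv_smul_eq_iff, hk', mul_smul, inv_smul_eq_iff] at h4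
  exact h4

/-- Distinct boundary lines are uniformly separated. -/
theorem exists_edge_separation (F : HyperbolicSurface) : ∃ ε > 0, ∀ g ∈ F.group, ∀ g' ∈ F.group,
    ∀ (b b' : F.Bdry) (s t : ℝ), dist (F.edge g b s) (F.edge g' b' t) < ε →
      ∃ r, F.edge g b s = F.edge g' b' r := by
  have := F.finite_bdry
  set K : Set UpperHalfPlane := ⋃ b, F.edge 1 b '' Set.Icc 0 1 with hK
  have hKc : IsCompact K := isCompact_iUnion fun b => isCompact_Icc.image (continuous_edge 1 b)
  have hfin := F.properlyDiscontinuous _ (hKc.cthickening (r := 1))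
  set S := {g : SL(2, ℝ) | g ∈ F.group ∧ ∃ z ∈ Metric.cthickening 1 K,
    g • z ∈ Metric.cthickening 1 K} with hS
  have : Finite S := hfin
  -- by compactness, for each of finitely many pairs of fundamental segments, a lower bound for
  -- their distance
  have hpair : ∀ i : F.Bdry × S × F.Bdry, ∃ ε > 0, ∀ s ∈ Set.Icc (0 : ℝ) 1,
      ∀ t ∈ Set.Icc (0 : ℝ) 1, dist (F.edge 1 i.1 s) (F.edge i.2.1 i.2.2 t) < ε →
        ∃ r r', F.edge 1 i.1 r = F.edge i.2.1 i.2.2 r' := by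
    rintro ⟨b, ⟨g, hg⟩, b'⟩
    by_cases hmeet : ∃ r r', F.edge 1 b r = F.edge g b' r'
    · exact ⟨1, one_pos, fun s _ t _ _ => hmeet⟩
    · have hdisj : Disjoint (F.edge 1 b '' Set.Icc 0 1) (F.edge g b' '' Set.Icc 0 1) := by
        rw [Set.disjoint_left]
        rintro _ ⟨r, _, rfl⟩ ⟨r', _, h⟩
        exact hmeet ⟨r, r', h.symm⟩
      obtain ⟨r, hr, h⟩ := Metric.exists_pos_forall_lt_edist
        (isCompact_Icc.image (continuous_edge 1 b))
        (isCompact_Icc.image (continuous_edge g b')).isClosed hdisj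
      refine ⟨r, hr, fun s hs t ht hlt => ?_⟩
      have := h _ (Set.mem_image_of_mem _ hs) _ (Set.mem_image_of_mem _ ht)
      rw [edist_nndist, ENNReal.coe_lt_coe, ← NNReal.coe_lt_coe, coe_nndist] at this
      exact absurd this hlt.not_gt
  choose e he hpair using hpair
  obtain ⟨ε, hε, hle⟩ := exists_pos_forall_le_of_finite e he
  refine ⟨min ε 1, lt_min hε one_pos, fun g hg g' hg' b b' s t hlt => ?_⟩
  -- translate the two points to the fundamental segments
  obtain ⟨h, hh, hshift⟩ := exists_shift b ⌊s⌋
  obtain ⟨h', hh', hshift'⟩ := exists_shift b' ⌊t⌋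
  have hs : ∀ r, F.edge g b (r + ⌊s⌋) = (g * h) • F.edge 1 b r := fun r => by
    rw [edge, edge, one_smul, mul_smul, hshift]
  have ht : ∀ r, F.edge g' b' (r + ⌊t⌋) = (g' * h') • F.edge 1 b' r := fun r => by
    rw [edge, edge, one_smul, mul_smul, hshift']
  set k := (g * h)⁻¹ * (g' * h') with hk
  have hkmem : k ∈ F.group :=
    F.group.mul_mem (F.group.inv_mem (F.group.mul_mem hg hh)) (F.group.mul_mem hg' hh')
  have hs0 : s = Int.fract s + ⌊s⌋ := (Int.fract_add_floor s).symm
  have ht0 : t = Int.fract t + ⌊t⌋ := (Int.fract_add_floor t).symm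
  have hd : dist (F.edge 1 b (Int.fract s)) (F.edge k b' (Int.fract t)) < min ε 1 := by
    rw [hs0, ht0, hs, ht] at hlt
    rw [← mul_one k, ← smul_edge, ← dist_smul (g * h), smul_smul (g * h) k, hk,
      mul_inv_cancel_left]
    exact hlt
  have hmemI : ∀ x : ℝ, Int.fract x ∈ Set.Icc (0 : ℝ) 1 := fun x =>
    ⟨Int.fract_nonneg x, (Int.fract_lt_one x).le⟩
  have hmemK : ∀ (c : F.Bdry) (x : ℝ), F.edge 1 c (Int.fract x) ∈ K := fun c x =>
    Set.mem_iUnion.2 ⟨c, Set.mem_image_of_mem _ (hmemI x)⟩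
  have hkS : k ∈ S := by
    refine ⟨hkmem, _, Metric.self_subset_cthickening K (hmemK b' t), ?_⟩
    apply Metric.mem_cthickening_of_dist_le _ _ _ _ (hmemK b s)
    rw [smul_edge, mul_one, dist_comm]
    exact (hd.trans_le (min_le_right _ _)).le
  obtain ⟨r, r', hrr⟩ := hpair (b, ⟨k, hkS⟩, b') _ (hmemI s) _ (hmemI t)
    ((hd.trans_le (min_le_left _ _)).trans_le (hle _))
  simp only at hrr
  obtain ⟨rfl, n, -, hn⟩ := edge_eq_edge F.group.one_mem hkmem hrr
  refine ⟨Int.fract s + n + ⌊t⌋, ?_⟩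
  have h1 : F.edge g b s = (g * h) • F.edge 1 b (Int.fract s) := by rw [← hs, ← hs0]
  rw [h1, hn, ht, smul_edge, hk, smul_edge]
  congr 1
  group

/-- Near a given point there is at most one boundary line, and if the point is close enough to a
boundary line, it lies on this line. -/
theorem exists_forall_edge_near (F : HyperbolicSurface) (z : UpperHalfPlane) :
    ∃ δ > 0, ∀ g ∈ F.group, ∀ (b : F.Bdry) (s : ℝ), dist (F.edge g b s) z < δ →
      ∃ r, F.edge g b r = z := by
  obtain ⟨ε, hε, hsep⟩ := F.exists_edge_separation
  by_cases h : ∃ g₀ ∈ F.group, ∃ b₀ s₀, dist (F.edge g₀ b₀ s₀) z < ε / 2 ∧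
      z ∉ Set.range (F.edge g₀ b₀)
  · obtain ⟨g₀, hg₀, b₀, s₀, h₀, hz⟩ := h
    have hpos : 0 < Metric.infDist z (Set.range (F.edge g₀ b₀)) :=
      ((isClosed_range_edge g₀ b₀).notMem_iff_infDist_pos (Set.range_nonempty _)).1 hz
    refine ⟨min (ε / 2) (Metric.infDist z (Set.range (F.edge g₀ b₀))),
      lt_min (by positivity) hpos, fun g hg b s hlt => ?_⟩
    obtain ⟨r, hr⟩ := hsep g hg g₀ hg₀ b b₀ s s₀ (by
      have := dist_triangle_right (F.edge g b s) (F.edge g₀ b₀ s₀) z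
      have := hlt.trans_le (min_le_left _ _)
      linarith)
    have h1 := Metric.infDist_le_dist_of_mem (x := z) (Set.mem_range_self (f := F.edge g₀ b₀) r)
    rw [← hr, dist_comm] at h1
    exact absurd (hlt.trans_le (min_le_right _ _)) h1.not_gt
  · push Not at h
    exact ⟨ε / 2, by positivity, fun g hg b s hlt => h g hg b s hlt⟩

/-- A covering transformation which moves a given point by a small amount fixes it. -/
theorem exists_forall_smul_near (F : HyperbolicSurface) (z : UpperHalfPlane) :
    ∃ δ > 0, ∀ g ∈ F.group, dist (g • z) z < δ → g • z = z := by
  have hfin := F.properlyDiscontinuous _ (isCompact_closedBall z 1)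
  set S := {g : SL(2, ℝ) | g ∈ F.group ∧ ∃ w ∈ Metric.closedBall z 1,
    g • w ∈ Metric.closedBall z 1} with hS
  have : Finite S := hfin
  classical
  obtain ⟨ε, hε, hle⟩ := exists_pos_forall_le_of_finite
    (fun g : S => if g.1 • z = z then 1 else dist (g.1 • z) z) (fun g => by
      split_ifs with h
      · exact one_pos
      · exact dist_pos.2 h)
  refine ⟨min ε 1, lt_min hε one_pos, fun g hg hlt => ?_⟩
  by_contra hne
  have hgS : g ∈ S := ⟨hg, z, Metric.mem_closedBall_self zero_le_one,
    Metric.mem_closedBall.2 (hlt.trans_le (min_le_right _ _)).le⟩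
  have := hle ⟨g, hgS⟩
  simp only [hne, if_false] at this
  exact absurd (hlt.trans_le (min_le_left _ _)) this.not_gt

/-- There is a constant, depending only on the surface, such that the distance between points of
two disjoint boundary lines grows linearly with the distances of these points from the endpoints of
the common perpendicular. -/
theorem exists_edge_divergence (F : HyperbolicSurface) : ∃ C : ℝ, ∀ g ∈ F.group, ∀ g' ∈ F.group,
    ∀ (b b' : F.Bdry) (s₀ t₀ : ℝ), (∀ s t, F.edge g b s ≠ F.edge g' b' t) →
      (∀ s t, dist (F.edge g b s₀) (F.edge g' b' t₀) ≤ dist (F.edge g b s) (F.edge g' b' t)) →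
        ∀ s t, dist (F.edge g b s₀) (F.edge g' b' t₀) + |s - s₀| + |t - t₀| ≤
          C * dist (F.edge g b s) (F.edge g' b' t) := by
  obtain ⟨ε, hε, hsep⟩ := F.exists_edge_separation
  have half : ∀ g ∈ F.group, ∀ g' ∈ F.group,
      ∀ (b b' : F.Bdry) (s₀ t₀ : ℝ), (∀ s t, F.edge g b s ≠ F.edge g' b' t) →
      (∀ s t, dist (F.edge g b s₀) (F.edge g' b' t₀) ≤ dist (F.edge g b s) (F.edge g' b' t)) →
        ∀ s t, |t - t₀| ≤ dist (F.edge g b s) (F.edge g' b' t) + |Real.log (Real.sinh ε)| := by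
    intro g hg g' hg' b b' s₀ t₀ hne hmin s t
    set f := g * F.frame b with hf
    have hd : ∀ s t, dist (F.edge g b s) (F.edge g' b' t) =
        dist (axisPoint s) ((f⁻¹ * (g' * F.frame b')) • axisPoint t) := fun s t => by
      rw [← dist_smul f (axisPoint s), smul_smul f, mul_inv_cancel_left, hf, edge, edge, mul_smul,
        mul_smul]
    have hle : ε ≤ dist (F.edge g b s₀) (F.edge g' b' t₀) := by
      by_contra hlt
      obtain ⟨r, hr⟩ := hsep g hg g' hg' b b' s₀ t₀ (not_le.1 hlt)
      exact hne _ _ hr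
    simp only [hd] at hmin hle ⊢
    refine abs_sub_le_dist_of_forall_dist_le hε (fun t => ?_) hmin hle s t
    have := F.cover_side b (F.edge (g⁻¹ * g') b' t)
      (edge_mem (F.group.mul_mem (F.group.inv_mem hg) hg') b' t)
    rw [edge, smul_smul, smul_smul] at this
    rw [hf, mul_inv_rev]
    convert this using 3
    group
  refine ⟨3 + 2 * |Real.log (Real.sinh ε)| / ε, fun g hg g' hg' b b' s₀ t₀ hne hmin s t => ?_⟩
  have h1 := half g hg g' hg' b b' s₀ t₀ hne hmin s t
  have h2 := half g' hg' g hg b' b t₀ s₀ (fun s t h => hne t s h.symm)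
    (fun s t => by rw [dist_comm, dist_comm (F.edge g' b' s)]; exact hmin t s) t s
  rw [dist_comm] at h2
  have h3 := hmin s t
  have h4 : ε ≤ dist (F.edge g b s) (F.edge g' b' t) := by
    by_contra hlt
    obtain ⟨r, hr⟩ := hsep g hg g' hg' b b' s t (not_le.1 hlt)
    exact hne _ _ hr
  set D := dist (F.edge g b s) (F.edge g' b' t)
  set l := |Real.log (Real.sinh ε)|
  have h5 : 2 * l ≤ 2 * l / ε * D := by
    rw [div_mul_eq_mul_div, le_div_iff₀ hε]
    have : 0 ≤ l := abs_nonneg _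
    nlinarith
  linarith

/-! ### Topology of the universal cover of a surface -/

/-- A geodesic segment in the domain. -/
theorem exists_path_of_mem_cover {z w : UpperHalfPlane} (hz : z ∈ F.cover) (hw : w ∈ F.cover) :
    JoinedIn {v | v ∈ F.cover ∧ dist v z ≤ dist w z} z w := by
  obtain ⟨g, s, t, rfl, rfl⟩ := exists_smul_axisPoint z w
  set f : ℝ → UpperHalfPlane := fun τ => g • axisPoint (s + τ * (t - s)) with hf
  have hfc : Continuous f := (isometry_smul UpperHalfPlane g).continuous.comp
    (continuous_axisPoint.comp (by fun_prop))
  refine ⟨⟨⟨fun τ => f τ, hfc.comp continuous_subtype_val⟩, by simp [hf], by simp [hf]⟩, ?_⟩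
  rintro ⟨τ, h0, h1⟩
  simp only [Path.coe_mk_mk, Set.mem_ofPred_eq, hf]
  have hτ : 0 ≤ 1 - τ := by linarith
  constructor
  · refine F.convex _ hz _ hw _ ?_
    simp only [dist_smul, dist_axisPoint]
    rw [show s - (s + τ * (t - s)) = τ * (s - t) by ring,
      show s + τ * (t - s) - t = (1 - τ) * (s - t) by ring, abs_mul, abs_mul, abs_of_nonneg h0,
      abs_of_nonneg hτ]
    ring
  · simp only [dist_smul, dist_axisPoint]
    rw [show s + τ * (t - s) - s = τ * (t - s) by ring, abs_mul, abs_of_nonneg h0]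
    nlinarith [abs_nonneg (t - s)]

theorem joinedIn_ball_cover {z w : F.cover} {r : ℝ} (hw : dist w z < r) :
    JoinedIn (Metric.ball z r) z w := by
  obtain ⟨γ, hγ⟩ := exists_path_of_mem_cover z.2 w.2
  refine ⟨⟨⟨fun τ => ⟨γ τ, (hγ τ).1⟩, by fun_prop⟩, Subtype.ext (by simp), Subtype.ext (by simp)⟩,
    fun τ => ?_⟩
  exact (hγ τ).2.trans_lt hw

instance : Nonempty F.cover :=
  let ⟨z, hz⟩ := F.interior_nonempty
  ⟨⟨z, interior_subset hz⟩⟩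

instance : PathConnectedSpace F.cover where
  nonempty := inferInstance
  joined z w := (joinedIn_ball_cover (lt_add_one (dist w z))).joined

instance : LocallyPathConnectedSpace F.cover :=
  .of_bases (fun _ => Metric.nhds_basis_ball) fun z _ hr =>
    ⟨z, Metric.mem_ball_self hr, fun {_} hw => joinedIn_ball_cover hw⟩

instance : ProperSpace F.cover :=
  .of_isClosed F.isClosed_cover

variable (F) in
theorem continuous_proj : Continuous F.proj := continuous_quotient_mk'

variable (F) in
theorem proj_surjective : Function.Surjective F.proj := Quotient.mk_surjective

theorem proj_eq_proj {z w : F.cover} :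
    F.proj z = F.proj w ↔ ∃ g ∈ F.group, g • (z : UpperHalfPlane) = w :=
  Quotient.eq

/-- The action of a covering transformation on the universal cover. -/
noncomputable def deck {g : SL(2, ℝ)} (hg : g ∈ F.group) (z : F.cover) : F.cover :=
  ⟨g • (z : UpperHalfPlane), F.smul_mem g hg z z.2⟩

theorem isometry_deck {g : SL(2, ℝ)} (hg : g ∈ F.group) : Isometry (F.deck hg) :=
  Isometry.of_dist_eq fun z w => dist_smul g (z : UpperHalfPlane) w

theorem proj_deck {g : SL(2, ℝ)} (hg : g ∈ F.group) (z : F.cover) :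
    F.proj (F.deck hg z) = F.proj z :=
  (proj_eq_proj.2 ⟨g, hg, rfl⟩).symm

variable (F) in
theorem isOpenMap_proj : IsOpenMap F.proj := by
  intro U hU
  rw [← isQuotientMap_quotient_mk'.isOpen_preimage]
  have : (Quotient.mk F.deckSetoid) ⁻¹' (F.proj '' U) =
      ⋃ g : F.group, F.deck g.2 ⁻¹' U := by
    ext z
    simp only [Set.mem_preimage, Set.mem_image, Set.mem_iUnion]
    constructor
    · rintro ⟨w, hw, h⟩
      obtain ⟨g, hg, h⟩ := proj_eq_proj.1 (show F.proj z = F.proj w from h.symm)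
      exact ⟨⟨g, hg⟩, by rwa [show F.deck hg z = w from Subtype.ext h]⟩
    · rintro ⟨g, hg⟩
      exact ⟨_, hg, proj_deck g.2 z⟩
  exact this ▸ isOpen_iUnion fun g => hU.preimage (isometry_deck g.2).continuous

end HyperbolicSurface

namespace FlipManifold

variable (M : FlipManifold)

/-! ### Points of the flip manifold in coordinates of the universal covers of the pieces -/

/-- The disjoint union of the universal covers `F̃ × ℝ` of the pieces. -/
abbrev Chart : Type := Σ i : M.Piece, (M.surface i).cover × ℝ

/-- The two boundary tori which are glued along `τ`. -/
def side (τ : M.Torus) (b : Bool) : Σ i, (M.surface i).Bdry :=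
  cond b (M.left τ) (M.right τ)

/-- The boundary line `g • frame` over a boundary circle, parametrised by arc length. -/
noncomputable def edge (β : Σ i, (M.surface i).Bdry) (g : SL(2, ℝ)) (s : ℝ) : UpperHalfPlane :=
  (M.surface β.1).edge g β.2 s

/-- The coordinates (arc length parameter of the boundary line, height) of a point of the torus `τ`
with respect to the two pieces which meet there, expressed in terms of its coordinates `u` with
respect to the left one. -/
def coord (τ : M.Torus) (b : Bool) (u : ℝ × ℝ) : ℝ × ℝ :=
  cond b u (((M.sign τ : ℤ) : ℝ) * u.2 + M.baseShift τ, ((M.sign τ : ℤ) : ℝ) * u.1 + M.fibreShift τ)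

/-- The projection of the universal covers of the pieces to the flip manifold. -/
def down (x : M.Chart) : M.Total := M.pieceMap x.1 x.2

/-- Two points of `F̃ × ℝ` are related if they have the same image in `F × S¹`. -/
def DeckRel (x y : M.Chart) : Prop :=
  x.1 = y.1 ∧ ∃ g ∈ (M.surface x.1).group, g • (x.2.1 : UpperHalfPlane) = y.2.1 ∧
    ∃ n : ℤ, y.2.2 = x.2.2 + n

/-- The point of the plane over a side of the torus `τ` with coordinates `u`. -/
noncomputable def torusPt (τ : M.Torus) (b : Bool) (u : ℝ × ℝ) : M.Chart :=
  ⟨(M.side τ b).1, (M.surface (M.side τ b).1).line (M.side τ b).2 (M.coord τ b u).1,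
    (M.coord τ b u).2⟩

/-- Two pairs of reals differ by integers. -/
def IntRel (u v : ℝ × ℝ) : Prop :=
  (∃ m : ℤ, v.1 = u.1 + m) ∧ ∃ n : ℤ, v.2 = u.2 + n

variable {M}

theorem side_injective {τ τ' : M.Torus} {b b' : Bool} (h : M.side τ b = M.side τ' b') :
    τ = τ' ∧ b = b' := by
  cases b <;> cases b'
  · exact ⟨Sum.inr_injective (M.injective_sides (a₁ := .inr τ) (a₂ := .inr τ') h), rfl⟩
  · exact absurd (M.injective_sides (a₁ := .inr τ) (a₂ := .inl τ') h) (by simp)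
  · exact absurd (M.injective_sides (a₁ := .inl τ) (a₂ := .inr τ') h) (by simp)
  · exact ⟨Sum.inl_injective (M.injective_sides (a₁ := .inl τ) (a₂ := .inl τ') h), rfl⟩

theorem edge_eq_edge {β β' : Σ i, (M.surface i).Bdry} (hβ : β.1 = β'.1) {g g' : SL(2, ℝ)}
    (hg : g ∈ (M.surface β.1).group) (hg' : g' ∈ (M.surface β'.1).group) {s t : ℝ}
    (h : M.edge β g s = M.edge β' g' t) :
    β = β' ∧ ∃ n : ℤ, t = s + n ∧ ∀ r, M.edge β g r = M.edge β' g' (r + n) := by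
  obtain ⟨i, b⟩ := β
  obtain ⟨j, b'⟩ := β'
  obtain rfl : i = j := hβ
  obtain ⟨rfl, hn⟩ := HyperbolicSurface.edge_eq_edge hg hg' h
  exact ⟨rfl, hn⟩

theorem sign_mul_sign (τ : M.Torus) :
    ((M.sign τ : ℤ) : ℝ) * ((M.sign τ : ℤ) : ℝ) = 1 := by
  rw [← Int.cast_mul, ← Units.val_mul, Int.units_mul_self]; simp

theorem abs_sign (τ : M.Torus) : |((M.sign τ : ℤ) : ℝ)| = 1 := by
  have h := sign_mul_sign τ
  rw [← sq, ← sq_abs] at h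
  exact (pow_eq_one_iff_of_nonneg (abs_nonneg _) two_ne_zero).1 h

/-- The flip is an isometry which interchanges the base and the fibre direction. -/
theorem dist_coord_fst (τ : M.Torus) (b : Bool) (u v : ℝ × ℝ) :
    dist (M.coord τ b u).1 (M.coord τ b v).1 = dist (M.coord τ (!b) u).2 (M.coord τ (!b) v).2 := by
  cases b <;> simp [coord, Real.dist_eq, ← mul_sub, abs_mul, abs_sign]

theorem dist_coord_snd (τ : M.Torus) (b : Bool) (u v : ℝ × ℝ) :
    dist (M.coord τ b u).2 (M.coord τ b v).2 = dist (M.coord τ (!b) u).1 (M.coord τ (!b) v).1 := by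
  rw [dist_coord_fst, Bool.not_not]

theorem coord_injective (τ : M.Torus) (b : Bool) : Function.Injective (M.coord τ b) := by
  intro u v h
  have h1 := dist_coord_fst τ b u v
  have h2 := dist_coord_snd τ b u v
  rw [h, dist_self] at h1 h2
  cases b
  · exact Prod.ext (dist_eq_zero.1 h2.symm) (dist_eq_zero.1 h1.symm)
  · exact h

theorem coord_surjective (τ : M.Torus) (b : Bool) : Function.Surjective (M.coord τ b) := by
  intro u
  cases b
  · refine ⟨(((M.sign τ : ℤ) : ℝ) * (u.2 - M.fibreShift τ),
      ((M.sign τ : ℤ) : ℝ) * (u.1 - M.baseShift τ)), ?_⟩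
    simp [coord, ← mul_assoc, sign_mul_sign]
  · exact ⟨u, rfl⟩

theorem continuous_coord (τ : M.Torus) (b : Bool) : Continuous (M.coord τ b) := by
  cases b
  · change Continuous fun u : ℝ × ℝ => (((M.sign τ : ℤ) : ℝ) * u.2 + M.baseShift τ,
      ((M.sign τ : ℤ) : ℝ) * u.1 + M.fibreShift τ)
    fun_prop
  · exact continuous_id

theorem intRel_coord_iff {τ : M.Torus} {b : Bool} {u v : ℝ × ℝ} :
    IntRel (M.coord τ b u) (M.coord τ b v) ↔ IntRel u v := by
  cases b
  · have key : ∀ x y a : ℝ, (∃ m : ℤ, ((M.sign τ : ℤ) : ℝ) * y + a =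
        ((M.sign τ : ℤ) : ℝ) * x + a + m) ↔ ∃ m : ℤ, y = x + m := by
      intro x y a
      constructor
      · rintro ⟨m, hm⟩
        refine ⟨M.sign τ * m, ?_⟩
        push_cast
        linear_combination ((M.sign τ : ℤ) : ℝ) * hm + (x - y) * sign_mul_sign τ
      · rintro ⟨m, hm⟩
        refine ⟨M.sign τ * m, ?_⟩
        push_cast
        rw [hm]; ring
    simp only [IntRel, coord, cond_false, key]
    exact and_comm
  · rfl

theorem DeckRel.refl (x : M.Chart) : M.DeckRel x x :=
  ⟨rfl, 1, Subgroup.one_mem _, one_smul _ _, 0, by simp⟩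

theorem DeckRel.symm {x y : M.Chart} (h : M.DeckRel x y) : M.DeckRel y x := by
  obtain ⟨i, z, s⟩ := x
  obtain ⟨j, w, t⟩ := y
  obtain ⟨h0, g, hg, h1, n, hn⟩ := h
  obtain rfl : i = j := h0
  exact ⟨rfl, g⁻¹, Subgroup.inv_mem _ hg, by rw [← h1, inv_smul_smul], -n,
    by simp only at hn ⊢; rw [hn]; push_cast; ring⟩

theorem DeckRel.trans {x y z : M.Chart} (h : M.DeckRel x y) (h' : M.DeckRel y z) :
    M.DeckRel x z := by
  obtain ⟨i, x1, s⟩ := x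
  obtain ⟨j, y1, t⟩ := y
  obtain ⟨k, z1, r⟩ := z
  obtain ⟨h0, g, hg, h1, n, hn⟩ := h
  obtain rfl : i = j := h0
  obtain ⟨h0, g', hg', h1', n', hn'⟩ := h'
  obtain rfl : i = k := h0
  exact ⟨rfl, g' * g, Subgroup.mul_mem _ hg' hg, by rw [mul_smul, h1, h1'], n + n',
    by simp only at hn hn' ⊢; rw [hn', hn]; push_cast; ring⟩

theorem torusPt_coe (τ : M.Torus) (b : Bool) (u : ℝ × ℝ) :
    ((M.torusPt τ b u).2.1 : UpperHalfPlane) = M.edge (M.side τ b) 1 (M.coord τ b u).1 :=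
  (one_smul _ _).symm

theorem deckRel_torusPt_iff {τ τ' : M.Torus} {b b' : Bool} {u v : ℝ × ℝ} :
    M.DeckRel (M.torusPt τ b u) (M.torusPt τ' b' v) ↔ τ = τ' ∧ b = b' ∧ IntRel u v := by
  constructor
  · rintro ⟨h0, g, hg, h1, n, hn⟩
    rw [torusPt_coe, torusPt_coe, edge, HyperbolicSurface.smul_edge, mul_one] at h1
    obtain ⟨h2, m, hm, -⟩ := edge_eq_edge (β := M.side τ b) (β' := M.side τ' b') h0 hg
      (Subgroup.one_mem _) h1
    obtain ⟨rfl, rfl⟩ := side_injective h2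
    exact ⟨rfl, rfl, intRel_coord_iff.1 ⟨⟨m, hm⟩, n, hn⟩⟩
  · rintro ⟨rfl, rfl, h⟩
    obtain ⟨⟨m, hm⟩, n, hn⟩ := (intRel_coord_iff (τ := τ) (b := b)).2 h
    obtain ⟨g, hg, hshift⟩ := HyperbolicSurface.exists_shift (M.side τ b).2 m
    refine ⟨rfl, g, hg, ?_, n, hn⟩
    rw [torusPt, torusPt]
    simp only [HyperbolicSurface.line]
    rw [hshift, hm]

/-- The relation on the universal covers of the pieces whose classes are the points of the flip
manifold. -/
def ChartRel (x y : M.Chart) : Prop :=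
  M.DeckRel x y ∨ ∃ τ b u, M.DeckRel x (M.torusPt τ b u) ∧ M.DeckRel (M.torusPt τ (!b) u) y

theorem ChartRel.symm {x y : M.Chart} (h : ChartRel x y) : ChartRel y x := by
  rcases h with h | ⟨τ, b, u, h1, h2⟩
  · exact .inl h.symm
  · exact .inr ⟨τ, !b, u, h2.symm, by rw [Bool.not_not]; exact h1.symm⟩

theorem ChartRel.trans {x y z : M.Chart} (h : ChartRel x y) (h' : ChartRel y z) :
    ChartRel x z := by
  rcases h with h | ⟨τ, b, u, h1, h2⟩ <;> rcases h' with h' | ⟨τ', b', u', h1', h2'⟩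
  · exact .inl (h.trans h')
  · exact .inr ⟨τ', b', u', h.trans h1', h2'⟩
  · exact .inr ⟨τ, b, u, h1, h2.trans h'⟩
  · obtain ⟨rfl, rfl, hi⟩ := deckRel_torusPt_iff.1 (h2.trans h1')
    rw [Bool.not_not] at h2'
    exact .inl (h1.trans ((deckRel_torusPt_iff.2 ⟨rfl, rfl, hi⟩).trans h2'))

/-- The projection from the universal covers of the pieces to the pieces. -/
def toPreTotal (x : M.Chart) : M.PreTotal :=
  ⟨x.1, (M.surface x.1).proj x.2.1, (x.2.2 : AddCircle (1 : ℝ))⟩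

theorem down_eq (x : M.Chart) : M.down x = Quot.mk M.Glue (toPreTotal x) := rfl

theorem coe_addCircle_eq_iff {s t : ℝ} :
    (s : AddCircle (1 : ℝ)) = t ↔ ∃ n : ℤ, t = s + n := by
  rw [QuotientAddGroup.eq, AddSubgroup.mem_zmultiples_iff]
  refine exists_congr fun n => ?_
  rw [zsmul_eq_mul, mul_one]
  constructor <;> intro h <;> linarith

theorem toPreTotal_eq_iff {x y : M.Chart} : toPreTotal x = toPreTotal y ↔ M.DeckRel x y := by
  obtain ⟨i, z, s⟩ := x
  obtain ⟨j, w, t⟩ := y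
  constructor
  · intro h
    obtain rfl : i = j := congrArg Sigma.fst h
    have h' := eq_of_heq (Sigma.mk.inj h).2
    obtain ⟨h1, h2⟩ := Prod.mk.inj h'
    obtain ⟨g, hg, hgz⟩ := HyperbolicSurface.proj_eq_proj.1 h1
    exact ⟨rfl, g, hg, hgz, coe_addCircle_eq_iff.1 h2⟩
  · rintro ⟨h0, g, hg, h1, h2⟩
    obtain rfl : i = j := h0
    have h3 : (M.surface i).proj z = (M.surface i).proj w :=
      HyperbolicSurface.proj_eq_proj.2 ⟨g, hg, h1⟩
    have h4 := coe_addCircle_eq_iff.2 h2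
    simp only [toPreTotal]
    rw [h3, h4]

theorem toPreTotal_surjective : Function.Surjective (toPreTotal (M := M)) := by
  rintro ⟨i, z, s⟩
  obtain ⟨z, rfl⟩ := (M.surface i).proj_surjective z
  obtain ⟨s, rfl⟩ := QuotientAddGroup.mk_surjective s
  exact ⟨⟨i, z, s⟩, rfl⟩

theorem glue_iff {x y : M.PreTotal} : M.Glue x y ↔
    ∃ τ u, x = toPreTotal (M.torusPt τ true u) ∧ y = toPreTotal (M.torusPt τ false u) := by
  constructor
  · rintro ⟨τ, s, t⟩
    exact ⟨τ, (s, t), rfl, rfl⟩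
  · rintro ⟨τ, ⟨s, t⟩, rfl, rfl⟩
    exact .flip τ s t

theorem down_surjective : Function.Surjective M.down := by
  intro z
  obtain ⟨z, rfl⟩ := Quot.exists_rep z
  obtain ⟨x, rfl⟩ := toPreTotal_surjective z
  exact ⟨x, rfl⟩

theorem down_torusPt (τ : M.Torus) (b : Bool) (u : ℝ × ℝ) :
    M.down (M.torusPt τ (!b) u) = M.down (M.torusPt τ b u) := by
  have h : M.down (M.torusPt τ true u) = M.down (M.torusPt τ false u) :=
    Quot.sound (glue_iff.2 ⟨τ, u, rfl, rfl⟩)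
  cases b
  · exact h
  · exact h.symm

theorem down_eq_of_deckRel {x y : M.Chart} (h : M.DeckRel x y) : M.down x = M.down y := by
  rw [down_eq, down_eq, toPreTotal_eq_iff.2 h]

theorem down_eq_down_iff {x y : M.Chart} : M.down x = M.down y ↔ ChartRel x y := by
  constructor
  · intro h
    have h' := Quot.eqvGen_exact (show Quot.mk M.Glue (toPreTotal x) = Quot.mk M.Glue _ from h)
    suffices H : ∀ a b, Relation.EqvGen M.Glue a b → ∀ x y, toPreTotal x = a → toPreTotal y = b →
        ChartRel x y from H _ _ h' x y rfl rfl
    intro a b hab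
    induction hab with
    | refl a =>
      rintro x y rfl hy
      exact .inl (toPreTotal_eq_iff.1 hy.symm)
    | rel a b hab =>
      rintro x y rfl rfl
      obtain ⟨τ, u, h1, h2⟩ := glue_iff.1 hab
      exact .inr ⟨τ, true, u, toPreTotal_eq_iff.1 h1, toPreTotal_eq_iff.1 h2.symm⟩
    | symm a b _ ih =>
      rintro x y rfl rfl
      exact (ih y x rfl rfl).symm
    | trans a b c _ _ ih1 ih2 =>
      rintro x y rfl rfl
      obtain ⟨z, rfl⟩ := toPreTotal_surjective b
      exact (ih1 x z rfl rfl).trans (ih2 z y rfl rfl)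
  · rintro (h | ⟨τ, b, u, h1, h2⟩)
    · exact down_eq_of_deckRel h
    · rw [down_eq_of_deckRel h1, ← down_eq_of_deckRel h2, down_torusPt]

theorem isQuotientMap_toPreTotal : Topology.IsQuotientMap (toPreTotal (M := M)) := by
  have hc : Continuous (toPreTotal (M := M)) :=
    continuous_sigma fun i => continuous_sigmaMk.comp
      (((M.surface i).continuous_proj.comp continuous_fst).prodMk
        (AddCircle.continuous_mk' 1 |>.comp continuous_snd))
  have ho : IsOpenMap (toPreTotal (M := M)) := by
    rw [isOpenMap_sigma]
    intro i
    exact isOpenMap_sigmaMk.comp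
      ((M.surface i).isOpenMap_proj.prodMap QuotientAddGroup.isOpenMap_coe)
  exact ho.isQuotientMap hc toPreTotal_surjective

theorem isQuotientMap_down : Topology.IsQuotientMap M.down :=
  (isQuotientMap_quot_mk (r := M.Glue)).comp isQuotientMap_toPreTotal

instance : LocallyPathConnectedSpace M.Total := isQuotientMap_down.locallyPathConnectedSpace

end FlipManifold

namespace FlipManifold

variable (M : FlipManifold)

/-! ### The tree of pieces -/

/-- Two covering transformations are equivalent if they map the chosen lift of the boundary circle
`β` to the same line. -/
def lineSetoid (β : Σ i, (M.surface i).Bdry) : Setoid (M.surface β.1).group where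
  r g g' := ∃ n : ℤ, ∀ r, M.edge β g r = M.edge β g' (r + n)
  iseqv :=
    { refl := fun _ => ⟨0, fun r => by simp⟩
      symm := by
        rintro g g' ⟨n, h⟩
        exact ⟨-n, fun r => by rw [h]; congr 1; push_cast; ring⟩
      trans := by
        rintro g g' g'' ⟨n, h⟩ ⟨n', h'⟩
        exact ⟨n + n', fun r => by rw [h, h']; congr 1; push_cast; ring⟩ }

/-- The boundary lines of the universal cover which lie over the boundary circle `β`. -/
abbrev Line (β : Σ i, (M.surface i).Bdry) : Type := Quotient (M.lineSetoid β)

/-- A set of labels which is so large that, for each boundary circle `β`, the pairs of a label and a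
line over `β` can be labelled again. -/
abbrev Label : Type := ℕ × SL(2, ℝ)

theorem nonempty_labelEquiv (β : Σ i, (M.surface i).Bdry) :
    Nonempty (Label × M.Line β ≃ Label) := by
  rw [← Cardinal.eq, Cardinal.mk_prod, Cardinal.lift_id, Cardinal.lift_id]
  refine Cardinal.mul_eq_left (Cardinal.aleph0_le_mk _) ?_ ?_
  · calc Cardinal.mk (M.Line β) ≤ Cardinal.mk (M.surface β.1).group := Cardinal.mk_quotient_le
      _ ≤ Cardinal.mk SL(2, ℝ) := Cardinal.mk_subtype_le _
      _ ≤ Cardinal.mk Label := Cardinal.mk_le_of_injective (f := fun g => (0, g))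
          fun _ _ h => congrArg Prod.snd h
  · exact Cardinal.mk_ne_zero_iff.2 ⟨Quotient.mk _ 1⟩

/-- A chosen labelling of the pairs of a label and a line over `β`. -/
noncomputable def labelEquiv (β : Σ i, (M.surface i).Bdry) : Label × M.Line β ≃ Label :=
  (M.nonempty_labelEquiv β).some

/-- The pieces of the tree of pieces: copies of the universal covers of the pieces of the manifold,
indexed by labels and by elements of a free group. -/
structure Node where
  piece : M.Piece
  label : Label
  word : FreeGroup (M.Torus × Label)

/-- The planes along which the pieces of the tree of pieces are glued. -/
structure Wall where
  torus : M.Torus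
  label : Label
  word : FreeGroup (M.Torus × Label)

variable {M}

/-- The label of the piece on the given side of a wall, and the line along which it contains this
wall. -/
noncomputable def Wall.line (ω : M.Wall) (b : Bool) : Label × M.Line (M.side ω.torus b) :=
  (M.labelEquiv (M.side ω.torus b)).symm ω.label

/-- The piece on the given side of a wall. Crossing the wall multiplies the element of the free
group by a generator which is determined by the wall; this makes the pieces the vertices of a
forest. -/
noncomputable def Wall.node (ω : M.Wall) (b : Bool) : M.Node where
  piece := (M.side ω.torus b).1
  label := (ω.line b).1
  word := ω.word * cond b 1 (FreeGroup.of (ω.torus, ω.label))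

/-- A covering transformation that maps the chosen lift of the boundary circle to the line of the
wall. -/
noncomputable def Wall.rep (ω : M.Wall) (b : Bool) : (M.surface (ω.node b).piece).group :=
  (ω.line b).2.out

variable (M) in
/-- The disjoint union of the pieces of the tree of pieces. -/
abbrev PreTree : Type := Σ v : M.Node, (M.surface v.piece).cover × ℝ

/-- The line of the wall `ω` in the piece on the given side, parametrised by arc length. -/
noncomputable def Wall.edge (ω : M.Wall) (b : Bool) (s : ℝ) : (M.surface (ω.node b).piece).cover :=
  ⟨M.edge (M.side ω.torus b) (ω.rep b) s, HyperbolicSurface.edge_mem (ω.rep b).2 _ _⟩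

/-- The point of the wall `ω` with coordinates `u`, as a point of the piece on the given side. -/
noncomputable def wallPt (ω : M.Wall) (b : Bool) (u : ℝ × ℝ) : M.PreTree :=
  ⟨ω.node b, ω.edge b (M.coord ω.torus b u).1, (M.coord ω.torus b u).2⟩

/-- The identification of the two copies of each wall. -/
def TreeGlue (x y : M.PreTree) : Prop :=
  ∃ (ω : M.Wall) (b : Bool) (u : ℝ × ℝ), x = wallPt ω b u ∧ y = wallPt ω (!b) u

variable (M) in
/-- The tree of pieces: a disjoint union of copies of the universal covers `F̃ × ℝ` of the pieces,
glued along walls in the pattern of a forest. It is a covering space of the flip manifold, in which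
the pieces are embedded and each wall separates. -/
abbrev Tree : Type := Quot (TreeGlue (M := M))

/-- The point of the flip manifold below a point of a piece of the tree, in coordinates of the
universal cover of a piece. -/
def toChart (x : M.PreTree) : M.Chart := ⟨x.1.piece, x.2⟩

theorem PreTree.ext {x y : M.PreTree} (h : x.1 = y.1) (h1 : (x.2.1 : UpperHalfPlane) = y.2.1)
    (h2 : x.2.2 = y.2.2) : x = y := by
  obtain ⟨i, ⟨z, hz⟩, s⟩ := x
  obtain ⟨j, ⟨w, hw⟩, t⟩ := y
  obtain rfl : i = j := h
  obtain rfl : z = w := h1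
  obtain rfl : s = t := h2
  rfl

theorem Wall.edge_eq_edge {ω ω' : M.Wall} {b b' : Bool} (h : ω.node b = ω'.node b') {s s' : ℝ}
    (he : (ω.edge b s : UpperHalfPlane) = ω'.edge b' s') : ω = ω' ∧ b = b' := by
  obtain ⟨τ, k, w⟩ := ω
  obtain ⟨τ', k', w'⟩ := ω'
  obtain ⟨hside, n, -, hn⟩ := FlipManifold.edge_eq_edge (β := M.side τ b) (β' := M.side τ' b')
    (congrArg Node.piece h) (Subtype.property _) (Subtype.property _) he
  obtain ⟨rfl, rfl⟩ := side_injective hside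
  have h1 : (M.labelEquiv (M.side τ b)).symm k = (M.labelEquiv (M.side τ b)).symm k' := by
    refine Prod.ext (congrArg Node.label h) ?_
    rw [← Quotient.out_eq ((M.labelEquiv (M.side τ b)).symm k).2,
      ← Quotient.out_eq ((M.labelEquiv (M.side τ b)).symm k').2]
    exact Quotient.sound ⟨n, hn⟩
  obtain rfl := (M.labelEquiv _).symm.injective h1
  obtain rfl := mul_right_cancel (congrArg Node.word h)
  exact ⟨rfl, rfl⟩

theorem Wall.dist_edge (ω : M.Wall) (b : Bool) (s t : ℝ) :
    dist (ω.edge b s) (ω.edge b t) = |s - t| :=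
  HyperbolicSurface.dist_edge _ _ _ _

theorem Wall.edge_injective (ω : M.Wall) (b : Bool) : Function.Injective (ω.edge b) := by
  intro s t h
  have := ω.dist_edge b s t
  rw [h, dist_self] at this
  linarith [abs_eq_zero.1 this.symm]

theorem wallPt_injective {ω ω' : M.Wall} {b b' : Bool} {u u' : ℝ × ℝ}
    (h : wallPt ω b u = wallPt ω' b' u') : ω = ω' ∧ b = b' ∧ u = u' := by
  have h0 : ω.node b = ω'.node b' := congrArg Sigma.fst h
  have h1 : (ω.edge b (M.coord ω.torus b u).1 : UpperHalfPlane) =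
      ω'.edge b' (M.coord ω'.torus b' u').1 :=
    congrArg (fun x : M.PreTree => (x.2.1 : UpperHalfPlane)) h
  have h2 : (M.coord ω.torus b u).2 = (M.coord ω'.torus b' u').2 :=
    congrArg (fun x : M.PreTree => x.2.2) h
  obtain ⟨rfl, rfl⟩ := Wall.edge_eq_edge h0 h1
  exact ⟨rfl, rfl, coord_injective _ _ (Prod.ext (ω.edge_injective b (Subtype.ext h1)) h2)⟩

theorem TreeGlue.symm {x y : M.PreTree} (h : TreeGlue x y) : TreeGlue y x := by
  obtain ⟨ω, b, u, rfl, rfl⟩ := h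
  exact ⟨ω, !b, u, rfl, by rw [Bool.not_not]⟩

theorem mk_eq_mk_iff {x y : M.PreTree} :
    (Quot.mk TreeGlue x : M.Tree) = Quot.mk TreeGlue y ↔ x = y ∨ TreeGlue x y := by
  constructor
  · intro h
    have h' := Quot.eqvGen_exact h
    clear h
    induction h' with
    | refl x => exact .inl rfl
    | rel x y h => exact .inr h
    | symm x y _ ih =>
      rcases ih with rfl | ih
      · exact .inl rfl
      · exact .inr ih.symm
    | trans x y z _ _ ih1 ih2 =>
      rcases ih1 with rfl | ih1
      · exact ih2
      rcases ih2 with rfl | ih2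
      · exact .inr ih1
      obtain ⟨ω, b, u, rfl, rfl⟩ := ih1
      obtain ⟨ω', b', u', h, rfl⟩ := ih2
      obtain ⟨rfl, rfl, rfl⟩ := wallPt_injective h
      rw [Bool.not_not]
      exact .inl rfl
  · rintro (rfl | h)
    · rfl
    · exact Quot.sound h

theorem mk_wallPt (ω : M.Wall) (b : Bool) (u : ℝ × ℝ) :
    (Quot.mk TreeGlue (wallPt ω (!b) u) : M.Tree) = Quot.mk TreeGlue (wallPt ω b u) :=
  Quot.sound ⟨ω, !b, u, rfl, by rw [Bool.not_not]⟩

theorem deckRel_wallPt (ω : M.Wall) (b : Bool) (u : ℝ × ℝ) :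
    M.DeckRel (toChart (wallPt ω b u)) (M.torusPt ω.torus b u) := by
  refine DeckRel.symm ⟨rfl, ω.rep b, (ω.rep b).2, ?_, 0, by simp [torusPt, toChart, wallPt]⟩
  rw [torusPt_coe, FlipManifold.edge, HyperbolicSurface.smul_edge, mul_one]
  rfl

theorem exists_eq_wallPt {x : M.PreTree} {τ : M.Torus} {b : Bool} {u : ℝ × ℝ}
    (h : M.DeckRel (toChart x) (M.torusPt τ b u)) :
    ∃ (ω : M.Wall) (v : ℝ × ℝ), ω.torus = τ ∧ x = wallPt ω b v := by
  obtain ⟨⟨i, a, w⟩, ⟨z, hz⟩, h⟩ := x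
  obtain ⟨h0, g, hg, h1, n, hn⟩ := h
  obtain rfl : i = (M.side τ b).1 := h0
  have hz' : z = M.edge (M.side τ b) g⁻¹ (M.coord τ b u).1 := by
    rw [torusPt_coe] at h1
    rw [← mul_one g⁻¹, edge, ← HyperbolicSurface.smul_edge]
    exact eq_inv_smul_iff.2 h1
  set ℓ : M.Line (M.side τ b) := Quotient.mk _ ⟨g⁻¹, Subgroup.inv_mem _ hg⟩ with hℓ
  obtain ⟨m, hm⟩ : (M.lineSetoid (M.side τ b)).r ⟨g⁻¹, Subgroup.inv_mem _ hg⟩ ℓ.out :=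
    Quotient.exact (Quotient.out_eq ℓ).symm
  set k := M.labelEquiv (M.side τ b) (a, ℓ) with hk
  obtain ⟨v, hv⟩ := coord_surjective τ b ((M.coord τ b u).1 + m, h)
  have hkk : (M.labelEquiv (M.side τ b)).symm k = (a, ℓ) := by rw [hk, Equiv.symm_apply_apply]
  refine ⟨⟨τ, k, w * (cond b 1 (FreeGroup.of (τ, k)))⁻¹⟩, v, rfl, PreTree.ext ?_ ?_ ?_⟩
  · simp only [wallPt, Wall.node, Wall.line, hkk, inv_mul_cancel_right]
  · simp only [wallPt, Wall.edge, Wall.rep, Wall.line, hkk, hv]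
    exact hz'.trans (hm _)
  · simp only [wallPt, hv]

/-- The covering map from the tree of pieces to the flip manifold. -/
def treeProj : M.Tree → M.Total :=
  Quot.lift (fun x => M.down (toChart x)) (by
    rintro _ _ ⟨ω, b, u, rfl, rfl⟩
    rw [down_eq_of_deckRel (deckRel_wallPt ω b u), down_eq_of_deckRel (deckRel_wallPt ω (!b) u),
      down_torusPt])

/-- Points of the tree are determined by the point below and the choice of a piece: if a point of
the tree lies over a point of a piece of the manifold, it lies in a copy of the universal cover of
this piece. -/
theorem exists_deckRel_of_treeProj_eq {x : M.PreTree} {y : M.Chart}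
    (h : treeProj (Quot.mk TreeGlue x) = M.down y) :
    ∃ x' : M.PreTree, (Quot.mk TreeGlue x' : M.Tree) = Quot.mk TreeGlue x ∧
      M.DeckRel (toChart x') y := by
  rcases down_eq_down_iff.1 h with h | ⟨τ, b, u, h1, h2⟩
  · exact ⟨x, rfl, h⟩
  · obtain ⟨ω, v, rfl, rfl⟩ := exists_eq_wallPt h1
    have h3 := (deckRel_torusPt_iff.1 ((deckRel_wallPt ω b v).symm.trans h1)).2.2
    exact ⟨wallPt ω (!b) v, mk_wallPt ω b v, (deckRel_wallPt ω (!b) v).trans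
      ((deckRel_torusPt_iff.2 ⟨rfl, rfl, h3⟩).trans h2)⟩

end FlipManifold

namespace FlipManifold

variable {M : FlipManifold}

/-! ### The tree of pieces covers the manifold -/

theorem isOpen_sigma_prod_iff {ι : Type*} {B : ι → Type*} [∀ i, PseudoMetricSpace (B i)]
    {A : Set (Σ i, B i × ℝ)} :
    IsOpen A ↔ ∀ i, ∀ x : B i × ℝ, (⟨i, x⟩ : Σ i, B i × ℝ) ∈ A → ∃ δ > 0, ∀ y : B i × ℝ,
      dist x.1 y.1 < δ → dist x.2 y.2 < δ → (⟨i, y⟩ : Σ i, B i × ℝ) ∈ A := by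
  rw [isOpen_sigma_iff]
  refine forall_congr' fun i => ?_
  rw [Metric.isOpen_iff]
  refine forall_congr' fun x => imp_congr_right fun _ => exists_congr fun δ =>
    and_congr_right fun _ => ?_
  constructor
  · intro h y h1 h2
    exact h (by rw [Metric.mem_ball, dist_comm]; exact max_lt h1 h2)
  · intro h y hy
    rw [Metric.mem_ball, dist_comm] at hy
    exact h y ((le_max_left _ _).trans_lt hy) ((le_max_right _ _).trans_lt hy)

/-- Two points lie in the same `F̃ × ℝ`, and both of their coordinates differ by less than `δ`. -/
def Near (δ : ℝ) (x y : M.Chart) : Prop :=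
  x.1 = y.1 ∧ dist (x.2.1 : UpperHalfPlane) y.2.1 < δ ∧ dist x.2.2 y.2.2 < δ

/-- Two points lie in the same piece of the tree, and their coordinates differ by less than `δ`. -/
def TreeNear (δ : ℝ) (x y : M.PreTree) : Prop :=
  x.1 = y.1 ∧ Near δ (toChart x) (toChart y)

theorem Near.symm {δ : ℝ} {x y : M.Chart} (h : Near δ x y) : Near δ y x :=
  ⟨h.1.symm, by rw [dist_comm]; exact h.2.1, by rw [dist_comm]; exact h.2.2⟩

theorem Near.refl {δ : ℝ} (hδ : 0 < δ) (x : M.Chart) : Near δ x x :=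
  ⟨rfl, by simpa using hδ, by simpa using hδ⟩

theorem TreeNear.symm {δ : ℝ} {x y : M.PreTree} (h : TreeNear δ x y) : TreeNear δ y x :=
  ⟨h.1.symm, h.2.symm⟩

theorem TreeNear.trans {δ δ' : ℝ} {x y z : M.PreTree} (h : TreeNear δ x y)
    (h' : TreeNear δ' y z) : TreeNear (δ + δ') x z :=
  ⟨h.1.trans h'.1, h.2.1.trans h'.2.1,
    (dist_triangle _ _ _).trans_lt (add_lt_add h.2.2.1 h'.2.2.1),
    (dist_triangle _ _ _).trans_lt (add_lt_add h.2.2.2 h'.2.2.2)⟩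

theorem Near.exists_of_deckRel {δ : ℝ} {x x' y : M.Chart} (hx : M.DeckRel x x')
    (h : Near δ x y) : ∃ y', Near δ x' y' ∧ M.DeckRel y y' := by
  obtain ⟨i, z, s⟩ := x
  obtain ⟨j, z', s'⟩ := x'
  obtain ⟨k, w, t⟩ := y
  obtain ⟨h0, g, hg, h1, n, hn⟩ := hx
  obtain rfl : i = j := h0
  obtain ⟨h0', h2, h3⟩ := h
  obtain rfl : i = k := h0'
  refine ⟨⟨i, HyperbolicSurface.deck hg w, t + n⟩, ⟨rfl, ?_, ?_⟩, rfl, g, hg, rfl, n, rfl⟩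
  · change dist (z' : UpperHalfPlane) (g • (w : UpperHalfPlane)) < δ
    rw [← h1, dist_smul]
    exact h2
  · simp only at hn h3 ⊢
    rw [hn, dist_add_right]
    exact h3

theorem exists_treeNear {δ : ℝ} {x : M.PreTree} {x' y' : M.Chart}
    (hx : M.DeckRel (toChart x) x') (h : Near δ x' y') :
    ∃ y, TreeNear δ x y ∧ M.DeckRel (toChart y) y' := by
  obtain ⟨⟨i, y⟩, h1, h2⟩ := h.exists_of_deckRel hx.symm
  obtain ⟨v, x⟩ := x
  obtain rfl : v.piece = i := h1.1
  exact ⟨⟨v, y⟩, ⟨rfl, h1⟩, h2.symm⟩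

/-- The number `δ` is so small that the `2 δ`-neighbourhood of `x` is embedded in the manifold, up
to the gluing of the boundary tori, and meets at most one boundary plane, which then contains
`x`. -/
structure Good (δ : ℝ) (x : M.Chart) : Prop where
  pos : 0 < δ
  two_mul_le_one : 2 * δ ≤ 1
  near_edge : ∀ g ∈ (M.surface x.1).group, ∀ (b : (M.surface x.1).Bdry) (s : ℝ),
    dist ((M.surface x.1).edge g b s) x.2.1 < δ → ∃ r, (M.surface x.1).edge g b r = x.2.1
  near_smul : ∀ g ∈ (M.surface x.1).group,
    dist (g • (x.2.1 : UpperHalfPlane)) x.2.1 < 2 * δ → g • (x.2.1 : UpperHalfPlane) = x.2.1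
  separation : ∀ g ∈ (M.surface x.1).group, ∀ g' ∈ (M.surface x.1).group,
    ∀ (b b' : (M.surface x.1).Bdry) (s t : ℝ),
      dist ((M.surface x.1).edge g b s) ((M.surface x.1).edge g' b' t) < 2 * δ →
        ∃ r, (M.surface x.1).edge g b s = (M.surface x.1).edge g' b' r

theorem Good.mono {δ δ' : ℝ} {x : M.Chart} (h : Good δ x) (h0 : 0 < δ') (hle : δ' ≤ δ) :
    Good δ' x where
  pos := h0
  two_mul_le_one := by linarith [h.two_mul_le_one]
  near_edge g hg b s hs := h.near_edge g hg b s (hs.trans_le hle)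
  near_smul g hg hs := h.near_smul g hg (by linarith)
  separation g hg g' hg' b b' s t hs := h.separation g hg g' hg' b b' s t (by linarith)

theorem Good.of_deckRel {δ : ℝ} {x y : M.Chart} (h : Good δ x) (hxy : M.DeckRel x y) :
    Good δ y := by
  obtain ⟨i, ⟨z, hz⟩, s⟩ := x
  obtain ⟨j, ⟨w, hw⟩, t⟩ := y
  obtain ⟨h0, k, hk, h1, -⟩ := hxy
  obtain rfl : i = j := h0
  obtain rfl : k • z = w := h1
  refine ⟨h.pos, h.two_mul_le_one, fun g hg b r hr => ?_, fun g hg hr => ?_, h.separation⟩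
  · simp only at hr hg ⊢
    obtain ⟨r', hr'⟩ := h.near_edge (k⁻¹ * g) (Subgroup.mul_mem _ (Subgroup.inv_mem _ hk) hg) b r
      (by
        rw [← HyperbolicSurface.smul_edge, ← dist_smul k, smul_inv_smul]
        exact hr)
    have h2 := congrArg (fun v => k • v) hr'
    simp only [HyperbolicSurface.smul_edge, mul_inv_cancel_left] at h2
    exact ⟨r', h2⟩
  · simp only at hr hg ⊢
    have := h.near_smul (k⁻¹ * (g * k))
      (Subgroup.mul_mem _ (Subgroup.inv_mem _ hk) (Subgroup.mul_mem _ hg hk)) (by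
        simp only
        rw [mul_smul, mul_smul, ← dist_smul k, smul_inv_smul]
        exact hr)
    simp only at this
    rw [mul_smul, mul_smul, inv_smul_eq_iff] at this
    exact this

theorem exists_good (x : M.Chart) : ∃ δ, Good δ x := by
  obtain ⟨ε₁, h₁, hε₁⟩ := (M.surface x.1).exists_edge_separation
  obtain ⟨ε₂, h₂, hε₂⟩ := (M.surface x.1).exists_forall_edge_near x.2.1
  obtain ⟨ε₃, h₃, hε₃⟩ := (M.surface x.1).exists_forall_smul_near x.2.1
  set δ := min (min 1 ε₁) (min ε₂ ε₃) / 2 with hδ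
  have hpos : 0 < min (min 1 ε₁) (min ε₂ ε₃) :=
    lt_min (lt_min one_pos h₁) (lt_min h₂ h₃)
  have e1 : min (min 1 ε₁) (min ε₂ ε₃) ≤ 1 := (min_le_left _ _).trans (min_le_left _ _)
  have e2 : min (min 1 ε₁) (min ε₂ ε₃) ≤ ε₁ := (min_le_left _ _).trans (min_le_right _ _)
  have e3 : min (min 1 ε₁) (min ε₂ ε₃) ≤ ε₂ := (min_le_right _ _).trans (min_le_left _ _)
  have e4 : min (min 1 ε₁) (min ε₂ ε₃) ≤ ε₃ := (min_le_right _ _).trans (min_le_right _ _)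
  refine ⟨δ, by linarith, by linarith, fun g hg b s hs => hε₂ g hg b s (by linarith),
    fun g hg hs => hε₃ g hg (by linarith),
    fun g hg g' hg' b b' s t hs => hε₁ g hg g' hg' b b' s t (by linarith)⟩

theorem exists_forall_good (z : M.Total) : ∃ δ, ∀ x, M.down x = z → Good δ x := by
  obtain ⟨x₀, rfl⟩ := down_surjective z
  obtain ⟨δ₀, h₀⟩ := exists_good x₀
  by_cases h : ∃ τ b u, M.DeckRel x₀ (M.torusPt τ b u)
  · obtain ⟨τ, b, u, hu⟩ := h
    obtain ⟨δ₁, h₁⟩ := exists_good (M.torusPt τ (!b) u)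
    refine ⟨min δ₀ δ₁, fun x hx => ?_⟩
    have hpos := lt_min h₀.pos h₁.pos
    rcases down_eq_down_iff.1 hx.symm with hx | ⟨τ', b', u', h2, h3⟩
    · exact (h₀.mono hpos (min_le_left _ _)).of_deckRel hx
    · obtain ⟨rfl, rfl, hi⟩ := deckRel_torusPt_iff.1 (hu.symm.trans h2)
      exact (h₁.mono hpos (min_le_right _ _)).of_deckRel
        ((deckRel_torusPt_iff.2 ⟨rfl, rfl, hi⟩).trans h3)
  · refine ⟨δ₀, fun x hx => ?_⟩
    rcases down_eq_down_iff.1 hx.symm with hx | ⟨τ', b', u', h2, h3⟩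
    · exact h₀.of_deckRel hx
    · exact absurd ⟨τ', b', u', h2⟩ h

/-- A point near a point of a wall lies itself on this wall, and the two points are near in both of
the pieces which meet along the wall. -/
theorem Good.exists_eq_wallPt {δ : ℝ} {x : M.PreTree} (hx : Good δ (toChart x)) {ω : M.Wall}
    {b : Bool} {v : ℝ × ℝ} (h : TreeNear δ x (wallPt ω b v)) :
    ∃ u, x = wallPt ω b u ∧ TreeNear δ (wallPt ω (!b) u) (wallPt ω (!b) v) := by
  obtain ⟨w, z, s⟩ := x
  obtain rfl : w = ω.node b := h.1
  obtain ⟨r, hr⟩ := hx.near_edge (ω.rep b) (ω.rep b).2 (M.side ω.torus b).2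
    (M.coord ω.torus b v).1 h.symm.2.2.1
  obtain ⟨u, hu⟩ := coord_surjective ω.torus b (r, s)
  have hxu : (⟨ω.node b, z, s⟩ : M.PreTree) = wallPt ω b u :=
    PreTree.ext rfl (by rw [wallPt, hu]; exact hr.symm) (by rw [wallPt, hu])
  refine ⟨u, hxu, ?_⟩
  rw [hxu] at h
  have hd : ∀ b, dist ((toChart (wallPt ω b u)).2.1 : UpperHalfPlane) (toChart (wallPt ω b v)).2.1 =
      dist (M.coord ω.torus b u).1 (M.coord ω.torus b v).1 := fun b => by
    rw [Real.dist_eq]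
    exact ω.dist_edge b _ _
  refine ⟨rfl, rfl, ?_, ?_⟩
  · rw [hd, dist_coord_fst, Bool.not_not]
    exact h.2.2.2
  · have := h.2.2.1
    rw [hd, dist_coord_fst] at this
    exact this

theorem Good.exists_mk_eq {δ : ℝ} {x y y' : M.PreTree} (hx : Good δ (toChart x))
    (h : TreeNear δ x y) (hy : (Quot.mk TreeGlue y : M.Tree) = Quot.mk TreeGlue y') :
    ∃ x' : M.PreTree, (Quot.mk TreeGlue x' : M.Tree) = Quot.mk TreeGlue x ∧
      TreeNear δ x' y' := by
  rcases mk_eq_mk_iff.1 hy with rfl | ⟨ω, b, v, rfl, rfl⟩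
  · exact ⟨x, rfl, h⟩
  · obtain ⟨u, rfl, hu⟩ := hx.exists_eq_wallPt h
    exact ⟨_, mk_wallPt ω b u, hu⟩

theorem Good.eq_of_deckRel {δ : ℝ} {x y : M.PreTree} (hx : Good δ (toChart x))
    (h : TreeNear (δ + δ) x y) (hxy : M.DeckRel (toChart x) (toChart y)) : x = y := by
  obtain ⟨h0, g, hg, h1, n, hn⟩ := hxy
  have hfix := hx.near_smul g hg (by
    rw [h1, dist_comm, two_mul]
    exact h.2.2.1)
  refine PreTree.ext h.1 (hfix.symm.trans h1) ?_
  have h2 := h.2.2.2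
  rw [hn, Real.dist_eq, sub_add_cancel_left, abs_neg] at h2
  have h3 : |(n : ℝ)| < 1 := by linarith [hx.two_mul_le_one]
  rw [← Int.cast_abs, ← Int.cast_one, Int.cast_lt, Int.abs_lt_one_iff] at h3
  rw [h3, Int.cast_zero, add_zero] at hn
  exact hn.symm

/-- The lines of walls over different boundary circles are not near to each other. -/
theorem Good.side_eq {δ : ℝ} {x : M.Chart} (hx : Good δ x) {β β' : Σ i, (M.surface i).Bdry}
    (hβ : x.1 = β.1) (hβ' : x.1 = β'.1) {g g' : SL(2, ℝ)} (hg : g ∈ (M.surface x.1).group)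
    (hg' : g' ∈ (M.surface x.1).group) {s t : ℝ}
    (h : dist (M.edge β g s) (M.edge β' g' t) < 2 * δ) : β = β' := by
  obtain ⟨i, x⟩ := x
  obtain ⟨j, c⟩ := β
  obtain ⟨k, c'⟩ := β'
  obtain rfl : i = j := hβ
  obtain rfl : i = k := hβ'
  obtain ⟨r, hr⟩ := hx.separation g hg g' hg' c c' s t h
  obtain ⟨rfl, -⟩ := HyperbolicSurface.edge_eq_edge hg hg' hr
  rfl

/-- Two points of a piece which represent the same point of a torus, but from its two sides, are not
near to each other. -/
theorem Good.not_chartRel_flip {δ : ℝ} {x y : M.PreTree} (hx : Good δ (toChart x))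
    (h : TreeNear (δ + δ) x y) {τ : M.Torus} {b : Bool} {u : ℝ × ℝ}
    (h1 : M.DeckRel (toChart x) (M.torusPt τ b u))
    (h2 : M.DeckRel (M.torusPt τ (!b) u) (toChart y)) : False := by
  obtain ⟨ω, v, rfl, rfl⟩ := FlipManifold.exists_eq_wallPt h1
  obtain ⟨ω', v', hω', rfl⟩ := FlipManifold.exists_eq_wallPt h2.symm
  have hnode : ω.node b = ω'.node !b := h.1
  have hp : (ω.node b).piece = (M.side ω'.torus !b).1 := congrArg Node.piece hnode
  have := hx.side_eq (β := M.side ω.torus b) (β' := M.side ω'.torus !b) (g := ω.rep b)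
    (g' := ω'.rep !b) (s := (M.coord ω.torus b v).1) (t := (M.coord ω'.torus (!b) v').1)
    rfl hp (ω.rep b).2 (by
      change (ω'.rep !b : SL(2, ℝ)) ∈ (M.surface (ω.node b).piece).group
      rw [hnode]
      exact (ω'.rep !b).2) (by rw [two_mul]; exact h.2.2.1)
  exact absurd (side_injective this).2 (by simp)

/-- Disjointness of the sheets over a small neighbourhood. -/
theorem Good.mk_eq_mk_of_near {δ : ℝ} {x₁ x₂ y₁ y₂ : M.PreTree} (h₁ : Good δ (toChart x₁))
    (hgood : ∀ x, M.down x = M.down (toChart x₁) → Good δ x)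
    (hx : M.down (toChart x₁) = M.down (toChart x₂)) (hy₁ : TreeNear δ x₁ y₁)
    (hy₂ : TreeNear δ x₂ y₂) (hy : (Quot.mk TreeGlue y₁ : M.Tree) = Quot.mk TreeGlue y₂) :
    (Quot.mk TreeGlue x₁ : M.Tree) = Quot.mk TreeGlue x₂ := by
  obtain ⟨x, hx1, hxy⟩ := h₁.exists_mk_eq hy₁ hy
  have hdx : M.down (toChart x) = M.down (toChart x₁) := congrArg treeProj hx1
  have hgx := hgood _ hdx
  rw [← hx1]
  have hn := hxy.trans hy₂.symm
  rcases down_eq_down_iff.1 (hdx.trans hx) with h | ⟨τ, b, u, h1, h2⟩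
  · rw [hgx.eq_of_deckRel hn h]
  · exact (hgx.not_chartRel_flip hn h1 h2).elim

/-- Points near to points representing the same point of the tree coincide if they differ by a
covering transformation. -/
theorem Good.mk_eq_mk_of_deckRel {δ : ℝ} {x₁ x₂ y₁ y₂ : M.PreTree} (h₁ : Good δ (toChart x₁))
    (hx : (Quot.mk TreeGlue x₁ : M.Tree) = Quot.mk TreeGlue x₂) (hy₁ : TreeNear δ x₁ y₁)
    (hy₂ : TreeNear δ x₂ y₂) (hy : M.DeckRel (toChart y₁) (toChart y₂)) : y₁ = y₂ := by
  rcases mk_eq_mk_iff.1 hx with rfl | ⟨ω, b, u, rfl, rfl⟩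
  · -- the covering transformation moves the centre by less than `2 δ`
    obtain ⟨h0, g, hg, h1, n, hn⟩ := hy
    have hg' : g ∈ (M.surface x₁.1.piece).group := by
      change g ∈ (M.surface y₁.1.piece).group at hg
      rwa [← hy₁.1] at hg
    have hfix := h₁.near_smul g hg' (by
      calc dist (g • ((toChart x₁).2.1 : UpperHalfPlane)) (toChart x₁).2.1
          ≤ dist (g • ((toChart x₁).2.1 : UpperHalfPlane)) (g • ((toChart y₁).2.1 : UpperHalfPlane))
            + dist (g • ((toChart y₁).2.1 : UpperHalfPlane)) (toChart x₁).2.1 := dist_triangle _ _ _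
        _ < δ + δ := by
          rw [dist_smul, h1, dist_comm _ ((toChart x₁).2.1 : UpperHalfPlane)]
          exact add_lt_add hy₁.2.2.1 hy₂.2.2.1
        _ = 2 * δ := by ring)
    have htriv := (M.surface x₁.1.piece).free g hg' _ (toChart x₁).2.1.2 hfix
    refine PreTree.ext (hy₁.1.symm.trans hy₂.1) ((htriv _).symm.trans h1) ?_
    have h4 : dist (toChart y₁).2.2 (toChart y₂).2.2 < δ + δ :=
      (dist_triangle_left _ _ _).trans_lt (add_lt_add hy₁.2.2.2 hy₂.2.2.2)
    rw [hn, Real.dist_eq, sub_add_cancel_left, abs_neg] at h4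
    have h5 : |(n : ℝ)| < 1 := by linarith [h₁.two_mul_le_one]
    rw [← Int.cast_abs, ← Int.cast_one, Int.cast_lt, Int.abs_lt_one_iff] at h5
    rw [h5, Int.cast_zero, add_zero] at hn
    exact hn.symm
  · -- a translate of the first centre would lie near the second one, but on another line
    obtain ⟨x', hx', hd⟩ := Near.exists_of_deckRel hy hy₁.symm.2
    obtain ⟨x'', hx'', hd'⟩ := exists_treeNear (x := y₂) (.refl _) hx'
    have h3 := hd.trans hd'.symm
    exact ((h₁.of_deckRel h3).not_chartRel_flip (hy₂.trans hx'').symm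
      (h3.symm.trans (deckRel_wallPt ω b u)) (deckRel_wallPt ω (!b) u).symm).elim

/-- Injectivity of the covering map on the sheets over a small neighbourhood. -/
theorem Good.mk_eq_mk_of_down_eq {δ : ℝ} {x₁ x₂ y₁ y₂ : M.PreTree}
    (hgood : ∀ x, M.down x = M.down (toChart x₁) → Good δ x)
    (hx : (Quot.mk TreeGlue x₁ : M.Tree) = Quot.mk TreeGlue x₂) (hy₁ : TreeNear δ x₁ y₁)
    (hy₂ : TreeNear δ x₂ y₂) (hy : M.down (toChart y₁) = M.down (toChart y₂)) :
    (Quot.mk TreeGlue y₁ : M.Tree) = Quot.mk TreeGlue y₂ := by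
  obtain ⟨y, hy1, hd⟩ := exists_deckRel_of_treeProj_eq (x := y₁) hy
  obtain ⟨x, hx1, hn⟩ := (hgood _ rfl).exists_mk_eq hy₁ hy1.symm
  have hdx : M.down (toChart x) = M.down (toChart x₁) := congrArg treeProj hx1
  rw [← hy1, (hgood _ hdx).mk_eq_mk_of_deckRel (hx1.trans hx) hn hy₂ hd]

/-- The image in the tree of the `δ`-balls around the points representing `e`. -/
def sheet (δ : ℝ) (e : M.Tree) : Set M.Tree :=
  {f | ∃ x y, Quot.mk TreeGlue x = e ∧ Quot.mk TreeGlue y = f ∧ TreeNear δ x y}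

/-- The image in the manifold of the `δ`-balls around the points representing `z`. -/
def base (δ : ℝ) (z : M.Total) : Set M.Total :=
  {w | ∃ x y, M.down x = z ∧ M.down y = w ∧ Near δ x y}

theorem isOpen_preimage_mk_iff {A : Set M.Tree} :
    IsOpen A ↔ ∀ x : M.PreTree, Quot.mk TreeGlue x ∈ A → ∃ δ > 0, ∀ y, TreeNear δ x y →
      Quot.mk TreeGlue y ∈ A := by
  rw [← (isQuotientMap_quot_mk (r := TreeGlue (M := M))).isOpen_preimage, isOpen_sigma_prod_iff]
  constructor
  · rintro h ⟨v, x⟩ hx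
    obtain ⟨δ, hδ, h⟩ := h v x hx
    refine ⟨δ, hδ, ?_⟩
    rintro ⟨w, y⟩ ⟨h0, h1⟩
    obtain rfl : v = w := h0
    exact h y h1.2.1 h1.2.2
  · intro h v x hx
    obtain ⟨δ, hδ, h⟩ := h ⟨v, x⟩ hx
    exact ⟨δ, hδ, fun y h1 h2 => h ⟨v, y⟩ ⟨rfl, rfl, h1, h2⟩⟩

theorem isOpen_preimage_down_iff {A : Set M.Total} :
    IsOpen A ↔ ∀ x : M.Chart, M.down x ∈ A → ∃ δ > 0, ∀ y, Near δ x y → M.down y ∈ A := by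
  rw [← (isQuotientMap_down (M := M)).isOpen_preimage, isOpen_sigma_prod_iff]
  constructor
  · rintro h ⟨v, x⟩ hx
    obtain ⟨δ, hδ, h⟩ := h v x hx
    refine ⟨δ, hδ, ?_⟩
    rintro ⟨w, y⟩ ⟨h0, h1⟩
    obtain rfl : v = w := h0
    exact h y h1.1 h1.2
  · intro h v x hx
    obtain ⟨δ, hδ, h⟩ := h ⟨v, x⟩ hx
    exact ⟨δ, hδ, fun y h1 h2 => h ⟨v, y⟩ ⟨rfl, h1, h2⟩⟩

theorem continuous_treeProj : Continuous (treeProj (M := M)) := by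
  refine continuous_def.2 fun A hA => isOpen_preimage_mk_iff.2 fun x hx => ?_
  obtain ⟨δ, hδ, h⟩ := isOpen_preimage_down_iff.1 hA (toChart x) hx
  exact ⟨δ, hδ, fun y hy => h _ hy.2⟩

theorem isOpenMap_treeProj : IsOpenMap (treeProj (M := M)) := by
  intro A hA
  refine isOpen_preimage_down_iff.2 fun y hy => ?_
  obtain ⟨e, he, hey⟩ := hy
  obtain ⟨x, rfl⟩ := Quot.exists_rep e
  obtain ⟨x', hx', hd⟩ := exists_deckRel_of_treeProj_eq hey
  rw [← hx'] at he
  obtain ⟨δ, hδ, h⟩ := isOpen_preimage_mk_iff.1 hA x' he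
  refine ⟨δ, hδ, fun z hz => ?_⟩
  obtain ⟨z', hz', hd'⟩ := exists_treeNear hd hz
  exact ⟨_, h z' hz', down_eq_of_deckRel hd'⟩

theorem TreeNear.exists_shrink {δ : ℝ} {x y : M.PreTree} (h : TreeNear δ x y) :
    ∃ δ' > 0, ∀ z, TreeNear δ' y z → TreeNear δ x z := by
  refine ⟨min (δ - dist ((toChart x).2.1 : UpperHalfPlane) (toChart y).2.1)
    (δ - dist (toChart x).2.2 (toChart y).2.2),
    lt_min (sub_pos.2 h.2.2.1) (sub_pos.2 h.2.2.2), fun z hz => ⟨h.1.trans hz.1,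
      h.2.1.trans hz.2.1, (dist_triangle _ (toChart y).2.1.1 _).trans_lt ?_,
      (dist_triangle _ (toChart y).2.2 _).trans_lt ?_⟩⟩
  · have := hz.2.2.1.trans_le (min_le_left _ _)
    linarith
  · have := hz.2.2.2.trans_le (min_le_right _ _)
    linarith

theorem isOpen_sheet {δ : ℝ} {e : M.Tree} (hgood : ∀ x, M.down x = treeProj e → Good δ x) :
    IsOpen (sheet δ e) := by
  refine isOpen_preimage_mk_iff.2 fun y hy => ?_
  obtain ⟨x, y', rfl, h1, h2⟩ := hy
  obtain ⟨x', hx', hn⟩ := (hgood _ rfl).exists_mk_eq h2 h1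
  obtain ⟨δ', hδ', h⟩ := hn.exists_shrink
  exact ⟨δ', hδ', fun z hz => ⟨x', z, hx', rfl, h z hz⟩⟩

theorem exists_toChart_eq (x : M.Chart) : ∃ x' : M.PreTree, toChart x' = x :=
  ⟨⟨⟨x.1, 1, 1⟩, x.2⟩, rfl⟩

theorem treeProj_surjective : Function.Surjective (treeProj (M := M)) := by
  intro z
  obtain ⟨x, rfl⟩ := down_surjective z
  obtain ⟨x, rfl⟩ := exists_toChart_eq x
  exact ⟨Quot.mk _ x, rfl⟩

theorem image_sheet (δ : ℝ) (e : M.Tree) : treeProj '' sheet δ e = base δ (treeProj e) := by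
  ext w
  constructor
  · rintro ⟨_, ⟨x, y, rfl, rfl, h⟩, rfl⟩
    exact ⟨toChart x, toChart y, rfl, rfl, h.2⟩
  · rintro ⟨x, y, hx, rfl, h⟩
    obtain ⟨x₀, rfl⟩ := Quot.exists_rep e
    obtain ⟨x', hx', hd⟩ := exists_deckRel_of_treeProj_eq hx.symm
    obtain ⟨y', hy', hd'⟩ := exists_treeNear hd h
    exact ⟨Quot.mk _ y', ⟨x', y', hx', rfl, hy'⟩, down_eq_of_deckRel hd'⟩

theorem exists_mem_sheet {δ : ℝ} {z : M.Total} {f : M.Tree} (h : treeProj f ∈ base δ z) :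
    ∃ e, treeProj e = z ∧ f ∈ sheet δ e := by
  obtain ⟨x, y, rfl, hy, hn⟩ := h
  obtain ⟨y₀, rfl⟩ := Quot.exists_rep f
  obtain ⟨y', hy', hd⟩ := exists_deckRel_of_treeProj_eq hy.symm
  obtain ⟨x', hx', hd'⟩ := exists_treeNear hd hn.symm
  exact ⟨Quot.mk _ x', down_eq_of_deckRel hd', x', y', rfl, hy', hx'.symm⟩

/-- The fibre of the covering map, as a discrete space. -/
def TreeFibre (z : M.Total) : Type := {e : M.Tree // treeProj e = z}

instance (z : M.Total) : TopologicalSpace (TreeFibre z) := ⊥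

instance (z : M.Total) : DiscreteTopology (TreeFibre z) := ⟨rfl⟩

instance (z : M.Total) : Nonempty (TreeFibre z) :=
  let ⟨e, he⟩ := treeProj_surjective z
  ⟨⟨e, he⟩⟩

theorem isCoveringMap_treeProj : IsCoveringMap (treeProj (M := M)) := by
  have hne : Nonempty (M.Total → M.Tree) := ⟨Function.surjInv treeProj_surjective⟩
  choose δ hδ using exists_forall_good (M := M)
  have hopen : ∀ (z : M.Total) (e : TreeFibre z), IsOpen (sheet (δ z) e.1) := fun z e =>
    isOpen_sheet (by rw [e.2]; exact hδ z)
  have himage : ∀ (z : M.Total) (e : TreeFibre z),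
      treeProj '' sheet (δ z) e.1 = base (δ z) z := fun z e => by
    rw [image_sheet, e.2]
  refine IsCoveringMap.mk _ TreeFibre (fun z => IsOpen.trivializationDiscrete
    (fun e : TreeFibre z => sheet (δ z) e.1) (base (δ z) z) ?_ ?_ ?_ ?_ ?_ ?_) fun z => ?_
  · obtain ⟨e⟩ : Nonempty (TreeFibre z) := inferInstance
    rw [← himage z e]
    exact isOpenMap_treeProj _ (hopen z e)
  · intro e W hW
    refine ⟨fun h => (h.preimage continuous_treeProj).inter (hopen z e), fun h => ?_⟩
    have := isOpenMap_treeProj _ h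
    rwa [Set.image_preimage_inter, himage, Set.inter_eq_left.2 hW] at this
  · rintro ⟨e, rfl⟩ _ ⟨x₁, y₁, h1, rfl, hn⟩ _ ⟨x₂, y₂, rfl, rfl, hn'⟩ heq
    exact Good.mk_eq_mk_of_down_eq (fun x hx => hδ _ x (hx.trans (congrArg treeProj h1))) h1 hn hn'
      heq
  · intro e w hw
    rwa [← himage z e] at hw
  · intro e e' hee
    rw [Function.onFun, Set.disjoint_left]
    rintro _ ⟨x₁, y₁, h1, rfl, hn⟩ ⟨x₂, y₂, h2, h3, hn'⟩
    have hz1 : M.down (toChart x₁) = z := (congrArg treeProj h1).trans e.2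
    have hz2 : M.down (toChart x₂) = z := (congrArg treeProj h2).trans e'.2
    exact hee (Subtype.ext (h1.symm.trans ((Good.mk_eq_mk_of_near (hδ z _ hz1)
      (fun x hx => hδ z x (hx.trans hz1)) (hz1.trans hz2.symm) hn hn' h3.symm).trans h2)))
  · intro f hf
    obtain ⟨e, he, hfe⟩ := exists_mem_sheet hf
    exact Set.mem_iUnion.2 ⟨⟨e, he⟩, hfe⟩
  · obtain ⟨x, hx⟩ := down_surjective z
    exact ⟨x, x, hx, hx, .refl (hδ z x hx).pos x⟩

theorem _root_.IsLocalHomeomorph.locallyPathConnectedSpace {X Y : Type*} [TopologicalSpace X]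
    [TopologicalSpace Y] [LocallyPathConnectedSpace Y] {f : X → Y} (hf : IsLocalHomeomorph f) :
    LocallyPathConnectedSpace X := by
  refine ⟨fun x => Filter.hasBasis_self.2 fun t ht => ?_⟩
  obtain ⟨U, hU, he⟩ := isLocalHomeomorph_iff_isOpenEmbedding_restrict.1 hf x
  have := he.locallyPathConnectedSpace
  obtain ⟨s, ⟨hs, hpc⟩, hst⟩ := (LocallyPathConnectedSpace.path_connected_basis
    (⟨x, mem_of_mem_nhds hU⟩ : U)).mem_iff.1 (continuous_subtype_val.continuousAt ht)
  refine ⟨Subtype.val '' s, ?_, hpc.image continuous_subtype_val, Set.image_subset_iff.2 hst⟩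
  rw [← map_nhds_subtype_coe_eq_nhds (mem_of_mem_nhds hU) hU]
  exact Filter.image_mem_map hs

/-- Through a covering space of the manifold which is simply connected, the covering map factors
over the tree of pieces. -/
theorem exists_lift_to_tree {X : Type*} [TopologicalSpace X] [SimplyConnectedSpace X]
    {p : X → M.Total} (hp : IsCoveringMap p) :
    ∃ Φ : X → M.Tree, Continuous Φ ∧ ∀ x, treeProj (Φ x) = p x := by
  have := hp.isLocalHomeomorph.locallyPathConnectedSpace
  obtain ⟨x₀⟩ : Nonempty X := inferInstance
  obtain ⟨e₀, he₀⟩ := treeProj_surjective (p x₀)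
  obtain ⟨Φ, ⟨-, hΦ⟩, -⟩ := isCoveringMap_treeProj.existsUnique_continuousMap_lifts
    ⟨p, hp.continuous⟩ x₀ e₀ he₀
  exact ⟨Φ, Φ.continuous, fun x => congrFun hΦ x⟩

end FlipManifold

/-! ### Products with the real line -/

section ProdDist

variable {B : Type*} [MetricSpace B]

/-- The `ℓ²` product metric on the product of a metric space and the real line. -/
noncomputable def pdist (x y : B × ℝ) : ℝ := √(dist x.1 y.1 ^ 2 + dist x.2 y.2 ^ 2)

theorem pdist_eq (x y : B × ℝ) : pdist x y = dist (WithLp.toLp 2 x) (WithLp.toLp 2 y) := by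
  rw [WithLp.prod_dist_eq_add (by norm_num), pdist, Real.sqrt_eq_rpow]
  norm_num

theorem pdist_nonneg (x y : B × ℝ) : 0 ≤ pdist x y := Real.sqrt_nonneg _

theorem pdist_self (x : B × ℝ) : pdist x x = 0 := by rw [pdist_eq, dist_self]

theorem pdist_comm (x y : B × ℝ) : pdist x y = pdist y x := by
  rw [pdist_eq, pdist_eq, dist_comm]

theorem pdist_triangle (x y z : B × ℝ) : pdist x z ≤ pdist x y + pdist y z := by
  simp only [pdist_eq]; exact dist_triangle _ _ _

theorem dist_fst_le_pdist (x y : B × ℝ) : dist x.1 y.1 ≤ pdist x y :=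
  Real.le_sqrt_of_sq_le (by nlinarith [sq_nonneg (dist x.2 y.2)])

theorem dist_snd_le_pdist (x y : B × ℝ) : dist x.2 y.2 ≤ pdist x y :=
  Real.le_sqrt_of_sq_le (by nlinarith [sq_nonneg (dist x.1 y.1)])

theorem pdist_le_add (x y : B × ℝ) : pdist x y ≤ dist x.1 y.1 + dist x.2 y.2 := by
  have h1 : 0 ≤ dist x.1 y.1 := dist_nonneg
  have h2 : 0 ≤ dist x.2 y.2 := dist_nonneg
  exact Real.sqrt_le_iff.2 ⟨by positivity, by nlinarith⟩

theorem continuous_pdist : Continuous fun p : (B × ℝ) × (B × ℝ) => pdist p.1 p.2 := by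
  unfold pdist; fun_prop

/-- A geodesic of the product projects to a geodesic of the base. -/
theorem dist_add_dist_eq_of_pdist {x y z : B × ℝ} (h : pdist x z + pdist z y ≤ pdist x y) :
    dist x.1 z.1 + dist z.1 y.1 = dist x.1 y.1 := by
  refine le_antisymm ?_ (dist_triangle _ _ _)
  have t1 := dist_triangle x.1 z.1 y.1
  have t2 := dist_triangle x.2 z.2 y.2
  have hR := Real.sq_sqrt (show 0 ≤ dist x.1 y.1 ^ 2 + dist x.2 y.2 ^ 2 by positivity)
  have hP := Real.sq_sqrt (show 0 ≤ dist x.1 z.1 ^ 2 + dist x.2 z.2 ^ 2 by positivity)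
  have hQ := Real.sq_sqrt (show 0 ≤ dist z.1 y.1 ^ 2 + dist z.2 y.2 ^ 2 by positivity)
  have hP0 := pdist_nonneg x z
  have hQ0 := pdist_nonneg z y
  have hR0 := pdist_nonneg x y
  unfold pdist at h hP0 hQ0 hR0
  set P := √(dist x.1 z.1 ^ 2 + dist x.2 z.2 ^ 2)
  set Q := √(dist z.1 y.1 ^ 2 + dist z.2 y.2 ^ 2)
  set R := √(dist x.1 y.1 ^ 2 + dist x.2 y.2 ^ 2)
  have ha : 0 ≤ dist x.1 z.1 := dist_nonneg
  have hb : 0 ≤ dist z.1 y.1 := dist_nonneg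
  have hc : 0 ≤ dist x.2 z.2 := dist_nonneg
  have he : 0 ≤ dist z.2 y.2 := dist_nonneg
  have hD : 0 ≤ dist x.1 y.1 := dist_nonneg
  have hH : 0 ≤ dist x.2 y.2 := dist_nonneg
  generalize dist x.1 z.1 = a at *
  generalize dist z.1 y.1 = b at *
  generalize dist x.2 z.2 = c at *
  generalize dist z.2 y.2 = e at *
  generalize dist x.1 y.1 = D at *
  generalize dist x.2 y.2 = H at *
  have hCS : a * b + c * e ≤ P * Q := by
    refine le_of_sq_le_sq ?_ (by positivity)
    rw [mul_pow, hP, hQ]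
    nlinarith [sq_nonneg (a * e - b * c)]
  have hsq : (P + Q) ^ 2 ≤ R ^ 2 := by gcongr
  have hsq2 : (c + e) ^ 2 ≥ H ^ 2 := by gcongr
  refine le_of_sq_le_sq ?_ hD
  nlinarith

/-- A compactness statement: points over a closed set `K` disjoint from a closed convex set `ℓ` are
uniformly far from being on geodesics between points over `ℓ`, in bounded regions. -/
theorem exists_pos_forall_pdist_lt [ProperSpace B] {ℓ K : Set B} (hℓ : IsClosed ℓ)
    (hK : IsClosed K) (hdisj : Disjoint ℓ K)
    (hconv : ∀ x ∈ ℓ, ∀ y ∈ ℓ, ∀ z, dist x z + dist z y = dist x y → z ∈ ℓ) (o : B × ℝ) (R : ℝ) :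
    ∃ η > 0, ∀ x y z : B × ℝ, x.1 ∈ ℓ → y.1 ∈ ℓ → z.1 ∈ K → pdist o x ≤ R → pdist o y ≤ R →
      pdist x y + η < pdist x z + pdist z y := by
  set S : Set ((B × ℝ) × (B × ℝ) × (B × ℝ)) := {q | q.1.1 ∈ ℓ ∧ q.2.1.1 ∈ ℓ ∧ q.2.2.1 ∈ K ∧
    pdist o q.1 ≤ R ∧ pdist o q.2.1 ≤ R ∧ pdist o q.2.2 ≤ 2 * R + 1} with hS
  set f : (B × ℝ) × (B × ℝ) × (B × ℝ) → ℝ := fun q =>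
    pdist q.1 q.2.2 + pdist q.2.2 q.2.1 - pdist q.1 q.2.1 with hf
  have hp : ∀ {g h : (B × ℝ) × (B × ℝ) × (B × ℝ) → B × ℝ}, Continuous g → Continuous h →
      Continuous fun q => pdist (g q) (h q) := fun hg hh => continuous_pdist.comp (hg.prodMk hh)
  have hfc : Continuous f :=
    ((hp (by fun_prop) (by fun_prop)).add (hp (by fun_prop) (by fun_prop))).sub
      (hp (by fun_prop) (by fun_prop))
  have hSclosed : IsClosed S := by
    refine (hℓ.preimage (by fun_prop)).inter ((hℓ.preimage (by fun_prop)).inter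
      ((hK.preimage (by fun_prop)).inter ((isClosed_le (hp ?_ ?_) ?_).inter
        ((isClosed_le (hp ?_ ?_) ?_).inter (isClosed_le (hp ?_ ?_) ?_))))) <;> fun_prop
  have hball : ∀ (x : B × ℝ) (r : ℝ), pdist o x ≤ r → x ∈ Metric.closedBall o r := fun x r hx => by
    rw [Metric.mem_closedBall, dist_comm]
    exact max_le ((dist_fst_le_pdist _ _).trans hx) ((dist_snd_le_pdist _ _).trans hx)
  have hScomp : IsCompact S :=
    ((isCompact_closedBall o R).prod ((isCompact_closedBall o R).prod
      (isCompact_closedBall o (2 * R + 1)))).of_isClosed_subset hSclosed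
        fun q hq => ⟨hball _ _ hq.2.2.2.1, hball _ _ hq.2.2.2.2.1, hball _ _ hq.2.2.2.2.2⟩
  have hpos : ∀ q ∈ S, 0 < f q := by
    intro q hq
    by_contra hle
    exact hdisj.le_bot ⟨hconv _ hq.1 _ hq.2.1 _ (dist_add_dist_eq_of_pdist
      (by simp only [hf] at hle; linarith)), hq.2.2.1⟩
  obtain ⟨m, hm, hmin⟩ : ∃ m > 0, ∀ q ∈ S, m ≤ f q := by
    rcases S.eq_empty_or_nonempty with hE | hne
    · exact ⟨1, one_pos, fun q hq => by rw [hE] at hq; exact hq.elim⟩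
    · obtain ⟨q₀, hq₀, h⟩ := hScomp.exists_isMinOn hne hfc.continuousOn
      exact ⟨f q₀, hpos q₀ hq₀, fun q hq => h hq⟩
  refine ⟨min (m / 2) 1, by positivity, fun x y z hx hy hz hox hoy => ?_⟩
  by_cases hoz : pdist o z ≤ 2 * R + 1
  · have h1 := hmin (x, y, z) ⟨hx, hy, hz, hox, hoy, hoz⟩
    simp only [hf] at h1
    linarith [min_le_left (m / 2) 1]
  · have h1 := pdist_triangle o x z
    have h2 := pdist_triangle o y z
    have h3 := pdist_triangle x o y
    rw [pdist_comm x o] at h3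
    rw [pdist_comm z y]
    linarith [min_le_right (m / 2) 1]

end ProdDist

/-! ### Path lengths in a tree of products -/

/-- A union of products `B v × ℝ`, each of them embedded, which are glued along walls (products of
convex closed subsets of the bases with `ℝ`) by isometries interchanging the base and the fibre
directions, such that each wall separates. -/
structure TreeOfProducts (E V : Type*) (B : V → Type*) [∀ v, MetricSpace (B v)] where
  /-- the embedding of the piece `v` -/
  emb : ∀ v, B v × ℝ → E
  emb_injective : ∀ v, Function.Injective (emb v)
  /-- at most two pieces meet in a point -/
  eq_or_eq_or_eq : ∀ {u v w : V} {x y z}, emb u x = emb v y → emb v y = emb w z →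
    u = v ∨ v = w ∨ u = w
  /-- walls are unions of fibres -/
  exists_fibre : ∀ {v w : V} {x : B v} {s : ℝ} {y}, v ≠ w → emb v (x, s) = emb w y →
    ∀ s', ∃ y', emb v (x, s') = emb w y'
  /-- the gluing maps are isometries interchanging base and fibre -/
  dist_flip : ∀ {v w : V} {x x' y y'}, v ≠ w → emb v x = emb w y → emb v x' = emb w y' →
    dist x.1 x'.1 = dist y.2 y'.2
  /-- `side v w u`: the piece `u` lies on the side of `v` of the wall between the pieces `v` and
  `w` -/
  side : V → V → V → Prop
  side_left : ∀ {v w x y}, v ≠ w → emb v x = emb w y → side v w v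
  /-- the two sides of a wall are complementary -/
  side_comm : ∀ {v w u x y}, v ≠ w → emb v x = emb w y → (side w v u ↔ ¬ side v w u)
  /-- pieces on different sides of a wall meet only in this wall -/
  mem_of_side : ∀ {v w x y v' w' x' y'}, v ≠ w → emb v x = emb w y → side v w v' →
    ¬ side v w w' → emb v' x' = emb w' y' →
      emb v' x' ∈ Set.range (emb v) ∧ emb v' x' ∈ Set.range (emb w)
  isClosed_line : ∀ {v w}, v ≠ w → IsClosed {x : B v | ∃ s y, emb v (x, s) = emb w y}
  convex_line : ∀ {v w}, v ≠ w → ∀ x ∈ {x : B v | ∃ s y, emb v (x, s) = emb w y},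
    ∀ y ∈ {x : B v | ∃ s y, emb v (x, s) = emb w y}, ∀ z, dist x z + dist z y = dist x y →
      z ∈ {x : B v | ∃ s y, emb v (x, s) = emb w y}
  /-- the rate at which different walls of a piece diverge -/
  C : ℝ
  divergence : ∀ {v w w'}, v ≠ w → v ≠ w' → w ≠ w' →
    ∀ p ∈ {x : B v | ∃ s y, emb v (x, s) = emb w y},
    ∀ q ∈ {x : B v | ∃ s y, emb v (x, s) = emb w' y},
    (∀ x ∈ {x : B v | ∃ s y, emb v (x, s) = emb w y},
      ∀ y ∈ {x : B v | ∃ s y, emb v (x, s) = emb w' y}, dist p q ≤ dist x y) →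
    ∀ x ∈ {x : B v | ∃ s y, emb v (x, s) = emb w y},
      ∀ y ∈ {x : B v | ∃ s y, emb v (x, s) = emb w' y},
        dist p q + dist x p + dist y q ≤ C * dist x y

namespace TreeOfProducts

variable {E V : Type*} {B : V → Type*} [∀ v, MetricSpace (B v)] (T : TreeOfProducts E V B)

/-- The projection to the base of the wall between two pieces. -/
def line (v w : V) : Set (B v) := {x : B v | ∃ s y, T.emb v (x, s) = T.emb w y}

/-- `T.Path n x y L`: there is a path of length `L` from `x` to `y` which is a concatenation of `n`
segments, each of them a geodesic of the product metric of some piece. -/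
inductive Path : ℕ → E → E → ℝ → Prop
  | nil (x : E) : Path 0 x x 0
  | cons {n : ℕ} {z : E} {L : ℝ} (v : V) (x y : B v × ℝ) :
      Path n (T.emb v y) z L → Path (n + 1) (T.emb v x) z (pdist x y + L)

variable {T}

theorem mem_line {v w : V} {x : B v × ℝ} {y : B w × ℝ} (h : T.emb v x = T.emb w y) :
    x.1 ∈ T.line v w := ⟨x.2, y, h⟩

theorem Path.nonneg {n : ℕ} {x y : E} {L : ℝ} (h : T.Path n x y L) : 0 ≤ L := by
  induction h with
  | nil => exact le_rfl
  | cons v x y _ ih => exact add_nonneg (pdist_nonneg _ _) ih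

theorem Path.trans {m n : ℕ} {x y z : E} {L L' : ℝ} (h : T.Path m x y L) (h' : T.Path n y z L') :
    T.Path (m + n) x z (L + L') := by
  induction h with
  | nil => simpa using h'
  | cons v x y _ ih =>
    convert Path.cons v x y (ih h') using 1 <;> ring

theorem Path.single (v : V) (x y : B v × ℝ) : T.Path 1 (T.emb v x) (T.emb v y) (pdist x y) := by
  simpa using Path.cons v x y (.nil _)

/-- A path from one side of a wall to the other has a vertex on the wall, since each of its
segments is contained in a piece. -/
theorem Path.exists_cross {v w : V} (hvw : v ≠ w) {p : B v × ℝ} {q : B w × ℝ}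
    (hpq : T.emb v p = T.emb w q) {n : ℕ} {x y : E} {L : ℝ} (h : T.Path n x y L) {v' w' : V}
    (hx : x ∈ Set.range (T.emb v')) (hv : T.side v w v') (hy : y ∈ Set.range (T.emb w'))
    (hw : ¬ T.side v w w') :
    ∃ (a : B v × ℝ) (b : B w × ℝ) (n₁ n₂ : ℕ) (L₁ L₂ : ℝ), T.emb v a = T.emb w b ∧
      T.Path n₁ x (T.emb v a) L₁ ∧ T.Path n₂ (T.emb v a) y L₂ ∧ n₁ + n₂ = n ∧ L₁ + L₂ = L := by
  induction h generalizing v' with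
  | nil x =>
    obtain ⟨x', rfl⟩ := hx
    obtain ⟨y', hy'⟩ := hy
    obtain ⟨⟨a, ha⟩, b, hb⟩ := T.mem_of_side hvw hpq hv hw hy'.symm
    exact ⟨a, b, 0, 0, 0, 0, ha.trans hb.symm, ha ▸ .nil _, ha ▸ .nil _, rfl, add_zero 0⟩
  | @cons n z L u x x' h ih =>
    by_cases hu : T.side v w u
    · obtain ⟨a, b, n₁, n₂, L₁, L₂, hab, h1, h2, rfl, rfl⟩ := ih ⟨x', rfl⟩ hu hy
      exact ⟨a, b, n₁ + 1, n₂, _, L₂, hab, .cons u x x' h1, h2, by ring, by ring⟩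
    · obtain ⟨x'', hx''⟩ := hx
      obtain ⟨⟨a, ha⟩, b, hb⟩ := T.mem_of_side hvw hpq hv hu hx''
      rw [hx''] at ha hb
      exact ⟨a, b, 0, n + 1, 0, _, ha.trans hb.symm, ha ▸ .nil _, ha ▸ .cons u x x' h,
        zero_add _, zero_add _⟩

theorem dist_flip' {v w : V} {x x' : B v × ℝ} {y y' : B w × ℝ} (hvw : v ≠ w)
    (h : T.emb v x = T.emb w y) (h' : T.emb v x' = T.emb w y') : dist x.2 x'.2 = dist y.1 y'.1 :=
  (T.dist_flip hvw.symm h.symm h'.symm).symm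

theorem pdist_flip {v w : V} {x x' : B v × ℝ} {y y' : B w × ℝ} (hvw : v ≠ w)
    (h : T.emb v x = T.emb w y) (h' : T.emb v x' = T.emb w y') : pdist x x' = pdist y y' := by
  rw [pdist, pdist, T.dist_flip hvw h h', dist_flip' hvw h h', add_comm]

theorem not_side_right {v w : V} {x : B v × ℝ} {y : B w × ℝ} (hvw : v ≠ w)
    (h : T.emb v x = T.emb w y) : ¬ T.side v w w :=
  (T.side_comm hvw h).1 (T.side_left hvw.symm h.symm)

/-- The pieces are isometrically embedded: a path which leaves a piece through a wall has to return
through the same wall. -/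
theorem Path.pdist_le {n : ℕ} {v : V} {x y : B v × ℝ} {L : ℝ}
    (h : T.Path n (T.emb v x) (T.emb v y) L) : pdist x y ≤ L := by
  induction n using Nat.strong_induction_on generalizing v x y L with
  | _ n ih =>
    generalize hX : T.emb v x = X at h
    cases h with
    | nil =>
      rw [T.emb_injective v hX, pdist_self]
    | @cons n _ L u x' y' h =>
      by_cases huv : u = v
      · subst huv
        have hxx := T.emb_injective u hX
        subst hxx
        have := ih n (by omega) h
        linarith [pdist_triangle x y' y]
      · obtain ⟨a, b, n₁, n₂, L₁, L₂, hab, h1, h2, hn, rfl⟩ := h.exists_cross huv hX.symm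
          ⟨y', rfl⟩ (T.side_left huv hX.symm) ⟨y, rfl⟩ (not_side_right huv hX.symm)
        rw [hab] at h2
        have e1 := ih n₁ (by omega) h1
        have e2 := ih n₂ (by omega) h2
        have e3 := pdist_flip huv hX.symm hab
        linarith [pdist_triangle x b y, pdist_triangle x' y' a]

/-- A point outside of the piece `v` which can be reached from `v` lies beyond some wall of `v`. -/
theorem Path.exists_exit {n : ℕ} {v : V} {x A : E} {L : ℝ} (h : T.Path n A x L)
    (hx : x ∈ Set.range (T.emb v)) (hA : A ∉ Set.range (T.emb v)) :
    ∃ (w u : V) (p : B v × ℝ) (q : B w × ℝ), v ≠ w ∧ T.emb v p = T.emb w q ∧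
      A ∈ Set.range (T.emb u) ∧ ¬ T.side v w u := by
  induction h with
  | nil x => exact absurd hx hA
  | cons u y y' h ih =>
    by_cases hy' : T.emb u y' ∈ Set.range (T.emb v)
    · obtain ⟨p, hp⟩ := hy'
      have hvu : v ≠ u := by
        rintro rfl
        exact hA ⟨y, rfl⟩
      exact ⟨u, u, p, y', hvu, hp, ⟨y, rfl⟩, not_side_right hvu hp⟩
    · obtain ⟨w, u', p, q, hvw, hpq, ⟨y'', hy''⟩, hu'⟩ := ih hx hy'
      refine ⟨w, u, p, q, hvw, hpq, ⟨y, rfl⟩, fun hu => hy' ?_⟩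
      exact (T.mem_of_side hvw hpq hu hu' hy''.symm).1

/-- Pieces are convex: if `A` is a limit of points on paths between two points of `v` of almost
minimal length, then it lies in `v`. Otherwise `A` lies beyond a wall of `v`, to a piece `w`, and
either in `w` or beyond another wall of `w`; in both cases, the paths connect points of the first
wall by a detour of a definite length. -/
theorem mem_range_of_geodesic [∀ v, ProperSpace (B v)] {v : V} {x y : B v × ℝ} {A : E}
    (h : ∀ ε > 0, ∃ n₁ n₂ L₁ L₂, T.Path n₁ (T.emb v x) A L₁ ∧ T.Path n₂ A (T.emb v y) L₂ ∧
      L₁ + L₂ ≤ pdist x y + ε) : A ∈ Set.range (T.emb v) := by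
  by_contra hA
  obtain ⟨_, n, _, L, -, h2, -⟩ := h 1 one_pos
  obtain ⟨w, u, p, q, hvw, hpq, hu, hsu⟩ := h2.exists_exit ⟨y, rfl⟩ hA
  have hsu' : T.side w v u := (T.side_comm hvw hpq).2 hsu
  set R := pdist p x + pdist x y + 1 + pdist p y with hR
  -- the parts of the paths beyond the first wall
  have key : ∀ ε > 0, ε ≤ 1 → ∃ (b₁ b₂ : B w × ℝ) (n₁ n₂ : ℕ) (L₁ L₂ : ℝ),
      b₁.1 ∈ T.line w v ∧ b₂.1 ∈ T.line w v ∧ pdist q b₁ ≤ R ∧ pdist q b₂ ≤ R ∧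
      T.Path n₁ (T.emb w b₁) A L₁ ∧ T.Path n₂ A (T.emb w b₂) L₂ ∧
      L₁ + L₂ ≤ pdist b₁ b₂ + ε := by
    intro ε hε hε1
    obtain ⟨n₁, n₂, L₁, L₂, h1, h2, hL⟩ := h ε hε
    obtain ⟨a₁, b₁, _, m₁, l₁, l₁', hab₁, h11, h12, -, rfl⟩ :=
      h1.exists_cross hvw hpq ⟨x, rfl⟩ (T.side_left hvw hpq) hu hsu
    obtain ⟨b₂, a₂, m₂, _, l₂, l₂', hab₂, h21, h22, -, rfl⟩ :=
      h2.exists_cross hvw.symm hpq.symm hu hsu' ⟨y, rfl⟩ (not_side_right hvw.symm hpq.symm)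
    have e1 := h11.pdist_le
    rw [hab₂] at h22
    have e2 := h22.pdist_le
    rw [hab₁] at h12
    have p1 := h12.nonneg
    have p2 := h21.nonneg
    have f1 := pdist_flip hvw hpq hab₁
    have f2 := pdist_flip hvw hpq hab₂.symm
    have f3 := pdist_flip hvw hab₁ hab₂.symm
    have t1 := pdist_triangle p x a₁
    have t2 := pdist_triangle p y a₂
    have t3 := pdist_triangle x a₁ a₂
    have t4 := pdist_triangle x a₂ y
    have c1 := pdist_comm y a₂
    have q1 := pdist_nonneg p x
    have q2 := pdist_nonneg p y
    have q3 := pdist_nonneg x a₁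
    have q4 := pdist_nonneg a₂ y
    exact ⟨b₁, b₂, m₁, m₂, l₁', l₂, mem_line hab₁.symm, mem_line hab₂, by linarith, by linarith,
      h12, h21, by linarith⟩
  by_cases hAw : A ∈ Set.range (T.emb w)
  · obtain ⟨a, rfl⟩ := hAw
    have hdisj : Disjoint (T.line w v) {a.1} := by
      rw [Set.disjoint_singleton_right]
      rintro ⟨s, z, hz⟩
      obtain ⟨z', hz'⟩ := T.exists_fibre hvw.symm hz a.2
      exact hA ⟨z', hz'.symm⟩
    obtain ⟨ε, hε, H⟩ := exists_pos_forall_pdist_lt (T.isClosed_line hvw.symm)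
      isClosed_singleton hdisj (T.convex_line hvw.symm) q R
    obtain ⟨b₁, b₂, n₁, n₂, L₁, L₂, m1, m2, r1, r2, h1, h2, hL⟩ :=
      key (min ε 1) (by positivity) (min_le_right _ _)
    have := H b₁ b₂ a m1 m2 rfl r1 r2
    linarith [h1.pdist_le, h2.pdist_le, min_le_left ε 1]
  · obtain ⟨_, b₂, _, _, _, _, -, -, -, -, -, h2, -⟩ := key 1 one_pos le_rfl
    obtain ⟨w', u', p', q', hww', hpq', hu', hsu''⟩ := h2.exists_exit ⟨b₂, rfl⟩ hAw
    have hw'v : w' ≠ v := by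
      rintro rfl
      obtain ⟨z, rfl⟩ := hu
      obtain ⟨z', hz'⟩ := hu'
      exact hAw (T.mem_of_side hww' hpq' hsu' hsu'' hz'.symm).1
    have hdisj : Disjoint (T.line w v) (T.line w w') := by
      rw [Set.disjoint_left]
      rintro t ⟨s, z, hz⟩ ⟨s', z', hz'⟩
      obtain ⟨z'', hz''⟩ := T.exists_fibre hww' hz' s
      rcases T.eq_or_eq_or_eq hz.symm hz'' with h | h | h
      exacts [hvw h, hww' h, hw'v h.symm]
    obtain ⟨ε, hε, H⟩ := exists_pos_forall_pdist_lt (T.isClosed_line hvw.symm)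
      (T.isClosed_line hww') hdisj (T.convex_line hvw.symm) q R
    obtain ⟨b₁, b₂, n₁, n₂, L₁, L₂, m1, m2, r1, r2, h1, h2, hL⟩ :=
      key (min ε 1) (by positivity) (min_le_right _ _)
    obtain ⟨k, k', _, _, l, l', hk, h11, h12, -, rfl⟩ := h1.exists_cross hww' hpq' ⟨b₁, rfl⟩
      (T.side_left hww' hpq') hu' hsu''
    have := H b₁ b₂ k m1 m2 (mem_line hk) r1 r2
    linarith [h11.pdist_le, (h12.trans h2).pdist_le, min_le_left ε 1]

/-! ### Special paths in a tree of products -/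

variable (T) in
/-- The combinatorial data of a special path which passes through the pieces `v 0, …, v n` without
backtracking. In the piece `v k` it connects `(α k, η k)` to `(β k, θ k)`, where `α k` and `β k`
realise the distance of the walls to `v (k - 1)` and `v (k + 1)`. -/
structure Turning (n : ℕ) (v : ℕ → V) (α β : ∀ k, B (v k)) (η θ : ℕ → ℝ) : Prop where
  ne_succ : ∀ k < n, v k ≠ v (k + 1)
  ne_add_two : ∀ k, k + 1 < n → v k ≠ v (k + 2)
  glue : ∀ k < n, T.emb (v k) (β k, θ k) = T.emb (v (k + 1)) (α (k + 1), η (k + 1))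
  closest_right : ∀ k < n, ∀ u ∈ T.line (v k) (v (k + 1)), dist (α k) (β k) ≤ dist (α k) u
  closest_left : ∀ k < n, ∀ u ∈ T.line (v (k + 1)) (v k),
    dist (α (k + 1)) (β (k + 1)) ≤ dist u (β (k + 1))
  shortest : ∀ k, k + 1 < n → ∀ u ∈ T.line (v (k + 1)) (v k),
    ∀ u' ∈ T.line (v (k + 1)) (v (k + 2)), dist (α (k + 1)) (β (k + 1)) ≤ dist u u'

namespace Turning

variable {n : ℕ} {v : ℕ → V} {α β : ∀ k, B (v k)} {η θ : ℕ → ℝ}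

/-- A chain of pieces without backtracking does not cross a wall twice. -/
theorem not_side (S : T.Turning n v α β η θ) (m : ℕ) (k : ℕ) (hk : k + (m + 1) ≤ n) :
    ¬ T.side (v k) (v (k + 1)) (v (k + (m + 1))) := by
  induction m using Nat.strong_induction_on generalizing k with
  | _ m ih =>
    have h1 := S.glue k (by omega)
    have hne := S.ne_succ k (by omega)
    rcases m with _ | m
    · exact not_side_right hne h1
    · intro hs
      have hn := ih m (by omega) k (by omega)
      have h2 := S.glue (k + (m + 1)) (by omega)
      obtain ⟨⟨z, hz⟩, z', hz'⟩ := T.mem_of_side hne h1 hs hn h2.symm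
      rcases T.eq_or_eq_or_eq (hz.trans hz'.symm) (hz'.trans h2.symm) with e | e | e
      · exact hne e
      · rcases m with _ | m
        · rcases T.eq_or_eq_or_eq (hz.trans hz'.symm) hz' with e' | e' | e'
          exacts [hne e', S.ne_succ (k + 1) (by omega) e', S.ne_add_two k (by omega) e']
        · have h3 := ih m (by omega) (k + 1) (by omega)
          rw [show k + 1 + (m + 1) = k + (m + 1 + 1) by ring, ← e] at h3
          exact h3 (T.side_left (S.ne_succ (k + 1) (by omega)) (S.glue (k + 1) (by omega)))
      · rw [← e] at hn
        exact hn (T.side_left hne h1)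

/-- The main estimate, for paths which start on the wall between `v k` and `v (k + 1)`, by downward
induction on `k`. The length of the special path is compensated by the terms for the distances of
the starting point to the fibres of the two pieces through the turning point: an error in the
direction of the base of a piece is an error in the direction of the fibre in the next one. The
factor `max T.C 3` accounts for the base directions (`T.C` in the intermediate pieces, `3` in the
last one), and the additional `1` for the fibre directions. -/
theorem sum_add_dist_sub_le (S : T.Turning n v α β η θ) {j : ℕ} (hj : j ≤ n) {y : B (v j) × ℝ}
    (hy : dist (α j) y.1 + dist y.1 (β j) = dist (α j) (β j)) (d k : ℕ) (hk : k + (d + 1) = j)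
    {z' : B (v k) × ℝ} {z : B (v (k + 1)) × ℝ} (hz : T.emb (v k) z' = T.emb (v (k + 1)) z)
    {m : ℕ} {L : ℝ} (h : T.Path m (T.emb (v (k + 1)) z) (T.emb (v j) y) L) :
    ∑ l ∈ Finset.Ico (k + 1) j, pdist (α l, η l) (β l, θ l) + pdist (α j, η j) y +
      dist z.1 (α (k + 1)) - dist z'.1 (β k) ≤ (max T.C 3 + 1) * L := by
  have hflip := T.dist_flip (S.ne_succ k (by omega)) hz (S.glue k (by omega))
  dsimp only at hflip
  rw [hflip]
  induction d generalizing k m L with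
  | zero =>
    subst hk
    have h0 := h.pdist_le
    have c1 := S.closest_left k (by omega) z.1 (mem_line hz.symm)
    have t1 := dist_triangle z.1 y.1 (β (k + 1))
    have t2 := dist_triangle_right z.1 (α (k + 1)) y.1
    have t3 := pdist_le_add (α (k + 1), η (k + 1)) y
    have t4 := dist_triangle_left (η (k + 1)) y.2 z.2
    have b1 := dist_fst_le_pdist z y
    have b2 := dist_snd_le_pdist z y
    have := mul_le_mul_of_nonneg_right (le_max_right T.C 3) h.nonneg
    simp only [zero_add, Finset.Ico_self, Finset.sum_empty] at *
    linarith
  | succ d ih =>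
    have hne := S.ne_succ (k + 1) (by omega)
    have hg := S.glue (k + 1) (by omega)
    have hside := S.not_side d (k + 1) (by omega)
    rw [show k + 1 + (d + 1) = j by omega] at hside
    obtain ⟨a, b, _, _, L₁, L₂, hab, h1, h2, -, rfl⟩ :=
      h.exists_cross hne hg ⟨z, rfl⟩ (T.side_left hne hg) ⟨y, rfl⟩ hside
    rw [hab] at h2
    have f1 := T.dist_flip hne hab hg
    have f2 := dist_flip' hne hab hg
    have hI := ih (k + 1) (by omega) hab h2 f1
    rw [Finset.sum_eq_sum_Ico_succ_bot (by omega)]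
    have hdiv := T.divergence (S.ne_succ k (by omega)).symm hne (S.ne_add_two k (by omega))
      (α (k + 1)) (mem_line (S.glue k (by omega)).symm) (β (k + 1)) (mem_line hg)
      (S.shortest k (by omega)) z.1 (mem_line hz.symm) a.1 (mem_line hab)
    have h0 := h1.pdist_le
    have b1 := dist_fst_le_pdist z a
    have b2 := dist_snd_le_pdist z a
    have t3 := pdist_le_add (α (k + 1), η (k + 1)) (β (k + 1), θ (k + 1))
    have t4 := dist_triangle4 (η (k + 1)) z.2 a.2 (θ (k + 1))
    rw [dist_comm (η (k + 1)) z.2] at t4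
    have m1 := mul_le_mul_of_nonneg_right (le_max_left T.C 3) (dist_nonneg (x := z.1) (y := a.1))
    have m2 : max T.C 3 * dist z.1 a.1 ≤ max T.C 3 * L₁ :=
      mul_le_mul_of_nonneg_left (b1.trans h0) (by positivity)
    dsimp only at *
    linarith

/-- The length of a special path between two of its points is bounded by a multiple of the length
of any path between these points. -/
theorem length_le (S : T.Turning n v α β η θ) {i j : ℕ} (hij : i < j) (hj : j ≤ n)
    {x : B (v i) × ℝ} {y : B (v j) × ℝ}
    (hx : dist (α i) x.1 + dist x.1 (β i) = dist (α i) (β i))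
    (hy : dist (α j) y.1 + dist y.1 (β j) = dist (α j) (β j)) {m : ℕ} {L : ℝ}
    (h : T.Path m (T.emb (v i) x) (T.emb (v j) y) L) :
    pdist x (β i, θ i) + ∑ l ∈ Finset.Ico (i + 1) j, pdist (α l, η l) (β l, θ l) +
      pdist (α j, η j) y ≤ (max T.C 3 + 1) * L := by
  obtain ⟨d, rfl⟩ := Nat.exists_eq_add_of_lt hij
  have hne := S.ne_succ i (by omega)
  have hg := S.glue i (by omega)
  obtain ⟨a, b, _, _, L₁, L₂, hab, h1, h2, -, rfl⟩ :=
    h.exists_cross hne hg ⟨x, rfl⟩ (T.side_left hne hg) ⟨y, rfl⟩ (S.not_side d i (by omega))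
  rw [hab] at h2
  have hI := S.sum_add_dist_sub_le hj hy d i rfl hab h2
  have f2 := dist_flip' hne hab hg
  have h0 := h1.pdist_le
  have c1 := S.closest_right i (by omega) a.1 (mem_line hab)
  have b1 := dist_fst_le_pdist x a
  have b2 := dist_snd_le_pdist x a
  have t1 := dist_triangle (α i) x.1 a.1
  have t2 := dist_triangle_left a.1 (β i) x.1
  have t3 := pdist_le_add x (β i, θ i)
  have t4 := dist_triangle x.2 a.2 (θ i)
  have := mul_le_mul_of_nonneg_right (le_max_right T.C 3) h1.nonneg
  dsimp only at *
  linarith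

end Turning

end TreeOfProducts

/-! ### Separation by walls in the tree of pieces -/

namespace FreeGroup

variable {α : Type*}

open Classical in
/-- Right multiplication by the generator `f'`, with a Boolean which is switched if the edge from
`1` to the generator `f` of the Cayley tree is crossed. -/
noncomputable def crossPerm (f f' : α) : Equiv.Perm (FreeGroup α × Bool) where
  toFun x := (x.1 * of f', x.2 ^^ decide (f' = f ∧ x.1 = 1))
  invFun x := (x.1 * (of f')⁻¹, x.2 ^^ decide (f' = f ∧ x.1 * (of f')⁻¹ = 1))
  left_inv x := by simp
  right_inv x := by simp

/-- The component of `w` in the graph which remains if the edge from `1` to the generator `f` is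
removed from the Cayley tree. -/
noncomputable def crossSide (f : α) (w : FreeGroup α) : Bool :=
  (((lift fun f' => MulOpposite.op (crossPerm f f')) w).unop (1, false)).2

theorem crossPerm_lift_fst (f : α) (w : FreeGroup α) (x : FreeGroup α × Bool) :
    (((lift fun f' => MulOpposite.op (crossPerm f f')) w).unop x).1 = x.1 * w := by
  induction w using FreeGroup.induction_on generalizing x with
  | C1 => simp
  | of a => rw [lift_apply_of]; rfl
  | inv_of a _ => rw [_root_.map_inv, lift_apply_of]; rfl
  | mul a b ha hb => rw [_root_.map_mul, MulOpposite.unop_mul, Equiv.Perm.mul_apply, hb, ha, mul_assoc]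

open Classical in
theorem crossSide_mul_of (f f' : α) (w : FreeGroup α) :
    crossSide f (w * of f') = (crossSide f w ^^ decide (f' = f ∧ w = 1)) := by
  rw [crossSide, crossSide, _root_.map_mul, MulOpposite.unop_mul, Equiv.Perm.mul_apply,
    lift_apply_of]
  change (_ ^^ decide (f' = f ∧ Prod.fst _ = 1)) = _
  rw [crossPerm_lift_fst, one_mul]

end FreeGroup

namespace FlipManifold

variable {M : FlipManifold}

/-- The side of the wall on which a piece lies. -/
noncomputable def Wall.sideOf (ω : M.Wall) (v : M.Node) : Bool :=
  FreeGroup.crossSide (ω.torus, ω.label) (ω.word⁻¹ * v.word)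

/-- The only wall that separates the two pieces which meet along `ω'` is `ω'` itself. -/
theorem Wall.sideOf_eq_iff (ω ω' : M.Wall) (b : Bool) :
    ω.sideOf (ω'.node b) = ω.sideOf (ω'.node !b) ↔ ω' ≠ ω := by
  suffices h : ω.sideOf (ω'.node true) = ω.sideOf (ω'.node false) ↔ ω' ≠ ω by
    cases b
    · rw [eq_comm]; exact h
    · exact h
  have h := FreeGroup.crossSide_mul_of (ω.torus, ω.label) (ω'.torus, ω'.label) (ω.word⁻¹ * ω'.word)
  have h' : ω.sideOf (ω'.node false) = FreeGroup.crossSide (ω.torus, ω.label)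
      (ω.word⁻¹ * ω'.word * FreeGroup.of (ω'.torus, ω'.label)) := by
    simp only [sideOf, node, cond_false, ← mul_assoc]
  have h'' : ω.sideOf (ω'.node true) = FreeGroup.crossSide (ω.torus, ω.label)
      (ω.word⁻¹ * ω'.word) := by
    simp only [sideOf, node, cond_true, mul_one]
  rw [← h', ← h''] at h
  rw [h, ne_eq, ← Bool.xor_false (ω.sideOf (ω'.node true)), Bool.xor_assoc, Bool.xor_right_inj,
    Bool.false_xor, eq_comm, decide_eq_false_iff_not, not_iff_not, inv_mul_eq_one]
  obtain ⟨τ, k, w⟩ := ω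
  obtain ⟨τ', k', w'⟩ := ω'
  simp only [Prod.mk.injEq, mk.injEq, eq_comm (a := w), and_assoc]

theorem Wall.node_ne (ω : M.Wall) (b : Bool) : ω.node b ≠ ω.node !b := fun h =>
  (ω.sideOf_eq_iff ω b).1 (congrArg _ h) rfl

/-- A wall is determined by the two pieces which meet there. -/
theorem Wall.eq_of_node_eq {ω ω' : M.Wall} {b b' : Bool} (h : ω.node b = ω'.node b')
    (h' : ω.node (!b) = ω'.node !b') : ω = ω' ∧ b = b' := by
  obtain rfl : ω' = ω := by
    by_contra hne
    have := (ω.sideOf_eq_iff ω' b').2 hne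
    rw [← h, ← h'] at this
    exact (ω.sideOf_eq_iff ω b).1 this rfl
  refine ⟨rfl, ?_⟩
  by_contra hne
  rw [Bool.eq_not_of_ne hne] at h
  exact ω'.node_ne b' h.symm

/-- The embedding of a piece in the tree of pieces. -/
def treeEmb (v : M.Node) (x : (M.surface v.piece).cover × ℝ) : M.Tree := Quot.mk _ ⟨v, x⟩

theorem exists_wallPt_of_treeEmb_eq {v w : M.Node} {x y} (hvw : v ≠ w)
    (h : treeEmb v x = treeEmb w y) :
    ∃ (ω : M.Wall) (b : Bool) (u : ℝ × ℝ), (⟨v, x⟩ : M.PreTree) = wallPt ω b u ∧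
      (⟨w, y⟩ : M.PreTree) = wallPt ω (!b) u := by
  rcases mk_eq_mk_iff.1 h with h | h
  · exact absurd (congrArg Sigma.fst h) hvw
  · exact h

theorem treeEmb_injective (v : M.Node) : Function.Injective (treeEmb v) := by
  intro x y h
  rcases mk_eq_mk_iff.1 h with h | ⟨ω, b, u, h1, h2⟩
  · exact eq_of_heq (Sigma.mk.inj h).2
  · have e1 : v = ω.node b := congrArg Sigma.fst h1
    have e2 : v = ω.node !b := congrArg Sigma.fst h2
    exact absurd (e1.symm.trans e2) (ω.node_ne b)

theorem exists_wall {v w : M.Node} {x y} (hvw : v ≠ w) (h : treeEmb v x = treeEmb w y) :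
    ∃ (ω : M.Wall) (b : Bool), v = ω.node b ∧ w = ω.node !b := by
  obtain ⟨ω, b, u, h1, h2⟩ := exists_wallPt_of_treeEmb_eq hvw h
  exact ⟨ω, b, congrArg Sigma.fst h1, congrArg Sigma.fst h2⟩

theorem treeEmb_node_eq_iff {ω : M.Wall} {b : Bool} {x y} :
    treeEmb (ω.node b) x = treeEmb (ω.node !b) y ↔ ∃ u : ℝ × ℝ,
      x = (ω.edge b (M.coord ω.torus b u).1, (M.coord ω.torus b u).2) ∧
      y = (ω.edge (!b) (M.coord ω.torus (!b) u).1, (M.coord ω.torus (!b) u).2) := by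
  constructor
  · intro h
    obtain ⟨ω', b', u, h1, h2⟩ := exists_wallPt_of_treeEmb_eq (ω.node_ne b) h
    obtain ⟨rfl, rfl⟩ := Wall.eq_of_node_eq (congrArg Sigma.fst h1) (congrArg Sigma.fst h2)
    exact ⟨u, eq_of_heq (Sigma.mk.inj h1).2, eq_of_heq (Sigma.mk.inj h2).2⟩
  · rintro ⟨u, rfl, rfl⟩
    exact (mk_wallPt ω b u).symm

theorem setOf_treeEmb_eq (ω : M.Wall) (b : Bool) :
    {x | ∃ s y, treeEmb (ω.node b) (x, s) = treeEmb (ω.node !b) y} = Set.range (ω.edge b) := by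
  ext x
  constructor
  · rintro ⟨s, y, h⟩
    obtain ⟨u, hu, -⟩ := treeEmb_node_eq_iff.1 h
    exact ⟨_, (congrArg Prod.fst hu).symm⟩
  · rintro ⟨s, rfl⟩
    obtain ⟨u, hu⟩ := coord_surjective ω.torus b (s, 0)
    exact ⟨0, _, treeEmb_node_eq_iff.2 ⟨u, by rw [hu], rfl⟩⟩

/-- The projection to the base of the wall between two pieces is a boundary line. -/
theorem exists_setOf_treeEmb_eq (v w : M.Node) (hvw : v ≠ w) :
    {x | ∃ s y, treeEmb v (x, s) = treeEmb w y} = ∅ ∨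
      ∃ g ∈ (M.surface v.piece).group, ∃ d, {x | ∃ s y, treeEmb v (x, s) = treeEmb w y} =
        {x : (M.surface v.piece).cover | ∃ s, (x : UpperHalfPlane) =
          (M.surface v.piece).edge g d s} := by
  rcases Set.eq_empty_or_nonempty {x | ∃ s y, treeEmb v (x, s) = treeEmb w y} with h | h
  · exact .inl h
  · obtain ⟨x, s, y, h⟩ := h
    obtain ⟨ω, b, rfl, rfl⟩ := exists_wall hvw h
    refine .inr ⟨ω.rep b, (ω.rep b).2, (M.side ω.torus b).2, ?_⟩
    rw [setOf_treeEmb_eq]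
    ext x
    exact ⟨fun ⟨s, hs⟩ => ⟨s, congrArg Subtype.val hs.symm⟩, fun ⟨s, hs⟩ => ⟨s, Subtype.ext hs.symm⟩⟩

/-- No three pieces meet in a point, since the boundary lines of the universal cover of a surface
are disjoint. -/
theorem eq_or_eq_or_eq_of_treeEmb_eq {u v w : M.Node} {x y z} (h : treeEmb u x = treeEmb v y)
    (h' : treeEmb v y = treeEmb w z) : u = v ∨ v = w ∨ u = w := by
  by_contra! hne
  obtain ⟨ω, b, p, h1, h2⟩ := exists_wallPt_of_treeEmb_eq hne.1 h
  obtain ⟨ω', b', p', h1', h2'⟩ := exists_wallPt_of_treeEmb_eq hne.2.1 h'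
  obtain ⟨rfl, rfl, rfl⟩ := wallPt_injective (h2.symm.trans h1')
  rw [Bool.not_not] at h2'
  exact hne.2.2 (congrArg Sigma.fst (h1.trans h2'.symm))

theorem exists_treeEmb_fibre_eq {v w : M.Node} {x : (M.surface v.piece).cover} {s : ℝ} {y}
    (hvw : v ≠ w) (h : treeEmb v (x, s) = treeEmb w y) (s' : ℝ) :
    ∃ y', treeEmb v (x, s') = treeEmb w y' := by
  obtain ⟨ω, b, rfl, rfl⟩ := exists_wall hvw h
  obtain ⟨u, hu, -⟩ := treeEmb_node_eq_iff.1 h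
  obtain ⟨u', hu'⟩ := coord_surjective ω.torus b ((M.coord ω.torus b u).1, s')
  exact ⟨_, treeEmb_node_eq_iff.2 ⟨u', by rw [hu', (Prod.mk.inj hu).1], rfl⟩⟩

theorem exists_uniform_divergence (M : FlipManifold) : ∃ C : ℝ, ∀ i : M.Piece,
    ∀ g ∈ (M.surface i).group, ∀ g' ∈ (M.surface i).group, ∀ (b b' : (M.surface i).Bdry)
      (s₀ t₀ : ℝ), (∀ s t, (M.surface i).edge g b s ≠ (M.surface i).edge g' b' t) →
      (∀ s t, dist ((M.surface i).edge g b s₀) ((M.surface i).edge g' b' t₀) ≤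
        dist ((M.surface i).edge g b s) ((M.surface i).edge g' b' t)) →
        ∀ s t, dist ((M.surface i).edge g b s₀) ((M.surface i).edge g' b' t₀) + |s - s₀| +
          |t - t₀| ≤ C * dist ((M.surface i).edge g b s) ((M.surface i).edge g' b' t) := by
  choose C hC using fun i => (M.surface i).exists_edge_divergence
  have := M.finite_piece
  obtain ⟨K, hK⟩ := Set.Finite.bddAbove (Set.finite_range C)
  exact ⟨K, fun i g hg g' hg' b b' s₀ t₀ h h' s t => (hC i g hg g' hg' b b' s₀ t₀ h h' s t).trans
    (mul_le_mul_of_nonneg_right (hK ⟨i, rfl⟩) dist_nonneg)⟩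

variable (M) in
/-- The tree of pieces as a union of products whose walls separate. -/
noncomputable def treeOfProducts :
    TreeOfProducts M.Tree M.Node (fun v => (M.surface v.piece).cover) where
  emb := treeEmb
  emb_injective := treeEmb_injective
  eq_or_eq_or_eq := eq_or_eq_or_eq_of_treeEmb_eq
  exists_fibre := exists_treeEmb_fibre_eq
  dist_flip := by
    intro v w x x' y y' hvw h h'
    obtain ⟨ω, b, rfl, rfl⟩ := exists_wall hvw h
    obtain ⟨u, rfl, rfl⟩ := treeEmb_node_eq_iff.1 h
    obtain ⟨u', rfl, rfl⟩ := treeEmb_node_eq_iff.1 h'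
    rw [ω.dist_edge, ← Real.dist_eq, dist_coord_fst]
  side v w u := ∃ (ω : M.Wall) (b : Bool), v = ω.node b ∧ w = ω.node (!b) ∧
    ω.sideOf u = ω.sideOf (ω.node b)
  side_left := by
    intro v w x y hvw h
    obtain ⟨ω, b, rfl, rfl⟩ := exists_wall hvw h
    exact ⟨ω, b, rfl, rfl, rfl⟩
  side_comm := by
    intro v w u x y hvw h
    obtain ⟨ω, b, rfl, rfl⟩ := exists_wall hvw h
    have hb : ω.sideOf (ω.node b) ≠ ω.sideOf (ω.node !b) := fun h =>
      (ω.sideOf_eq_iff ω b).1 h rfl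
    constructor
    · rintro ⟨ω', b', h1, h2, h3⟩ ⟨ω'', b'', h1', h2', h3'⟩
      obtain ⟨rfl, rfl⟩ := Wall.eq_of_node_eq (ω := ω) (b := !b) h1 (by rwa [Bool.not_not])
      obtain ⟨rfl, rfl⟩ := Wall.eq_of_node_eq h1' h2'
      exact hb (h3'.symm.trans h3)
    · intro hn
      refine ⟨ω, !b, rfl, by rw [Bool.not_not], ?_⟩
      have h1 : ω.sideOf u ≠ ω.sideOf (ω.node b) := fun h => hn ⟨ω, b, rfl, rfl, h⟩
      exact (Bool.eq_not_of_ne h1).trans (Bool.eq_not_of_ne hb.symm).symm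
  mem_of_side := by
    rintro v w x y v' w' x' y' hvw h ⟨ω, b, rfl, rfl, hv'⟩ hw' h'
    have hne : ω.sideOf v' ≠ ω.sideOf w' := fun e => hw' ⟨ω, b, rfl, rfl, e.symm.trans hv'⟩
    have hvw' : v' ≠ w' := fun e => hne (congrArg _ e)
    obtain ⟨ω', b', rfl, rfl⟩ := exists_wall hvw' h'
    obtain rfl : ω' = ω := by
      by_contra hω
      exact hne ((ω.sideOf_eq_iff ω' b').2 hω)
    have key : ∀ b, treeEmb (ω'.node b') x' ∈ Set.range (treeEmb (ω'.node b)) := by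
      intro b
      by_cases hb : b = b'
      · rw [hb]; exact ⟨x', rfl⟩
      · rw [Bool.eq_not_of_ne hb]; exact ⟨y', h'.symm⟩
    exact ⟨key b, key !b⟩
  isClosed_line := by
    intro v w hvw
    rcases exists_setOf_treeEmb_eq v w hvw with h | ⟨g, hg, d, h⟩
    · rw [h]; exact isClosed_empty
    · rw [h]
      simp only [eq_comm (b := HyperbolicSurface.edge _ _ _ _)]
      exact (HyperbolicSurface.isClosed_range_edge g d).preimage continuous_subtype_val
  convex_line := by
    intro v w hvw
    rcases exists_setOf_treeEmb_eq v w hvw with h | ⟨g, hg, d, h⟩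
    · rw [h]; exact fun x hx => hx.elim
    · rw [h]
      rintro ⟨x, hx⟩ ⟨s, rfl⟩ ⟨y, hy⟩ ⟨t, rfl⟩ z hz
      obtain ⟨r, hr⟩ := HyperbolicSurface.exists_edge_eq_of_dist_add_dist_eq hz
      exact ⟨r, hr.symm⟩
  C := M.exists_uniform_divergence.choose
  divergence := by
    intro v w w' hvw hvw' hww'
    have hdisj : ∀ x s y s' y', treeEmb v (x, s) = treeEmb w y →
        treeEmb v (x, s') ≠ treeEmb w' y' := by
      intro x s y s' y' h h'
      obtain ⟨y'', h''⟩ := exists_treeEmb_fibre_eq hvw' h' s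
      rcases eq_or_eq_or_eq_of_treeEmb_eq h.symm h'' with e | e | e
      exacts [hvw e.symm, hvw' e, hww' e]
    rcases exists_setOf_treeEmb_eq v w hvw with h | ⟨g, hg, d, h⟩
    · rw [h]; exact fun x hx => hx.elim
    rcases exists_setOf_treeEmb_eq v w' hvw' with h' | ⟨g', hg', d', h'⟩
    · rw [h']; exact fun _ _ x hx => hx.elim
    have hne : ∀ s t, (M.surface v.piece).edge g d s ≠ (M.surface v.piece).edge g' d' t := by
      intro s t e
      have h1 : (⟨_, HyperbolicSurface.edge_mem hg d s⟩ : (M.surface v.piece).cover) ∈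
        {x | ∃ s y, treeEmb v (x, s) = treeEmb w y} := h ▸ ⟨s, rfl⟩
      have h2 : (⟨_, HyperbolicSurface.edge_mem hg d s⟩ : (M.surface v.piece).cover) ∈
        {x | ∃ s y, treeEmb v (x, s) = treeEmb w' y} := h' ▸ ⟨t, e⟩
      obtain ⟨r, y, h1⟩ := h1
      obtain ⟨r', y', h2⟩ := h2
      exact hdisj _ _ _ _ _ h1 h2
    rw [h, h']
    rintro ⟨p, hp⟩ ⟨s₀, rfl⟩ ⟨q, hq⟩ ⟨t₀, rfl⟩ hmin ⟨x, hx⟩ ⟨s, rfl⟩ ⟨y, hy⟩ ⟨t, rfl⟩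
    have := M.exists_uniform_divergence.choose_spec v.piece g hg g' hg' d d' s₀ t₀ hne
      (fun s t => hmin ⟨_, HyperbolicSurface.edge_mem hg d s⟩ ⟨s, rfl⟩
        ⟨_, HyperbolicSurface.edge_mem hg' d' t⟩ ⟨t, rfl⟩) s t
    rw [← Real.dist_eq, ← Real.dist_eq, ← (HyperbolicSurface.isometry_edge g d).dist_eq,
      ← (HyperbolicSurface.isometry_edge g' d').dist_eq] at this
    exact this

end FlipManifold

namespace FlipManifold

variable {M : FlipManifold}

/-! ### The path metric of the universal cover -/

section CoverDist

variable {X : Type*} [TopologicalSpace X] {p : X → M.Total}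

theorem CoverPiece.prodDist_eq (P : M.CoverPiece p) (u v : P.Base × ℝ) :
    P.prodDist u v = pdist u v := rfl

theorem BrokenGeodesic.trans {x y z : X} {L L' : ℝ} (h : BrokenGeodesic p x y L)
    (h' : BrokenGeodesic p y z L') : BrokenGeodesic p x z (L + L') := by
  induction h' with
  | refl => simpa using h
  | step P u v _ ih => rw [← add_assoc]; exact .step P u v ih

theorem BrokenGeodesic.single (P : M.CoverPiece p) (u v : P.Base × ℝ) :
    BrokenGeodesic p (P.toFun u) (P.toFun v) (P.prodDist u v) := by
  simpa using BrokenGeodesic.step P u v (.refl _)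

theorem BrokenGeodesic.symm {x y : X} {L : ℝ} (h : BrokenGeodesic p x y L) :
    BrokenGeodesic p y x L := by
  induction h with
  | refl => exact .refl _
  | step P u v _ ih =>
    rw [add_comm, P.prodDist_eq, pdist_comm, ← P.prodDist_eq]
    exact (BrokenGeodesic.single P v u).trans ih

theorem coverDist_comm (x y : X) : coverDist p x y = coverDist p y x := by
  have h : ∀ x y : X, coverDist p x y ≤ coverDist p y x := fun x y =>
    le_iInf₂ fun L hL => iInf₂_le L hL.symm
  exact le_antisymm (h x y) (h y x)

theorem coverDist_le_ofReal_iff {x y : X} {D : ℝ} (hD : 0 ≤ D) :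
    coverDist p x y ≤ ENNReal.ofReal D ↔ ∀ ε > 0, ∃ L ≤ D + ε, BrokenGeodesic p x y L := by
  constructor
  · intro h ε hε
    have h1 : coverDist p x y < ENNReal.ofReal (D + ε) :=
      h.trans_lt ((ENNReal.ofReal_lt_ofReal_iff (by linarith)).2 (by linarith))
    simp only [coverDist, iInf_lt_iff] at h1
    obtain ⟨L, hL, hlt⟩ := h1
    exact ⟨L, ((ENNReal.ofReal_lt_ofReal_iff (by linarith)).1 hlt).le, hL⟩
  · intro h
    refine ENNReal.le_of_forall_pos_le_add fun ε hε _ => ?_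
    obtain ⟨L, hL, hb⟩ := h ε hε
    refine (iInf₂_le L hb).trans ((ENNReal.ofReal_le_ofReal hL).trans ?_)
    rw [ENNReal.ofReal_add hD (NNReal.coe_nonneg ε), ENNReal.ofReal_coe_nnreal]

theorem coverDist_le_add {x y z : X} {D D' : ℝ} (hD : 0 ≤ D) (hD' : 0 ≤ D')
    (h : coverDist p x y ≤ ENNReal.ofReal D) (h' : coverDist p y z ≤ ENNReal.ofReal D') :
    coverDist p x z ≤ ENNReal.ofReal (D + D') := by
  rw [coverDist_le_ofReal_iff (by positivity)]
  intro ε hε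
  obtain ⟨L, hL, hb⟩ := (coverDist_le_ofReal_iff hD).1 h (ε / 2) (by positivity)
  obtain ⟨L', hL', hb'⟩ := (coverDist_le_ofReal_iff hD').1 h' (ε / 2) (by positivity)
  exact ⟨L + L', by linarith, hb.trans hb'⟩

/-- A path which has at most unit speed on each of finitely many successive intervals has at most
unit speed. -/
theorem coverDist_le_sub {γ : ℝ → X} {r : ℕ → ℝ} {n : ℕ} (hr : ∀ k < n, r k ≤ r (k + 1))
    (h : ∀ k < n, ∀ s ∈ Set.Icc (r k) (r (k + 1)), ∀ t ∈ Set.Icc (r k) (r (k + 1)), s ≤ t →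
      coverDist p (γ s) (γ t) ≤ ENNReal.ofReal (t - s)) {s t : ℝ} (hs : r 0 ≤ s) (hst : s ≤ t)
    (ht : t ≤ r n) : coverDist p (γ s) (γ t) ≤ ENNReal.ofReal (t - s) := by
  induction n generalizing t with
  | zero =>
    obtain rfl : s = t := by linarith
    exact iInf₂_le_of_le 0 (.refl _) (by simp)
  | succ n ih =>
    have ih' := @ih (fun k hk => hr k (by omega)) (fun k hk => h k (by omega))
    rcases le_total t (r n) with h1 | h1
    · exact ih' hst h1
    · rcases le_total s (r n) with h2 | h2
      · rw [show t - s = (r n - s) + (t - r n) by ring]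
        exact coverDist_le_add (by linarith) (by linarith) (ih' h2 le_rfl)
          (h n (by omega) _ ⟨le_rfl, by linarith⟩ _ ⟨h1, ht⟩ h1)
      · exact h n (by omega) _ ⟨h2, by linarith⟩ _ ⟨h1, ht⟩ hst

end CoverDist

/-! ### The pieces of the universal cover in the tree of pieces -/

theorem continuous_treeEmb (v : M.Node) : Continuous (treeEmb v) :=
  continuous_quot_mk.comp continuous_sigmaMk

section TreeLabel

variable {X : Type*} [TopologicalSpace X] {p : X → M.Total}

/-- An isometric identification of a piece of the universal cover with a piece of the tree of
pieces, compatible with a map `Φ` between these spaces. -/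
structure TreeLabel (Φ : X → M.Tree) (P : M.CoverPiece p) where
  node : M.Node
  isom : P.Base ≃ᵢ (M.surface node.piece).cover
  shift : ℝ
  eq : ∀ u, Φ (P.toFun u) = treeEmb node (isom u.1, u.2 + shift)

variable {Φ : X → M.Tree}

theorem nonempty_treeLabel (hc : Continuous Φ) (hΦ : ∀ x, treeProj (Φ x) = p x)
    (P : M.CoverPiece p) : Nonempty (TreeLabel Φ P) := by
  obtain ⟨i, f, hf, hlift⟩ := P
  obtain ⟨z₀⟩ : Nonempty (M.surface i).cover := inferInstance
  obtain ⟨x, hx⟩ := Quot.exists_rep (Φ (f (z₀, 0)))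
  obtain ⟨⟨⟨j, a, w⟩, y⟩, hx', h0, g, hg, h1, n, hn⟩ :=
    exists_deckRel_of_treeProj_eq (x := x) (y := ⟨i, z₀, 0⟩) (by rw [hx, hΦ, hlift]; rfl)
  obtain rfl : j = i := h0
  change g ∈ (M.surface j).group at hg
  have hg' := (M.surface j).group.inv_mem hg
  let e : (M.surface j).cover ≃ᵢ (M.surface j).cover :=
    IsometryEquiv.mk' ((M.surface j).deck hg') ((M.surface j).deck hg)
      (fun z => Subtype.ext (inv_smul_smul g (z : UpperHalfPlane))) ((M.surface j).isometry_deck hg')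
  refine ⟨⟨⟨j, a, w⟩, e, -n, fun u => ?_⟩⟩
  have key := isCoveringMap_treeProj.eq_of_comp_eq (g₁ := fun u => Φ (f u))
    (g₂ := fun u => treeEmb ⟨j, a, w⟩ (e u.1, u.2 + -(n : ℝ))) (hc.comp hf)
    ((continuous_treeEmb _).comp (by fun_prop)) ?_ (z₀, 0) ?_
  · exact congrFun key u
  · funext u
    change treeProj (Φ (f u)) = M.down ⟨j, (e u.1, u.2 + -(n : ℝ))⟩
    rw [hΦ, hlift]
    exact down_eq_of_deckRel (x := ⟨j, u⟩) ⟨rfl, g⁻¹, hg', rfl, -n, by push_cast; rfl⟩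
  · rw [← hx, ← hx']
    refine congrArg (treeEmb ⟨j, a, w⟩) (Prod.ext (Subtype.ext ?_) ?_)
    · exact (inv_smul_eq_iff.2 h1.symm).symm
    · change (0 : ℝ) = y.2 + n at hn
      simp only
      linarith

namespace TreeLabel

variable {P Q : M.CoverPiece p} (ℓ : TreeLabel Φ P)

/-- The identification of the two pieces. -/
noncomputable def map (u : P.Base × ℝ) : (M.surface ℓ.node.piece).cover × ℝ := (ℓ.isom u.1, u.2 + ℓ.shift)

theorem apply_eq (u : P.Base × ℝ) : Φ (P.toFun u) = M.treeOfProducts.emb ℓ.node (ℓ.map u) := ℓ.eq u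

theorem pdist_map (u v : P.Base × ℝ) : pdist (ℓ.map u) (ℓ.map v) = P.prodDist u v := by
  simp only [pdist, CoverPiece.prodDist, map, dist_add_right]
  rw [ℓ.isom.dist_eq]

/-- Pieces of the universal cover intersect in the same way as the pieces of the tree, provided
that they intersect. -/
theorem mem_carrier {P Q : M.CoverPiece p} (ℓ : TreeLabel Φ P) (ℓ' : TreeLabel Φ Q) (hp : IsCoveringMap p)
    (hΦ : ∀ x, treeProj (Φ x) = p x)
    (h : (P.carrier ∩ Q.carrier).Nonempty) {u : P.Base × ℝ}
    (hu : Φ (P.toFun u) ∈ Set.range (M.treeOfProducts.emb ℓ'.node)) : P.toFun u ∈ Q.carrier := by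
  obtain ⟨_, ⟨u₀, rfl⟩, u₁, h₀⟩ := h
  obtain ⟨v, f, n, hf⟩ := ℓ
  obtain ⟨w, f', n', hf'⟩ := ℓ'
  obtain ⟨y, hy⟩ := hu
  change treeEmb w y = _ at hy
  have hcomp : ∀ {x x' : X}, Φ x = Φ x' → p x = p x' := fun h => by rw [← hΦ, h, hΦ]
  by_cases hvw : v = w
  · subst hvw
    have hQ : ∀ u, Φ (P.toFun u) = Φ (Q.toFun (f'.symm (f u.1), u.2 + n - n')) := fun u => by
      rw [hf, hf']; simp
    have key := hp.eq_of_comp_eq (g₁ := P.toFun)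
      (g₂ := fun u => Q.toFun (f'.symm (f u.1), u.2 + n - n')) P.continuous_toFun
      (Q.continuous_toFun.comp (by fun_prop)) (funext fun u => hcomp (hQ u)) u₀ (by
        rw [← h₀]
        have h1 := hf' u₁
        rw [h₀, hf] at h1
        obtain ⟨h2, h3⟩ := Prod.mk.inj (treeEmb_injective v h1)
        refine congrArg Q.toFun (Prod.ext ?_ ?_)
        · simp [h2]
        · simp [h3])
    exact ⟨_, (congrFun key u).symm⟩
  · have h1 : treeEmb v (f u₀.1, u₀.2 + n) = treeEmb w (f' u₁.1, u₁.2 + n') := by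
      rw [← hf, ← hf', h₀]
    obtain ⟨ω, b, rfl, rfl⟩ := exists_wall hvw h1
    obtain ⟨t₀, ht₀, ht₀'⟩ := treeEmb_node_eq_iff.1 h1
    obtain ⟨t, ht, -⟩ := treeEmb_node_eq_iff.1 ((hf u).symm.trans hy.symm)
    have hedge : ∀ b, Continuous (ω.edge b) := fun b =>
      (Isometry.of_dist_eq fun s t => (ω.dist_edge b s t).trans (Real.dist_eq s t).symm).continuous
    have hcoord := fun b => continuous_coord ω.torus b
    set α : ℝ × ℝ → P.Base × ℝ := fun t =>
      (f.symm (ω.edge b (M.coord ω.torus b t).1), (M.coord ω.torus b t).2 - n) with hα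
    set β : ℝ × ℝ → Q.Base × ℝ := fun t =>
      (f'.symm (ω.edge (!b) (M.coord ω.torus (!b) t).1), (M.coord ω.torus (!b) t).2 - n') with hβ
    have hα' : ∀ (u : P.Base × ℝ) t, (f u.1, u.2 + n) =
        (ω.edge b (M.coord ω.torus b t).1, (M.coord ω.torus b t).2) → α t = u := fun u t h => by
      obtain ⟨h2, h3⟩ := Prod.mk.inj h
      exact Prod.ext (by simp [hα, ← h2]) (by simp [hα, ← h3])
    have hβ' : ∀ (u : Q.Base × ℝ) t, (f' u.1, u.2 + n') =
        (ω.edge (!b) (M.coord ω.torus (!b) t).1, (M.coord ω.torus (!b) t).2) → β t = u :=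
      fun u t h => by
        obtain ⟨h2, h3⟩ := Prod.mk.inj h
        exact Prod.ext (by simp [hβ, ← h2]) (by simp [hβ, ← h3])
    have key := hp.eq_of_comp_eq (g₁ := fun t => P.toFun (α t)) (g₂ := fun t => Q.toFun (β t))
      (P.continuous_toFun.comp (by fun_prop)) (Q.continuous_toFun.comp (by fun_prop))
      (funext fun t => hcomp (by
        rw [hf, hf']
        simpa [hα, hβ] using treeEmb_node_eq_iff.2 ⟨t, rfl, rfl⟩)) t₀
      (by simp only [hα' _ _ ht₀, hβ' _ _ ht₀', h₀])
    refine ⟨β t, ?_⟩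
    rw [← congrFun key t, hα' _ _ ht]

theorem carrier_subset (ℓ' : TreeLabel Φ Q) (hp : IsCoveringMap p)
    (hΦ : ∀ x, treeProj (Φ x) = p x)
    (h : (P.carrier ∩ Q.carrier).Nonempty) (hn : ℓ.node = ℓ'.node) : P.carrier ⊆ Q.carrier := by
  rintro _ ⟨u, rfl⟩
  exact ℓ.mem_carrier ℓ' hp hΦ h (by rw [ℓ.apply_eq, ← hn]; exact ⟨_, rfl⟩)

theorem node_ne (ℓ' : TreeLabel Φ Q) (hp : IsCoveringMap p)
    (hΦ : ∀ x, treeProj (Φ x) = p x)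
    (h : (P.carrier ∩ Q.carrier).Nonempty) (hne : P.carrier ≠ Q.carrier) :
    ℓ.node ≠ ℓ'.node := fun hn =>
  hne ((ℓ.carrier_subset ℓ' hp hΦ h hn).antisymm
    (ℓ'.carrier_subset ℓ hp hΦ (Set.inter_comm _ _ ▸ h) hn.symm))

theorem mem_boundaryLine (ℓ' : TreeLabel Φ Q) (hp : IsCoveringMap p)
    (hΦ : ∀ x, treeProj (Φ x) = p x)
    (h : (P.carrier ∩ Q.carrier).Nonempty) (hne : P.carrier ≠ Q.carrier) {z : P.Base} :
    z ∈ P.boundaryLine Q ↔ ℓ.isom z ∈ M.treeOfProducts.line ℓ.node ℓ'.node := by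
  constructor
  · rintro ⟨u, hu⟩
    refine ⟨0 + ℓ.shift, ℓ'.map u, ?_⟩
    rw [← ℓ'.apply_eq, hu, ℓ.apply_eq]
    rfl
  · rintro ⟨s, y, hy⟩
    obtain ⟨y', hy'⟩ := M.treeOfProducts.exists_fibre (ℓ.node_ne ℓ' hp hΦ h hne) hy (0 + ℓ.shift)
    exact ℓ.mem_carrier ℓ' hp hΦ h ⟨y', by rw [← hy', ℓ.apply_eq]; simp only [map]⟩

end TreeLabel

/-- A map to the tree which is isometric on pieces preserves the lengths of broken geodesics. -/
theorem exists_path {Φ : X → M.Tree} (ℓ : ∀ P : M.CoverPiece p, TreeLabel Φ P) {x y : X} {L : ℝ}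
    (h : BrokenGeodesic p x y L) : ∃ n, M.treeOfProducts.Path n (Φ x) (Φ y) L := by
  induction h with
  | refl => exact ⟨0, .nil _⟩
  | step P u v _ ih =>
    obtain ⟨n, hn⟩ := ih
    rw [(ℓ P).apply_eq] at hn ⊢
    rw [← (ℓ P).pdist_map]
    exact ⟨_, hn.trans (.single _ _ _)⟩

end TreeLabel

end FlipManifold

namespace FlipManifold

variable {M : FlipManifold}

/-! ### Special paths are quasi-geodesics -/

section SpecialPath

variable {X : Type*} [TopologicalSpace X] {p : X → M.Total} {Φ : X → M.Tree}

theorem exists_path_of_coverDist_le (ℓ : ∀ P : M.CoverPiece p, TreeLabel Φ P) {x y : X} {D : ℝ}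
    (hD : 0 ≤ D) (h : coverDist p x y ≤ ENNReal.ofReal D) {ε : ℝ} (hε : 0 < ε) :
    ∃ n, ∃ L ≤ D + ε, M.treeOfProducts.Path n (Φ x) (Φ y) L := by
  obtain ⟨L, hL, hb⟩ := (coverDist_le_ofReal_iff hD).1 h ε hε
  obtain ⟨n, hn⟩ := exists_path ℓ hb
  exact ⟨n, L, hL, hn⟩

/-- A geodesic between two points of a piece stays in this piece, and divides the distance of its
endpoints there. -/
theorem exists_of_isGeodesic (ℓ : ∀ P : M.CoverPiece p, TreeLabel Φ P) {P : M.CoverPiece p}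
    {u v : P.Base × ℝ} {γ : ℝ → X} {a b : ℝ} (h : IsGeodesic p γ a b (P.toFun u) (P.toFun v))
    {s : ℝ} (hs : s ∈ Set.Icc a b) :
    ∃ y, Φ (γ s) = M.treeOfProducts.emb (ℓ P).node y ∧ pdist ((ℓ P).map u) y = s - a ∧
      pdist y ((ℓ P).map v) = b - s ∧ pdist ((ℓ P).map u) ((ℓ P).map v) = b - a := by
  obtain ⟨hab, ha, hb, hγ⟩ := h
  have h1 := (hγ a ⟨le_rfl, hab⟩ s hs).le
  have h2 := (hγ s hs b ⟨hab, le_rfl⟩).le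
  have h3 := hγ a ⟨le_rfl, hab⟩ b ⟨hab, le_rfl⟩
  rw [ha, abs_sub_comm, abs_of_nonneg (sub_nonneg.2 hs.1)] at h1
  rw [hb, abs_sub_comm, abs_of_nonneg (sub_nonneg.2 hs.2)] at h2
  rw [ha, hb, abs_sub_comm, abs_of_nonneg (sub_nonneg.2 hab)] at h3
  have h4 : b - a ≤ pdist ((ℓ P).map u) ((ℓ P).map v) := by
    rw [(ℓ P).pdist_map]
    exact (ENNReal.ofReal_le_ofReal_iff (Real.sqrt_nonneg _)).1
      (h3.symm.le.trans (iInf₂_le _ (.single P u v)))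
  have p1 := fun ε hε => exists_path_of_coverDist_le ℓ (sub_nonneg.2 hs.1) h1 (ε := ε) hε
  have p2 := fun ε hε => exists_path_of_coverDist_le ℓ (sub_nonneg.2 hs.2) h2 (ε := ε) hε
  simp only [(ℓ P).apply_eq] at p1 p2
  obtain ⟨y, hy⟩ : Φ (γ s) ∈ Set.range (M.treeOfProducts.emb (ℓ P).node) := by
    refine TreeOfProducts.mem_range_of_geodesic (T := M.treeOfProducts) (x := (ℓ P).map u) (y := (ℓ P).map v)
      fun ε hε => ?_
    obtain ⟨n₁, L₁, hL₁, q1⟩ := p1 (ε / 2) (by positivity)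
    obtain ⟨n₂, L₂, hL₂, q2⟩ := p2 (ε / 2) (by positivity)
    exact ⟨n₁, n₂, L₁, L₂, q1, q2, by linarith⟩
  rw [← hy] at p1 p2
  have e1 : pdist ((ℓ P).map u) y ≤ s - a := le_of_forall_pos_le_add fun ε hε => by
    obtain ⟨n₁, L₁, hL₁, q1⟩ := p1 ε hε
    exact q1.pdist_le.trans hL₁
  have e2 : pdist y ((ℓ P).map v) ≤ b - s := le_of_forall_pos_le_add fun ε hε => by
    obtain ⟨n₁, L₁, hL₁, q1⟩ := p2 ε hε
    exact q1.pdist_le.trans hL₁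
  have e3 := pdist_triangle ((ℓ P).map u) y ((ℓ P).map v)
  exact ⟨y, hy.symm, by linarith, by linarith, by linarith⟩

/-- The turning points of a special path, in the coordinates of the pieces of the tree. -/
theorem turning_of_isTurningData (hp : IsCoveringMap p) (hΦ : ∀ x, treeProj (Φ x) = p x)
    (ℓ : ∀ P : M.CoverPiece p, TreeLabel Φ P) {x y : X} {n : ℕ} {P : ℕ → M.CoverPiece p}
    {a b : ∀ k, (P k).Base} (hinj : Set.InjOn (fun k => (P k).carrier) (Set.Iic n))
    (h : IsTurningData x y n P a b) {ξ : ℕ → X} {η θ : ℕ → ℝ}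
    (hη : ∀ k ≤ n, (P k).toFun (a k, η k) = ξ k)
    (hθ : ∀ k ≤ n, (P k).toFun (b k, θ k) = ξ (k + 1)) :
    M.treeOfProducts.Turning n (fun k => (ℓ (P k)).node) (fun k => (ℓ (P k)).isom (a k))
      (fun k => (ℓ (P k)).isom (b k)) (fun k => η k + (ℓ (P k)).shift)
      (fun k => θ k + (ℓ (P k)).shift) := by
  have hmeet : ∀ k < n, ((P k).carrier ∩ (P (k + 1)).carrier).Nonempty := fun k hk =>
    ⟨ξ (k + 1), ⟨_, hθ k hk.le⟩, ⟨_, hη (k + 1) hk⟩⟩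
  have hcar : ∀ k l, k ≤ n → l ≤ n → k ≠ l → (P k).carrier ≠ (P l).carrier :=
    fun k l hk hl hkl e => hkl (hinj hk hl e)
  have hright : ∀ k < n, ∀ z, z ∈ (P k).boundaryLine (P (k + 1)) ↔
      (ℓ (P k)).isom z ∈ M.treeOfProducts.line (ℓ (P k)).node (ℓ (P (k + 1))).node :=
    fun k hk z => (ℓ (P k)).mem_boundaryLine _ hp hΦ (hmeet k hk) (hcar _ _ (by omega) hk (by omega))
  have hleft : ∀ k < n, ∀ z, z ∈ (P (k + 1)).boundaryLine (P k) ↔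
      (ℓ (P (k + 1))).isom z ∈ M.treeOfProducts.line (ℓ (P (k + 1))).node (ℓ (P k)).node :=
    fun k hk z => (ℓ (P (k + 1))).mem_boundaryLine _ hp hΦ (Set.inter_comm _ _ ▸ hmeet k hk)
      (hcar _ _ hk (by omega) (by omega))
  constructor
  · exact fun k hk => (ℓ (P k)).node_ne _ hp hΦ (hmeet k hk) (hcar _ _ (by omega) hk (by omega))
  · intro k hk e
    -- the wall between `P k` and `P (k + 1)` would also be the one between `P (k + 1)` and `P (k + 2)`
    have h1 : ξ (k + 1) ∈ (P (k + 2)).carrier := by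
      rw [← hη (k + 1) (by omega)]
      refine (ℓ (P (k + 1))).mem_carrier (ℓ (P (k + 2))) hp hΦ (hmeet (k + 1) hk) ?_
      rw [hη (k + 1) (by omega), ← hθ k (by omega), (ℓ (P k)).apply_eq, ← e]
      exact ⟨_, rfl⟩
    exact (ℓ (P k)).node_ne (ℓ (P (k + 2))) hp hΦ ⟨ξ (k + 1), ⟨_, hθ k (by omega)⟩, h1⟩
      (hcar _ _ (by omega) hk (by omega)) e
  · intro k hk
    refine ((ℓ (P k)).apply_eq (b k, θ k)).symm.trans ?_
    rw [hθ k hk.le, ← hη (k + 1) hk, (ℓ (P (k + 1))).apply_eq]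
    rfl
  · intro k hk u hu
    obtain ⟨z, rfl⟩ := (ℓ (P k)).isom.surjective u
    rw [(ℓ (P k)).isom.dist_eq, (ℓ (P k)).isom.dist_eq]
    have hz := (hright k hk z).2 hu
    rcases k with _ | k
    · exact h.start_closest z hz
    · exact h.shortest k hk _ (h.left_mem k (by omega)) z hz
  · intro k hk u hu
    obtain ⟨z, rfl⟩ := (ℓ (P (k + 1))).isom.surjective u
    rw [(ℓ (P (k + 1))).isom.dist_eq, (ℓ (P (k + 1))).isom.dist_eq]
    have hz := (hleft k hk z).2 hu
    rcases eq_or_ne (k + 1) n with e | e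
    · exact h.finish_closest k e z hz
    · exact h.shortest k (by omega) z hz _ (h.right_mem (k + 1) (by omega))
  · intro k hk u hu u' hu'
    obtain ⟨z, rfl⟩ := (ℓ (P (k + 1))).isom.surjective u
    obtain ⟨z', rfl⟩ := (ℓ (P (k + 1))).isom.surjective u'
    rw [(ℓ (P (k + 1))).isom.dist_eq, (ℓ (P (k + 1))).isom.dist_eq]
    exact h.shortest k hk z ((hleft k (by omega) z).2 hu) z' ((hright (k + 1) hk z').2 hu')

theorem exists_mem_Icc_of_subdivision {r : ℕ → ℝ} {n : ℕ} {s : ℝ} (h0 : r 0 ≤ s)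
    (h : s ≤ r (n + 1)) : ∃ k ≤ n, s ∈ Set.Icc (r k) (r (k + 1)) := by
  induction n with
  | zero => exact ⟨0, le_rfl, h0, h⟩
  | succ n ih =>
    rcases le_total s (r (n + 1)) with h1 | h1
    · obtain ⟨k, hk, hs⟩ := ih h1
      exact ⟨k, by omega, hs⟩
    · exact ⟨n + 1, le_rfl, h1, h⟩

/-- The lower bound for a special path through several pieces, at parameters in different pieces. -/
theorem mul_sub_le_coverDist (hp : IsCoveringMap p) (hΦ : ∀ x, treeProj (Φ x) = p x)
    (ℓ : ∀ P : M.CoverPiece p, TreeLabel Φ P) {x y : X} {n : ℕ} {P : ℕ → M.CoverPiece p}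
    {a b : ∀ k, (P k).Base} (hinj : Set.InjOn (fun k => (P k).carrier) (Set.Iic n))
    (h : IsTurningData x y n P a b) {ξ : ℕ → X} (hξ : ∀ k ≤ n, ∃ t, (P k).toFun (a k, t) = ξ k)
    (hξ' : ∀ k ≤ n, ∃ t, (P k).toFun (b k, t) = ξ (k + 1)) {γ : ℝ → X} {r : ℕ → ℝ}
    (hγ : ∀ k ≤ n, IsGeodesic p γ (r k) (r (k + 1)) (ξ k) (ξ (k + 1))) {i j : ℕ} (hij : i < j)
    (hj : j ≤ n) {s t : ℝ} (hs : s ∈ Set.Icc (r i) (r (i + 1)))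
    (ht : t ∈ Set.Icc (r j) (r (j + 1))) :
    ENNReal.ofReal ((max M.treeOfProducts.C 3 + 1)⁻¹ * (t - s)) ≤ coverDist p (γ s) (γ t) := by
  choose! η hη using hξ
  choose! θ hθ using hξ'
  have S := turning_of_isTurningData hp hΦ ℓ hinj h hη hθ
  have hgeo : ∀ k ≤ n, IsGeodesic p γ (r k) (r (k + 1)) ((P k).toFun (a k, η k))
      ((P k).toFun (b k, θ k)) := fun k hk => by
    rw [hη k hk, hθ k hk]; exact hγ k hk
  obtain ⟨A, hA, hA₁, hA₂, hA₃⟩ := exists_of_isGeodesic ℓ (hgeo i (by omega)) hs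
  obtain ⟨B, hB, hB₁, hB₂, hB₃⟩ := exists_of_isGeodesic ℓ (hgeo j hj) ht
  refine le_iInf₂ fun L hL => ENNReal.ofReal_le_ofReal ?_
  obtain ⟨m, hm⟩ := exists_path ℓ hL
  rw [hA, hB] at hm
  have key := S.length_le hij hj (dist_add_dist_eq_of_pdist (x := (ℓ (P i)).map (a i, η i))
    (y := (ℓ (P i)).map (b i, θ i)) (by linarith))
    (dist_add_dist_eq_of_pdist (x := (ℓ (P j)).map (a j, η j)) (y := (ℓ (P j)).map (b j, θ j))
      (by linarith)) hm
  have hsum : ∑ l ∈ Finset.Ico (i + 1) j, pdist ((ℓ (P l)).map (a l, η l))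
      ((ℓ (P l)).map (b l, θ l)) = r j - r (i + 1) := by
    rw [← Finset.sum_Ico_sub r hij]
    refine Finset.sum_congr rfl fun l hl => ?_
    have hl' := Finset.mem_Ico.1 hl
    obtain ⟨_, -, -, -, hd⟩ := exists_of_isGeodesic ℓ (hgeo l (by omega))
      ⟨le_rfl, (hgeo l (by omega)).1⟩
    exact hd
  have e1 : pdist A ((ℓ (P i)).map (b i, θ i)) +
      ∑ l ∈ Finset.Ico (i + 1) j, pdist ((ℓ (P l)).map (a l, η l)) ((ℓ (P l)).map (b l, θ l)) +
      pdist ((ℓ (P j)).map (a j, η j)) B ≤ (max M.treeOfProducts.C 3 + 1) * L := key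
  rw [hsum, hA₂, hB₁] at e1
  rw [inv_mul_le_iff₀ (by positivity)]
  linarith

end SpecialPath

end FlipManifold

theorem propositionA6 (M : FlipManifold) :
    ∃ c : ℝ, 1 ≤ c ∧
      ∀ (X : Type*) [TopologicalSpace X] [SimplyConnectedSpace X] (p : X → M.Total),
        IsCoveringMap p → Function.Surjective p →
          ∀ (x y : X) (L : ℝ) (γ : ℝ → X), FlipManifold.IsSpecialPath p x y L γ →
            FlipManifold.IsQuasiGeodesic p c c γ 0 L := by
  have hc1 : 1 ≤ max M.treeOfProducts.C 3 + 1 := by linarith [le_max_right M.treeOfProducts.C 3]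
  refine ⟨max M.treeOfProducts.C 3 + 1, hc1, ?_⟩
  intro X _ _ p hp _ x y L γ hγ
  set c := max M.treeOfProducts.C 3 + 1 with hc
  -- special paths are even bi-Lipschitz: no additive constant is needed
  suffices H : ∀ s t, 0 ≤ s → s ≤ t → t ≤ L →
      ENNReal.ofReal (c⁻¹ * (t - s)) ≤ FlipManifold.coverDist p (γ s) (γ t) ∧
        FlipManifold.coverDist p (γ s) (γ t) ≤ ENNReal.ofReal (t - s) by
    have H' : ∀ s t, 0 ≤ s → s ≤ t → t ≤ L →
        ENNReal.ofReal (c⁻¹ * (t - s) - c) ≤ FlipManifold.coverDist p (γ s) (γ t) ∧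
          FlipManifold.coverDist p (γ s) (γ t) ≤ ENNReal.ofReal (c * (t - s) + c) := by
      intro s t hs hst ht
      obtain ⟨h1, h2⟩ := H s t hs hst ht
      exact ⟨(ENNReal.ofReal_le_ofReal (by linarith)).trans h1,
        h2.trans (ENNReal.ofReal_le_ofReal (by nlinarith))⟩
    intro s hs t ht
    rcases le_total s t with hst | hst
    · rw [abs_sub_comm, abs_of_nonneg (sub_nonneg.2 hst)]
      exact H' s t hs.1 hst ht.2
    · rw [abs_of_nonneg (sub_nonneg.2 hst), FlipManifold.coverDist_comm]
      exact H' t s ht.1 hst hs.2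
  have hinv : ∀ d : ℝ, 0 ≤ d → c⁻¹ * d ≤ d := fun d hd =>
    mul_le_of_le_one_left hd (inv_le_one_of_one_le₀ hc1)
  have hdist : ∀ {a b : ℝ} {x y : X}, FlipManifold.IsGeodesic p γ a b x y → ∀ s t, a ≤ s → s ≤ t →
      t ≤ b → FlipManifold.coverDist p (γ s) (γ t) = ENNReal.ofReal (t - s) := by
    intro a b x y h s t hs hst ht
    rw [h.2.2.2 s ⟨hs, hst.trans ht⟩ t ⟨hs.trans hst, ht⟩, abs_sub_comm,
      abs_of_nonneg (sub_nonneg.2 hst)]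
  rcases hγ with ⟨-, hγ⟩ | ⟨-, n, P, a, b, ξ, r, hn, ⟨hinj, -⟩, hdata, h0, hn', hξ, hr0, hrn, hγ⟩
  · intro s t hs hst ht
    rw [hdist hγ s t hs hst ht]
    exact ⟨ENNReal.ofReal_le_ofReal (hinv _ (sub_nonneg.2 hst)), le_rfl⟩
  obtain ⟨Φ, hΦc, hΦ⟩ := FlipManifold.exists_lift_to_tree hp
  have ℓ : ∀ P : M.CoverPiece p, FlipManifold.TreeLabel Φ P := fun P =>
    (FlipManifold.nonempty_treeLabel hΦc hΦ P).some
  have hξa : ∀ k ≤ n, ∃ t, (P k).toFun (a k, t) = ξ k := by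
    rintro (_ | k) hk
    · rw [h0]; exact hdata.start
    · exact (hξ k hk).2
  have hξb : ∀ k ≤ n, ∃ t, (P k).toFun (b k, t) = ξ (k + 1) := by
    intro k hk
    rcases hk.lt_or_eq with hk | rfl
    · exact (hξ k hk).1
    · rw [hn']; exact hdata.finish
  have hmono : ∀ k < n + 1, r k ≤ r (k + 1) := fun k hk => (hγ k (by omega)).1
  intro s t hs hst ht
  rw [← hr0] at hs
  rw [← hrn] at ht
  refine ⟨?_, FlipManifold.coverDist_le_sub hmono (fun k hk s hs t ht hst =>
    (hdist (hγ k (by omega)) s t hs.1 hst ht.2).le) hs hst ht⟩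
  obtain ⟨i, hi, hsi⟩ := FlipManifold.exists_mem_Icc_of_subdivision hs (hst.trans ht)
  obtain ⟨j, hj, htj⟩ := FlipManifold.exists_mem_Icc_of_subdivision (hs.trans hst) ht
  rcases lt_trichotomy i j with hij | rfl | hij
  · exact FlipManifold.mul_sub_le_coverDist hp hΦ ℓ hinj hdata hξa hξb hγ hij hj hsi htj
  · rw [hdist (hγ i hi) s t hsi.1 hst htj.2]
    exact ENNReal.ofReal_le_ofReal (hinv _ (sub_nonneg.2 hst))
  · -- here `s = t` is a common endpoint of intervals of the subdivision
    have : ∀ m, j + 1 ≤ m → m ≤ n → r (j + 1) ≤ r m := fun m hm => by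
      induction m, hm using Nat.le_induction with
      | base => exact fun _ => le_rfl
      | succ m hm ih => exact fun hmn => (ih (by omega)).trans (hmono m (by omega))
    have := this i hij hi
    have hts : t - s ≤ 0 := by linarith [hsi.1, htj.2]
    rw [ENNReal.ofReal_of_nonpos (mul_nonpos_of_nonneg_of_nonpos (by positivity) hts)]
    exact zero_le
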